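/- Let $n\ge 2$, let $\{E_{rs}\}$ be the elementary matrices in $\mathfrak{gl}(n)=\mathfrak{gl}(n,\mathbb C)$, and $U=U(\mathfrak{gl}(n))$. Vectors $v\in\mathbb C^{n(n+1)/2}$ are written as arrays $(v_{rs})_{1\le s\le r\le n}$; $\mathbb Z^{n(n-1)/2}$ is regarded as the set of integral arrays with zero $n$-th row; $\delta^{rs}$ is the array with entry $1$ at $(r,s)$ and $0$ elsewhere. For a variable vector $v$ let $T(v)$ be a formal symbol, and let the Gelfand–Tsetlin formulas be $$E_{m,m+1}T(v)=-\sum_{s=1}^{m}\frac{\prod_{t=1}^{m+1}(v_{ms}-v_{m+1,t})}{\prod_{t\ne s}(v_{ms}-v_{mt})}T(v+\delta^{ms}),\qquad E_{m+1,m}T(v)=\sum_{s=1}^{m}\frac{\prod_{t=1}^{m-1}(v_{ms}-v_{m-1,t})}{\prod_{t\ne s}(v_{ms}-v_{mt})}T(v-\delta^{ms}),$$ $$E_{mm}T(v)=\Big(m-1+\sum_{s=1}^{m}v_{ms}-\sum_{s=1}^{m-1}v_{m-1,s}\Big)T(v).$$ Fix $1\le i<j\le k\le n-1$ and a $1$-singular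 vector $\bar v$: $\bar v_{ki}=\bar v_{kj}$, and $\bar v_{rs}-\bar v_{rt}\notin\mathbb Z$ for all $1\le s<t\le r\le n-1$ with $(r,s,t)\ne(k,i,j)$. Let $\tau$ exchange the entries $(k,i)$ and $(k,j)$ of an array. Let $V(T(\bar v))$ be the complex vector space spanned by symbols $T(\bar v+w)$, $\mathcal DT(\bar v+w)$, $w\in\mathbb Z^{n(n-1)/2}$, subject to the relations $T(\bar v+w)=T(\bar v+\tau(w))$ and $\mathcal DT(\bar v+w)+\mathcal DT(\bar v+\tau(w))=0$, with basis $\{Tab(w): w\in\mathbb Z^{n(n-1)/2}\}$, where $Tab(w)=T(\bar v+w)$ if $w_{ki}-w_{kj}\le 0$ and $Tab(w)=\mathcal DT(\bar v+w)$ if $w_{ki}-w_{kj}>0$. For a rational function $f$ of $v$ that is smooth at $\bar v$ (after removing removable singularities along $v_{ki}=v_{kj}$), put $\mathcal D^{\bar v}(f)=\frac12\big(\frac{\partial f}{\partial v_{ki}}-\frac{\partial f}{\partial v_{kj}}\big)(\bar v)$ and $\mathcal D^{\bar v}(f\,T(v+z))=\mathcal D^{\bar v}(f)\,T(\bar v+z)+f(\bar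 v)\,\mathcal DT(\bar v+z)$, extended additively. Then $V(T(\bar v))$ has exactly one structure of $U$-module in which the generators $E_{rs}$, $|r-s|\le 1$, act by $$E_{rs}T(\bar v+z)=\mathcal D^{\bar v}\big((v_{ki}-v_{kj})E_{rs}T(v+z)\big),\qquad E_{rs}\,\mathcal DT(\bar v+z')=\mathcal D^{\bar v}\big(E_{rs}T(v+z')\big)$$ for all $z,z'\in\mathbb Z^{n(n-1)/2}$ with $z'\ne\tau(z')$. With this structure, write $Tab(z)\prec Tab(w)$ if there is $u\in U$ such that $Tab(w)$ occurs with nonzero coefficient in the expansion of $u\cdot Tab(z)$ in the basis above. Then: (1) If $Tab(z)\prec Tab(w)$, then there is $u'\in U$ with $u'\cdot Tab(z)=Tab(w)$. (2) The relation $\prec$ is a preorder (reflexive and transitive) on $\{Tab(w): w\in\mathbb Z^{n(n-1)/2}\}$. -/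

import Mathlib

-- `Matrix (Fin n) (Fin n) ℂ` and other associative algebras carry the commutator bracket.
attribute [local instance 100] LieRing.ofAssociativeRing

noncomputable section

namespace SingularGT

/-- Positions of a triangular Gelfand-Tsetlin array with rows of lengths `1, ..., n`.
The position `⟨r, c⟩` is the entry written `v_{r+1,c+1}` in the usual numbering from one. -/
abbrev Pos (n : ℕ) : Type := Σ r : Fin n, Fin (r.val + 1)

/-- The row number of a position, counted from one (row `n` is the top row). -/
def Pos.row {n : ℕ} (p : Pos n) : ℕ := p.1.val + 1

/-- The column number of a position, counted from one. -/
def Pos.col {n : ℕ} (p : Pos n) : ℕ := p.2.val + 1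

/-- Positions below the top row. -/
abbrev LPos (n : ℕ) : Type := {p : Pos n // p.row < n}

/-- The vectors of `ℂ^{n(n+1)/2}`, i.e. the Gelfand-Tsetlin tableaux. -/
abbrev Vec (n : ℕ) : Type := Pos n → ℂ

/-- The integral shifts, `ℤ^{n(n-1)/2}`. -/
abbrev Shift (n : ℕ) : Type := LPos n → ℤ

/-- `v + z`, where the shift `z` is extended by zero to the top row. -/
def addShift {n : ℕ} (v : Vec n) (z : Shift n) : Vec n :=
  fun p => v p + (if h : p.row < n then (z ⟨p, h⟩ : ℂ) else 0)

/-- The positions of the `m`-th row (counted from one; empty for `m = 0`). -/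
def rowSet (n m : ℕ) : Finset (Pos n) := Finset.univ.filter (fun p => p.row = m)

/-- The coefficient of `T(v + δ^p)` in `E_{m,m+1} T(v)`, where `m` is the row of `p`. -/
def raiseCoeff {n : ℕ} (p : Pos n) (v : Vec n) : ℂ :=
  -((∏ q ∈ rowSet n (p.row + 1), (v p - v q)) /
    ∏ q ∈ (rowSet n p.row).erase p, (v p - v q))

/-- The coefficient of `T(v - δ^p)` in `E_{m+1,m} T(v)`, where `m` is the row of `p`. -/
def lowerCoeff {n : ℕ} (p : Pos n) (v : Vec n) : ℂ :=
  (∏ q ∈ rowSet n (p.row - 1), (v p - v q)) /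
    ∏ q ∈ (rowSet n p.row).erase p, (v p - v q)

/-- The eigenvalue of `E_{mm}` on `T(v)` (`m` counted from one). -/
def diagCoeff {n : ℕ} (m : ℕ) (v : Vec n) : ℂ :=
  (m : ℂ) - 1 + ∑ q ∈ rowSet n m, v q - ∑ q ∈ rowSet n (m - 1), v q

/-- The Gelfand-Tsetlin formulas. For a generator `E_{rs}` of `gl(n)` (that is, `|r - s| ≤ 1`;
`r` and `s` are counted from zero here), the value at `y` of `gtFormula r s z` is the coefficient
of `T(v + y)` in `E_{rs} T(v + z)`, as a function of the variable vector `v`.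
The value for `|r - s| > 1` is not used. -/
def gtFormula {n : ℕ} (r s : Fin n) (z : Shift n) : Shift n →₀ (Vec n → ℂ) :=
  if r.val + 1 = s.val then
    ∑ p : LPos n with p.1.row = r.val + 1,
      Finsupp.single (z + Pi.single p 1) (fun v => raiseCoeff p.1 (addShift v z))
  else if s.val + 1 = r.val then
    ∑ p : LPos n with p.1.row = s.val + 1,
      Finsupp.single (z - Pi.single p 1) (fun v => lowerCoeff p.1 (addShift v z))
  else if r = s then
    Finsupp.single z (fun v => diagCoeff (r.val + 1) (addShift v z))
  else 0

/-- `v` is `1`-singular, the singular pair of positions being `(a, b)` (in one row below the top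
row, `a` to the left of `b`), and normalized by `v_a = v_b`. -/
structure IsOneSingular {n : ℕ} (a b : LPos n) (v : Vec n) : Prop where
  row_eq : a.1.row = b.1.row
  col_lt : a.1.col < b.1.col
  eq : v a.1 = v b.1
  generic : ∀ p q : LPos n, p.1.row = q.1.row → p.1.col < q.1.col → (p, q) ≠ (a, b) →
    ∀ m : ℤ, v p.1 - v q.1 ≠ m

/-- The transposition `τ` of the two singular positions, acting on shifts. -/
def tau {n : ℕ} (a b : LPos n) (z : Shift n) : Shift n := fun p => z (Equiv.swap a b p)

/-- The space `V(T(v̄))`, realized on its basis `Tab(w)`, `w ∈ ℤ^{n(n-1)/2}`. -/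
abbrev V (n : ℕ) : Type := Shift n →₀ ℂ

/-- The basis vector `Tab(w)`. -/
def Tab {n : ℕ} (w : Shift n) : V n := Finsupp.single w 1

/-- The regular tableau `T(v̄ + w)` as a vector of `V(T(v̄))`. -/
def regTab {n : ℕ} (a b : LPos n) (w : Shift n) : V n :=
  if w a ≤ w b then Tab w else Tab (tau a b w)

/-- The derivative tableau `𝒟T(v̄ + w)` as a vector of `V(T(v̄))`. -/
def derTab {n : ℕ} (a b : LPos n) (w : Shift n) : V n :=
  if w b < w a then Tab w else if w a = w b then 0 else -Tab (tau a b w)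

theorem tau_tau {n : ℕ} (a b : LPos n) (w : Shift n) : tau a b (tau a b w) = w := by
  funext p; simp [tau]

theorem tau_eq_self {n : ℕ} (a b : LPos n) (w : Shift n) (h : w a = w b) : tau a b w = w := by
  funext p
  unfold tau
  rcases eq_or_ne p a with rfl | hpa
  · rw [Equiv.swap_apply_left, h]
  · rcases eq_or_ne p b with rfl | hpb
    · rw [Equiv.swap_apply_right, h]
    · rw [Equiv.swap_apply_of_ne_of_ne hpa hpb]

/-- The defining relation `T(v̄ + τ(w)) = T(v̄ + w)`. -/
theorem regTab_tau {n : ℕ} (a b : LPos n) (w : Shift n) :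
    regTab a b (tau a b w) = regTab a b w := by
  have ha : tau a b w a = w b := by simp [tau]
  have hb : tau a b w b = w a := by simp [tau]
  unfold regTab
  rw [ha, hb, tau_tau]
  rcases lt_trichotomy (w a) (w b) with h | h | h
  · rw [if_neg (not_le.mpr h), if_pos h.le]
  · rw [if_pos h.ge, if_pos h.le, tau_eq_self a b w h]
  · rw [if_pos h.le, if_neg (not_le.mpr h)]

/-- The defining relation `𝒟T(v̄ + w) + 𝒟T(v̄ + τ(w)) = 0`. -/
theorem derTab_add_tau {n : ℕ} (a b : LPos n) (w : Shift n) :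
    derTab a b w + derTab a b (tau a b w) = 0 := by
  have ha : tau a b w a = w b := by simp [tau]
  have hb : tau a b w b = w a := by simp [tau]
  unfold derTab
  rw [ha, hb, tau_tau]
  rcases lt_trichotomy (w a) (w b) with h | h | h
  · simp [h, h.not_gt, h.ne]
  · simp [h]
  · simp [h, h.not_gt, h.ne]

/-- `Tab(w)` is `T(v̄ + w)` or `𝒟T(v̄ + w)`, according to the sign of `w_a - w_b`. -/
theorem tab_eq {n : ℕ} (a b : LPos n) (w : Shift n) :
    Tab w = if w a - w b ≤ 0 then regTab a b w else derTab a b w := by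
  unfold regTab derTab
  by_cases h : w a ≤ w b
  · simp [h]
  · simp [h, not_le.mp h]

/-- The rational function `f` with its removable singularities on the hyperplane `v_a = v_b`
removed: on that hyperplane its value is the limit of `f` from outside the hyperplane. -/
def smoothExt {n : ℕ} (a b : LPos n) (f : Vec n → ℂ) : Vec n → ℂ :=
  extendFrom {v : Vec n | v a.1 ≠ v b.1} f

/-- `𝒟^{v̄}(f) = 1/2 (∂f/∂v_a - ∂f/∂v_b)(v̄)`. -/
def scalarD {n : ℕ} (a b : LPos n) (vbar : Vec n) (f : Vec n → ℂ) : ℂ :=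
  (1 / 2) * (fderiv ℂ (smoothExt a b f) vbar (Pi.single a.1 1) -
    fderiv ℂ (smoothExt a b f) vbar (Pi.single b.1 1))

/-- `𝒟^{v̄}` on formal sums `∑_y F_y(v) T(v + y)`:
`𝒟^{v̄}(f T(v + y)) = 𝒟^{v̄}(f) T(v̄ + y) + f(v̄) 𝒟T(v̄ + y)`. -/
def opD {n : ℕ} (a b : LPos n) (vbar : Vec n) (F : Shift n →₀ (Vec n → ℂ)) : V n :=
  ∑ y ∈ F.support, (scalarD a b vbar (F y) • regTab a b y +
    smoothExt a b (F y) vbar • derTab a b y)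

/-- The multiple `(v_a - v_b) F` of a formal sum `F`. -/
def mulDiff {n : ℕ} (a b : LPos n) (F : Shift n →₀ (Vec n → ℂ)) : Shift n →₀ (Vec n → ℂ) :=
  F.mapRange (fun f v => (v a.1 - v b.1) * f v) (by funext v; simp)

/-- The universal enveloping algebra of `gl(n)`. -/
abbrev U (n : ℕ) : Type := UniversalEnvelopingAlgebra ℂ (Matrix (Fin n) (Fin n) ℂ)

/-- The generator `E_{rs}` as an element of `U(gl(n))`. -/
def E {n : ℕ} (r s : Fin n) : U n :=
  UniversalEnvelopingAlgebra.ι ℂ (Matrix.single r s (1 : ℂ))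

/-- `ρ` is the `U(gl(n))`-module structure of `V(T(v̄))`: the generators `E_{rs}`, `|r - s| ≤ 1`,
act by `E_{rs} T(v̄ + z) = 𝒟^{v̄}((v_a - v_b) E_{rs} T(v + z))` and, if `τ(z) ≠ z`, by
`E_{rs} 𝒟T(v̄ + z) = 𝒟^{v̄}(E_{rs} T(v + z))`. -/
structure IsSingularGTAction {n : ℕ} (a b : LPos n) (vbar : Vec n)
    (ρ : U n →ₐ[ℂ] Module.End ℂ (V n)) : Prop where
  reg : ∀ r s : Fin n, r.val ≤ s.val + 1 → s.val ≤ r.val + 1 → ∀ z : Shift n,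
    ρ (E r s) (regTab a b z) = opD a b vbar (mulDiff a b (gtFormula r s z))
  der : ∀ r s : Fin n, r.val ≤ s.val + 1 → s.val ≤ r.val + 1 → ∀ z : Shift n, tau a b z ≠ z →
    ρ (E r s) (derTab a b z) = opD a b vbar (gtFormula r s z)

/-- `Tab(z) ≺ Tab(w)`: for some `u ∈ U(gl(n))`, the basis vector `Tab(w)` occurs with nonzero
coefficient in `u · Tab(z)`. -/
def Prec {n : ℕ} (ρ : U n →ₐ[ℂ] Module.End ℂ (V n)) (z w : Shift n) : Prop :=
  ∃ u : U n, (ρ u (Tab z)) w ≠ 0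

end SingularGT

end

/-!
The module structure on `V(T(v̄))` is a limit of generic Gelfand–Tsetlin modules. For small `t ≠ 0`
the vector `v̄ + t (δ^a - δ^b)` is generic, and at a generic vector the Gelfand–Tsetlin formulas
define a representation: they satisfy the Chevalley–Serre relations (`isSerreSystem_generic`), from
which the commutation relations of all matrix units follow by induction on the rank
(`isUnitSystem_unitOf`). The relation between a raising and a lowering operator is the residue
theorem for a rational function whose poles are the entries of a row and their shifts by one
(`lie_raiseOp_lowerOp`). In the basis `T(v + z) + T(v + τ(z))`, `(T(v + z) - T(v + τ(z))) / 2t` the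
actions of the generators converge as `t → 0`, and the limits are the formulas with `𝒟^{v̄}`: the
even part of a function of `t` tends to its value and the odd part, divided by `t`, to its
derivative (`hasLim_reg`, `hasLim_der`). A limit of representations is a representation, which
gives existence (`exists_singular_action`); uniqueness holds because the `E_{rs}` with
`|r - s| ≤ 1` generate `U(gl(n))`.

For the relation `≺`, it suffices that every submodule contains each basis vector that occurs in one
of its elements (`IsGenericLimit.Tab_mem`). For every row `m` and every number `c` there is an
element of `U(gl(n))` that acts on all generic modules by `T(v) ↦ ∏_q (c - v_q) T(v)`, the product
being over the row (`eval_rowPoly_mem`); this is proved by induction on `m`, as commutators of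
weighted raising operators with lowering operators have eigenvalues that determine the symmetric
functions of a row from those of the two rows below. In the limit such an element acts on
`T(v̄ + z)` by the scalar `γ(v̄ + z)`, for `γ` the product, and maps `𝒟T(v̄ + z)` to
`γ(v̄ + z) 𝒟T(v̄ + z) + 𝒟^{v̄}(γ(v + z)) T(v̄ + z)` (`IsGenericLimit.exists_jordan`). These scalars
determine `z` up to `τ` (`exists_rowEval_ne`), so a submodule contains the components of its
elements in the span of `Tab(z)` and `Tab(τ(z))`. If `z_a ≠ z_b`, the number `c = (v̄ + z)_a` is a
simple zero of the polynomial of its row, hence `𝒟^{v̄}(γ(v + z)) ≠ 0` for this choice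
(`scalarD_rowEval_ne_zero`), and the Jordan block separates `T(v̄ + z)` from `𝒟T(v̄ + z)`.
-/

/-! ### The Chevalley–Serre presentation -/

namespace SingularGT

section Serre

variable {L : Type*} [LieRing L]

/-- The Chevalley–Serre relations of `gl(n)` for elements `e m = E_{m,m+1}`, `f m = E_{m+1,m}`
(`m + 1 < n`) and `h m = E_{m,m}` (`m < n`) of a Lie ring; indices are counted from zero and
values at larger indices are irrelevant. -/
structure IsSerreSystem (n : ℕ) (e f h : ℕ → L) : Prop where
  hh : ∀ i j, i < n → j < n → ⁅h i, h j⁆ = 0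
  he_self : ∀ m, m + 1 < n → ⁅h m, e m⁆ = e m
  he_succ : ∀ m, m + 1 < n → ⁅h (m + 1), e m⁆ = -e m
  he_ne : ∀ i m, i < n → m + 1 < n → i ≠ m → i ≠ m + 1 → ⁅h i, e m⁆ = 0
  hf_self : ∀ m, m + 1 < n → ⁅h m, f m⁆ = -f m
  hf_succ : ∀ m, m + 1 < n → ⁅h (m + 1), f m⁆ = f m
  hf_ne : ∀ i m, i < n → m + 1 < n → i ≠ m → i ≠ m + 1 → ⁅h i, f m⁆ = 0
  ef_self : ∀ m, m + 1 < n → ⁅e m, f m⁆ = h m - h (m + 1)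
  ef_ne : ∀ m l, m + 1 < n → l + 1 < n → m ≠ l → ⁅e m, f l⁆ = 0
  ee_far : ∀ m l, m + 1 < l → l + 1 < n → ⁅e m, e l⁆ = 0
  ff_far : ∀ m l, m + 1 < l → l + 1 < n → ⁅f m, f l⁆ = 0
  ee_lo : ∀ m, m + 2 < n → ⁅e m, ⁅e m, e (m + 1)⁆⁆ = 0
  ee_hi : ∀ m, m + 2 < n → ⁅e (m + 1), ⁅e (m + 1), e m⁆⁆ = 0
  ff_lo : ∀ m, m + 2 < n → ⁅f m, ⁅f m, f (m + 1)⁆⁆ = 0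
  ff_hi : ∀ m, m + 2 < n → ⁅f (m + 1), ⁅f (m + 1), f m⁆⁆ = 0

/-- The Chevalley involution `E_{rs} ↦ -E_{sr}` preserves the relations. -/
theorem IsSerreSystem.neg_swap {n : ℕ} {e f h : ℕ → L} (H : IsSerreSystem n e f h) :
    IsSerreSystem n (fun m => -f m) (fun m => -e m) (fun m => -h m) where
  hh i j hi hj := by simp [H.hh i j hi hj]
  he_self m hm := by simp [H.hf_self m hm]
  he_succ m hm := by simp [H.hf_succ m hm]
  he_ne i m hi hm h1 h2 := by simp [H.hf_ne i m hi hm h1 h2]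
  hf_self m hm := by simp [H.he_self m hm]
  hf_succ m hm := by simp [H.he_succ m hm]
  hf_ne i m hi hm h1 h2 := by simp [H.he_ne i m hi hm h1 h2]
  ef_self m hm := by
    simp only [lie_neg, neg_lie, neg_neg]
    rw [← lie_skew, H.ef_self m hm]
    abel
  ef_ne m l hm hl hml := by
    simp only [lie_neg, neg_lie, neg_neg]
    rw [← lie_skew, H.ef_ne l m hl hm hml.symm, neg_zero]
  ee_far m l h1 h2 := by simp [H.ff_far m l h1 h2]
  ff_far m l h1 h2 := by simp [H.ee_far m l h1 h2]
  ee_lo m hm := by simp [H.ff_lo m hm]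
  ee_hi m hm := by simp [H.ff_hi m hm]
  ff_lo m hm := by simp [H.ee_lo m hm]
  ff_hi m hm := by simp [H.ee_hi m hm]

/-- The iterated commutator `[[e i, e (i+1)], …, e (j-1)]`, which is `E_{ij}` for `i < j`; it is
zero for `j ≤ i`. -/
def raiseRoot (e : ℕ → L) (i : ℕ) : ℕ → L
  | 0 => 0
  | j + 1 => if i = j then e j else ⁅raiseRoot e i j, e j⁆

/-- The iterated commutator `[f (j-1), …, [f (i+1), f i]]`, which is `E_{ji}` for `i < j`; it is
zero for `j ≤ i`. -/
def lowerRoot (f : ℕ → L) (i : ℕ) : ℕ → L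
  | 0 => 0
  | j + 1 => if i = j then f j else ⁅f j, lowerRoot f i j⁆

/-- The element `E_{ij}` built from the Chevalley generators. -/
def unitOf (e f h : ℕ → L) (i j : ℕ) : L :=
  if i < j then raiseRoot e i j else if i = j then h i else lowerRoot f j i

theorem lowerRoot_neg (e : ℕ → L) (i j : ℕ) :
    lowerRoot (fun m => -e m) i j = -raiseRoot e i j := by
  induction j with
  | zero => simp [lowerRoot, raiseRoot]
  | succ j ih =>
    unfold lowerRoot raiseRoot
    split_ifs with h
    · rfl
    · rw [ih, lie_neg, neg_lie, neg_neg, ← lie_skew]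

theorem raiseRoot_neg (f : ℕ → L) (i j : ℕ) :
    raiseRoot (fun m => -f m) i j = -lowerRoot f i j := by
  induction j with
  | zero => simp [lowerRoot, raiseRoot]
  | succ j ih =>
    unfold lowerRoot raiseRoot
    split_ifs with h
    · rfl
    · rw [ih, lie_neg, neg_lie, neg_neg, ← lie_skew]

theorem unitOf_neg_swap (e f h : ℕ → L) (i j : ℕ) :
    unitOf (fun m => -f m) (fun m => -e m) (fun m => -h m) i j = -unitOf e f h j i := by
  unfold unitOf
  rcases lt_trichotomy i j with hij | rfl | hij
  · simp [hij, hij.not_gt, hij.ne', raiseRoot_neg]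
  · simp
  · simp [hij, hij.not_gt, hij.ne', lowerRoot_neg]

theorem lie_raiseRoot_eq_zero {e : ℕ → L} {x : L} (i : ℕ) {j : ℕ}
    (hx : ∀ l < j, ⁅x, e l⁆ = 0) : ⁅x, raiseRoot e i j⁆ = 0 := by
  induction j with
  | zero => simp [raiseRoot]
  | succ j ih =>
    unfold raiseRoot
    split_ifs
    · exact hx j (Nat.lt_succ_self j)
    · rw [leibniz_lie, ih fun l hl => hx l (by omega), hx j (Nat.lt_succ_self j)]
      simp

theorem lie_lowerRoot_eq_zero {f : ℕ → L} {x : L} (i : ℕ) {j : ℕ}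
    (hx : ∀ l < j, ⁅x, f l⁆ = 0) : ⁅x, lowerRoot f i j⁆ = 0 := by
  induction j with
  | zero => simp [lowerRoot]
  | succ j ih =>
    unfold lowerRoot
    split_ifs
    · exact hx j (Nat.lt_succ_self j)
    · rw [leibniz_lie, ih fun l hl => hx l (by omega), hx j (Nat.lt_succ_self j)]
      simp

/-- The commutation relations of the matrix units `X i j`, `i, j < m`. -/
def IsUnitSystem (m : ℕ) (X : ℕ → ℕ → L) : Prop :=
  ∀ i j k l, i < m → j < m → k < m → l < m →
    ⁅X i j, X k l⁆ = (if j = k then X i l else 0) - (if l = i then X k j else 0)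

theorem IsUnitSystem.neg_swap {m : ℕ} {X : ℕ → ℕ → L} (H : IsUnitSystem m X) :
    IsUnitSystem m (fun i j => -X j i) := by
  intro i j k l hi hj hk hl
  simp only [lie_neg, neg_lie, neg_neg]
  rw [H j i l k hj hi hl hk]
  simp only [eq_comm (a := i), eq_comm (a := k)]
  split_ifs <;> abel

variable {n : ℕ} {e f h : ℕ → L}

theorem unitOf_last_self (k : ℕ) : unitOf e f h k (k + 1) = e k := by
  simp [unitOf, raiseRoot]

theorem unitOf_last (i k : ℕ) (hik : i < k) :
    unitOf e f h i (k + 1) = ⁅unitOf e f h i k, e k⁆ := by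
  rw [unitOf, if_pos (by omega), raiseRoot, if_neg (by omega), unitOf, if_pos hik]

theorem unitOf_self (i : ℕ) : unitOf e f h i i = h i := by simp [unitOf]

/-- `E_{ij}` is built from generators with small indices, so it commutes with everything that
commutes with these. -/
theorem lie_unitOf_eq_zero {x : L} {i j : ℕ} (he : ∀ l < j, ⁅x, e l⁆ = 0)
    (hf : ∀ l < i, ⁅x, f l⁆ = 0) (hh : i = j → ⁅x, h i⁆ = 0) : ⁅x, unitOf e f h i j⁆ = 0 := by
  unfold unitOf
  split_ifs with h1 h2
  · exact lie_raiseRoot_eq_zero i he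
  · exact hh h2
  · exact lie_lowerRoot_eq_zero j hf

theorem lie_unitOf_e_eq_zero (H : IsSerreSystem n e f h) {k i j : ℕ} (hk : k + 1 < n)
    (hi : i ≤ k) (hj : j < k) : ⁅unitOf e f h i j, e k⁆ = 0 := by
  rw [← lie_skew, neg_eq_zero]
  refine lie_unitOf_eq_zero (fun l hl => ?_) (fun l hl => ?_) (fun hij => ?_)
  · rw [← lie_skew, H.ee_far l k (by omega) hk, neg_zero]
  · exact H.ef_ne k l hk (by omega) (by omega)
  · rw [← lie_skew, H.he_ne i k (by omega) hk (by omega) (by omega), neg_zero]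

theorem lie_unitOf_e (H : IsSerreSystem n e f h) {k i : ℕ} (hk : k + 1 < n) (hi : i ≤ k) :
    ⁅unitOf e f h i k, e k⁆ = unitOf e f h i (k + 1) := by
  rcases hi.lt_or_eq with hi | rfl
  · exact (unitOf_last i k hi).symm
  · rw [unitOf_self, unitOf_last_self, H.he_self i hk]

theorem lie_h_unitOf (H : IsSerreSystem n e f h) {k : ℕ} (hk : k + 1 < n) {i j : ℕ}
    (hi : i ≤ k) (hj : j ≤ k) : ⁅h (k + 1), unitOf e f h i j⁆ = 0 :=
  lie_unitOf_eq_zero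
    (fun l hl => H.he_ne (k + 1) l hk (by omega) (by omega) (by omega))
    (fun l hl => H.hf_ne (k + 1) l hk (by omega) (by omega) (by omega))
    (fun _ => H.hh (k + 1) i hk (by omega))

theorem lie_h_unitOf_col (H : IsSerreSystem n e f h) {k : ℕ} (hk : k + 1 < n) {i : ℕ}
    (hi : i ≤ k) : ⁅h (k + 1), unitOf e f h i (k + 1)⁆ = -unitOf e f h i (k + 1) := by
  rw [← lie_unitOf_e H hk hi, leibniz_lie, lie_h_unitOf H hk hi le_rfl, H.he_succ k hk]
  simp

theorem lie_h_unitOf_row (H : IsSerreSystem n e f h) {k : ℕ} (hk : k + 1 < n) {i : ℕ}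
    (hi : i ≤ k) : ⁅h (k + 1), unitOf e f h (k + 1) i⁆ = unitOf e f h (k + 1) i := by
  have h0 := lie_h_unitOf_col H.neg_swap hk hi
  simpa only [unitOf_neg_swap, lie_neg, neg_lie, neg_neg] using h0

variable [LieAlgebra ℂ L]

/-- The step from `gl(k+1)` to `gl(k+2)` that uses the cubic Serre relation: the bracket is
symmetric in `i` and `j`, vanishes by that relation for `i = j = k - 1`, and the other cases follow
by applying `ad E_{i,k-1}` and `ad E_{j,k-1}`. -/
theorem lie_unitOf_col_col_succ (H : IsSerreSystem n e f h) {k : ℕ} (hk : k + 1 < n)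
    (IH : IsUnitSystem (k + 1) (unitOf e f h)) {i j : ℕ} (hi : i < k) (hj : j < k) :
    ⁅unitOf e f h i k, unitOf e f h j (k + 1)⁆ = 0 := by
  have symm : ∀ i j, i < k → j < k → ⁅unitOf e f h i k, unitOf e f h j (k + 1)⁆ =
      ⁅unitOf e f h j k, unitOf e f h i (k + 1)⁆ := by
    intro i j hi hj
    rw [unitOf_last j k hj, leibniz_lie, unitOf_last i k hi,
      IH i k j k (by omega) (by omega) (by omega) (by omega)]
    simp [hi.ne', hj.ne']
  obtain ⟨r, rfl⟩ : ∃ r, k = r + 1 := ⟨k - 1, by omega⟩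
  have shift : ∀ i, i < r → ⁅unitOf e f h i r, unitOf e f h r (r + 1 + 1)⁆ =
      unitOf e f h i (r + 1 + 1) := by
    intro i hi
    rw [unitOf_last r (r + 1) (by omega), leibniz_lie,
      lie_unitOf_e_eq_zero H hk (by omega) (by omega),
      IH i r r (r + 1) (by omega) (by omega) (by omega) (by omega),
      unitOf_last i (r + 1) (by omega)]
    simp [show r + 1 ≠ i by omega]
  have base : ⁅unitOf e f h r (r + 1), unitOf e f h r (r + 1 + 1)⁆ = 0 := by
    rw [unitOf_last r (r + 1) (by omega), unitOf_last_self, H.ee_lo r hk]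
  have edge : ∀ i, i < r → ⁅unitOf e f h i (r + 1), unitOf e f h r (r + 1 + 1)⁆ = 0 := by
    intro i hi
    -- By `symm`, `ad E_{ir}` maps the bracket of `base` to twice the bracket in question.
    have h0 := congrArg (fun x => ⁅unitOf e f h i r, x⁆) base
    simp only [lie_zero] at h0
    rw [leibniz_lie, shift i hi, IH i r r (r + 1) (by omega) (by omega) (by omega) (by omega),
      symm r i (by omega) (by omega)] at h0
    simp only [if_true, show r + 1 ≠ i by omega, if_false, sub_zero] at h0
    rw [← two_smul ℂ] at h0
    exact (smul_eq_zero.mp h0).resolve_left two_ne_zero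
  rcases (Nat.lt_succ_iff.mp hi).lt_or_eq with hi' | rfl
  · rcases (Nat.lt_succ_iff.mp hj).lt_or_eq with hj' | rfl
    · have h0 := congrArg (fun x => ⁅unitOf e f h j r, x⁆) (edge i hi')
      simp only [lie_zero] at h0
      rw [leibniz_lie, shift j hj', IH j r i (r + 1) (by omega) (by omega) (by omega) (by omega)]
        at h0
      simpa [show r ≠ i by omega, show r + 1 ≠ j by omega] using h0
    · exact edge i hi'
  · rcases (Nat.lt_succ_iff.mp hj).lt_or_eq with hj' | rfl
    · rw [symm _ _ hi hj]
      exact edge j hj'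
    · exact base

/-- The elements `E_{0,k+1}, …, E_{k,k+1}` form the vector representation of the `gl(k+1)` spanned
by the matrix units with indices at most `k`. -/
theorem lie_unitOf_col (H : IsSerreSystem n e f h) {k : ℕ} (hk : k + 1 < n)
    (IH : IsUnitSystem (k + 1) (unitOf e f h)) {i j l : ℕ} (hi : i ≤ k) (hj : j ≤ k)
    (hl : l ≤ k) :
    ⁅unitOf e f h i j, unitOf e f h l (k + 1)⁆ =
      if j = l then unitOf e f h i (k + 1) else 0 := by
  rcases hl.lt_or_eq with hl' | rfl
  · rw [unitOf_last l k hl', leibniz_lie, IH i j l k (by omega) (by omega) (by omega) (by omega)]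
    rcases hj.lt_or_eq with hj' | rfl
    · rw [lie_unitOf_e_eq_zero H hk hi hj', lie_zero, add_zero]
      by_cases h1 : j = l <;> by_cases h2 : k = i <;>
        simp [h1, h2, lie_unitOf_e H hk hi]
      · subst h2
        simp [lie_unitOf_e H hk le_rfl, lie_unitOf_e_eq_zero H hk hl hl']
      · subst h2
        rw [← lie_skew, lie_unitOf_e_eq_zero H hk hl hj', neg_zero]
    · rw [if_neg hl'.ne', if_neg hl'.ne', lie_unitOf_e H hk hi]
      by_cases h2 : j = i
      · subst h2
        rw [if_pos rfl, zero_sub, neg_lie, unitOf_last_self, neg_add_cancel]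
      · rw [if_neg h2, sub_zero, zero_lie, zero_add]
        exact lie_unitOf_col_col_succ H hk IH hl' (by omega)
  · rw [unitOf_last_self]
    rcases hj.lt_or_eq with hj' | rfl
    · rw [if_neg hj'.ne, lie_unitOf_e_eq_zero H hk hi hj']
    · rw [if_pos rfl, lie_unitOf_e H hk hi]

/-- The case `i = k`, `j = k - 1` is a cubic Serre relation, from which the other cases follow by
the action of `gl(k+1)`. -/
theorem lie_unitOf_col_succ_col_succ (H : IsSerreSystem n e f h) {k : ℕ} (hk : k + 1 < n)
    (IH : IsUnitSystem (k + 1) (unitOf e f h)) {i j : ℕ} (hi : i ≤ k) (hj : j ≤ k) :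
    ⁅unitOf e f h i (k + 1), unitOf e f h j (k + 1)⁆ = 0 := by
  have last : ∀ j, j ≤ k → ⁅unitOf e f h k (k + 1), unitOf e f h j (k + 1)⁆ = 0 := by
    intro j hj
    rcases hj.lt_or_eq with hj' | rfl
    · obtain ⟨r, rfl⟩ : ∃ r, k = r + 1 := ⟨k - 1, by omega⟩
      have base : ⁅unitOf e f h (r + 1) (r + 1 + 1), unitOf e f h r (r + 1 + 1)⁆ = 0 := by
        rw [unitOf_last r (r + 1) (by omega), unitOf_last_self, unitOf_last_self,
          ← lie_skew (e r) (e (r + 1)), lie_neg, H.ee_hi r hk, neg_zero]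
      rcases (Nat.lt_succ_iff.mp hj').lt_or_eq with hj'' | rfl
      · have h0 := congrArg (fun x => ⁅unitOf e f h j r, x⁆) base
        simp only [lie_zero] at h0
        rw [leibniz_lie, lie_unitOf_col H hk IH (by omega) (by omega) (by omega),
          lie_unitOf_col H hk IH (by omega) (by omega) (by omega)] at h0
        simpa using h0
      · exact base
    · exact lie_self _
  rcases hi.lt_or_eq with hi' | rfl
  · rcases hj.lt_or_eq with hj' | rfl
    · have h0 := congrArg (fun x => ⁅unitOf e f h i k, x⁆) (last j hj)
      simp only [lie_zero] at h0
      rw [leibniz_lie, lie_unitOf_col H hk IH (by omega) (by omega) (by omega),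
        lie_unitOf_col H hk IH (by omega) (by omega) (by omega)] at h0
      simpa [hj'.ne'] using h0
    · rw [← lie_skew, last i hi, neg_zero]
  · exact last j hj

/-- The elements `E_{k+1,0}, …, E_{k+1,k}` form the dual of the vector representation; this is
`lie_unitOf_col` under the Chevalley involution. -/
theorem lie_unitOf_row (H : IsSerreSystem n e f h) {k : ℕ} (hk : k + 1 < n)
    (IH : IsUnitSystem (k + 1) (unitOf e f h)) {i j l : ℕ} (hi : i ≤ k) (hj : j ≤ k)
    (hl : l ≤ k) :
    ⁅unitOf e f h i j, unitOf e f h (k + 1) l⁆ =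
      -if l = i then unitOf e f h (k + 1) j else 0 := by
  have IH' : IsUnitSystem (k + 1) (unitOf (fun m => -f m) (fun m => -e m) (fun m => -h m)) := by
    intro i j
    simp only [unitOf_neg_swap]
    exact IH.neg_swap i j
  have h0 := lie_unitOf_col H.neg_swap hk IH' hj hi hl
  simp only [unitOf_neg_swap, lie_neg, neg_lie, neg_neg] at h0
  rw [h0]
  simp only [eq_comm (a := i)]
  split_ifs <;> simp

theorem lie_unitOf_row_row (H : IsSerreSystem n e f h) {k : ℕ} (hk : k + 1 < n)
    (IH : IsUnitSystem (k + 1) (unitOf e f h)) {i j : ℕ} (hi : i ≤ k) (hj : j ≤ k) :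
    ⁅unitOf e f h (k + 1) i, unitOf e f h (k + 1) j⁆ = 0 := by
  have IH' : IsUnitSystem (k + 1) (unitOf (fun m => -f m) (fun m => -e m) (fun m => -h m)) := by
    intro i j
    simp only [unitOf_neg_swap]
    exact IH.neg_swap i j
  have h0 := lie_unitOf_col_succ_col_succ H.neg_swap hk IH' hi hj
  simpa only [unitOf_neg_swap, lie_neg, neg_lie, neg_neg] using h0

/-- The case `i = j = k` is a Serre relation, from which the other cases follow by the action of
`gl(k+1)`. -/
theorem lie_unitOf_col_row (H : IsSerreSystem n e f h) {k : ℕ} (hk : k + 1 < n)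
    (IH : IsUnitSystem (k + 1) (unitOf e f h)) {i j : ℕ} (hi : i ≤ k) (hj : j ≤ k) :
    ⁅unitOf e f h i (k + 1), unitOf e f h (k + 1) j⁆ =
      unitOf e f h i j - if i = j then h (k + 1) else 0 := by
  have last : ∀ i, i ≤ k → ⁅unitOf e f h i (k + 1), unitOf e f h (k + 1) k⁆ =
      unitOf e f h i k - if i = k then h (k + 1) else 0 := by
    intro i hi
    have base : ⁅unitOf e f h k (k + 1), unitOf e f h (k + 1) k⁆ =
        unitOf e f h k k - h (k + 1) := by
      have : unitOf e f h (k + 1) k = f k := by simp [unitOf, lowerRoot]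
      rw [unitOf_last_self, unitOf_self, this, H.ef_self k hk]
    rcases hi.lt_or_eq with hi' | rfl
    · have h0 := congrArg (fun x => ⁅unitOf e f h i k, x⁆) base
      simp only [lie_sub] at h0
      rw [leibniz_lie, lie_unitOf_col H hk IH hi le_rfl le_rfl,
        lie_unitOf_row H hk IH hi le_rfl le_rfl,
        IH i k k k (by omega) (by omega) (by omega) (by omega),
        ← lie_skew _ (h (k + 1)), lie_h_unitOf H hk hi le_rfl] at h0
      simpa [hi'.ne, hi'.ne'] using h0
    · rw [base, if_pos rfl]
  rcases hj.lt_or_eq with hj' | rfl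
  · have h0 := congrArg (fun x => ⁅unitOf e f h k j, x⁆) (last i hi)
    simp only [lie_sub] at h0
    rw [leibniz_lie, lie_unitOf_col H hk IH le_rfl hj hi,
      lie_unitOf_row H hk IH le_rfl hj le_rfl,
      IH k j i k (by omega) (by omega) (by omega) (by omega)] at h0
    have hzero : ⁅unitOf e f h k j, if i = k then h (k + 1) else 0⁆ = 0 := by
      split_ifs
      · rw [← lie_skew, lie_h_unitOf H hk le_rfl hj, neg_zero]
      · exact lie_zero _
    rw [hzero] at h0
    by_cases hij : i = j
    · subst hij
      rw [if_pos rfl, last k le_rfl] at h0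
      simp only [if_true, lie_neg] at h0
      rw [if_pos rfl]
      generalize ⁅unitOf e f h i (k + 1), unitOf e f h (k + 1) i⁆ = x at h0 ⊢
      rw [← sub_eq_zero] at h0 ⊢
      rw [← neg_eq_zero, ← h0]
      abel
    · simp only [if_neg (Ne.symm hij), if_true, zero_lie, zero_add, lie_neg, zero_sub,
        sub_zero] at h0
      rw [if_neg hij, sub_zero]
      exact neg_injective h0
  · exact last i hi

/-- The elements built from a Serre system satisfy the commutation relations of matrix units. -/
theorem isUnitSystem_unitOf (H : IsSerreSystem n e f h) :
    ∀ m, m ≤ n → IsUnitSystem m (unitOf e f h) := by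
  intro m
  induction m with
  | zero => intro _ i j k l hi; omega
  | succ m ih =>
    intro hm
    rcases Nat.eq_zero_or_pos m with rfl | hm0
    · intro i j k l hi hj hk hl
      obtain rfl : i = 0 := by omega
      obtain rfl : j = 0 := by omega
      obtain rfl : k = 0 := by omega
      obtain rfl : l = 0 := by omega
      simp
    obtain ⟨k, rfl⟩ : ∃ k, m = k + 1 := ⟨m - 1, by omega⟩
    have IH := ih (by omega)
    intro i j p q hi hj hp hq
    have cas : ∀ r, r < k + 1 + 1 → r ≤ k ∨ r = k + 1 := fun r hr => by omega
    have ne : ∀ {r}, r ≤ k → r ≠ k + 1 := fun hr => by omega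
    rcases cas i hi with hi | rfl <;> rcases cas j hj with hj | rfl <;>
      rcases cas p hp with hp | rfl <;> rcases cas q hq with hq | rfl
    · exact IH i j p q (by omega) (by omega) (by omega) (by omega)
    · rw [lie_unitOf_col H hm IH hi hj hp, if_neg (ne hi).symm, sub_zero]
    · rw [lie_unitOf_row H hm IH hi hj hq, if_neg (ne hj), zero_sub]
    · rw [unitOf_self, ← lie_skew, lie_h_unitOf H hm hi hj, if_neg (ne hj), if_neg (ne hi).symm]
      simp
    · rw [← lie_skew, lie_unitOf_col H hm IH hp hq hi, if_neg (ne hp).symm, zero_sub]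
    · rw [lie_unitOf_col_succ_col_succ H hm IH hi hp, if_neg (ne hp).symm, if_neg (ne hi).symm,
        sub_zero]
    · rw [lie_unitOf_col_row H hm IH hi hq, if_pos rfl, unitOf_self]
      simp only [eq_comm (a := i)]
    · rw [unitOf_self, ← lie_skew, lie_h_unitOf_col H hm hi, if_pos rfl, if_neg (ne hi).symm,
        neg_neg, sub_zero]
    · rw [← lie_skew, lie_unitOf_row H hm IH hp hq hj, if_neg (ne hq), sub_zero, neg_neg]
    · rw [← lie_skew, lie_unitOf_col_row H hm IH hp hj, if_pos rfl, unitOf_self]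
      simp only [eq_comm (a := p)]
      abel
    · rw [lie_unitOf_row_row H hm IH hj hq, if_neg (ne hj), if_neg (ne hq), sub_zero]
    · rw [unitOf_self, ← lie_skew, lie_h_unitOf_row H hm hj, if_neg (ne hj), if_pos rfl, zero_sub]
    · rw [unitOf_self, lie_h_unitOf H hm hp hq, if_neg (ne hp).symm, if_neg (ne hq), sub_zero]
    · rw [unitOf_self, lie_h_unitOf_col H hm hp, if_neg (ne hp).symm, if_pos rfl, zero_sub]
    · rw [unitOf_self, lie_h_unitOf_row H hm hq, if_pos rfl, if_neg (ne hq), sub_zero]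
    · simp

end Serre

end SingularGT

/-! ### Representations of the universal enveloping algebra -/

namespace SingularGT

/-- A system of matrix units in an associative algebra `A` defines a representation of
`U(gl(n))` in `A`. -/
theorem exists_algHom_of_isUnitSystem {A : Type*} [Ring A] [Algebra ℂ A] {n : ℕ}
    {X : ℕ → ℕ → A} (H : IsUnitSystem n X) :
    ∃ ρ : U n →ₐ[ℂ] A, ∀ r s : Fin n, ρ (E r s) = X r s := by
  let φ : Matrix (Fin n) (Fin n) ℂ →ₗ[ℂ] A :=
    { toFun := fun M => ∑ i, ∑ j, M i j • X i j
      map_add' := fun M N => by simp [add_smul, Finset.sum_add_distrib]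
      map_smul' := fun c M => by simp [mul_smul, Finset.smul_sum] }
  have hφ : ∀ r s : Fin n, φ (Matrix.single r s 1) = X r s := by
    intro r s
    change ∑ i, ∑ j, Matrix.single r s (1 : ℂ) i j • X i j = X r s
    rw [Finset.sum_eq_single r, Finset.sum_eq_single s]
    · simp
    · intro j _ hj
      simp [hj.symm]
    · simp
    · intro i _ hi
      simp [hi.symm]
    · simp
  have hlie : ∀ M N : Matrix (Fin n) (Fin n) ℂ, φ ⁅M, N⁆ = ⁅φ M, φ N⁆ := by
    intro M N
    induction M using Matrix.induction_on' with
    | h_zero => simp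
    | h_add M M' h1 h2 => rw [add_lie, map_add, h1, h2, map_add, add_lie]
    | h_std_basis i j x =>
      induction N using Matrix.induction_on' with
      | h_zero => simp
      | h_add N N' h1 h2 => rw [lie_add, map_add, h1, h2, map_add, lie_add]
      | h_std_basis k l y =>
        have e1 : ∀ (r s : Fin n) (x : ℂ), Matrix.single r s x = x • Matrix.single r s 1 := by
          intro r s x; simp
        rw [e1 i j x, e1 k l y]
        simp only [smul_lie, lie_smul, map_smul, hφ]
        congr 2
        rw [H i j k l i.2 j.2 k.2 l.2, Ring.lie_def, map_sub]
        congr 1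
        · by_cases hjk : j = k
          · subst hjk
            rw [Matrix.single_mul_single_same, mul_one, hφ, if_pos rfl]
          · rw [Matrix.single_mul_single_of_ne _ _ _ _ hjk,
              if_neg (fun h => hjk (Fin.ext h)), map_zero]
        · by_cases hli : l = i
          · subst hli
            rw [Matrix.single_mul_single_same, mul_one, hφ, if_pos rfl]
          · rw [Matrix.single_mul_single_of_ne _ _ _ _ hli,
              if_neg (fun h => hli (Fin.ext h)), map_zero]
  let Φ : Matrix (Fin n) (Fin n) ℂ →ₗ⁅ℂ⁆ A := { φ with map_lie' := hlie _ _ }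
  refine ⟨UniversalEnvelopingAlgebra.lift ℂ Φ, fun r s => ?_⟩
  rw [E, UniversalEnvelopingAlgebra.lift_ι_apply]
  exact hφ r s

/-- The generators `E_{rs}` with `|r - s| ≤ 1`. -/
def simpleGenerators (n : ℕ) : Set (U n) :=
  {x | ∃ r s : Fin n, r.val ≤ s.val + 1 ∧ s.val ≤ r.val + 1 ∧ x = E r s}

theorem E_mul_sub_mul {n : ℕ} {r s t : Fin n} (hrt : r ≠ t) :
    (E r s * E s t - E s t * E r s : U n) = E r t := by
  unfold E
  rw [← Ring.lie_def, ← LieHom.map_lie, Ring.lie_def, Matrix.single_mul_single_same,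
    Matrix.single_mul_single_of_ne _ _ _ _ hrt.symm, mul_one, sub_zero]

theorem E_mem_adjoin {n : ℕ} (r s : Fin n) : E r s ∈ Algebra.adjoin ℂ (simpleGenerators n) := by
  have up : ∀ d : ℕ, ∀ r s : Fin n, s.val = r.val + d →
      E r s ∈ Algebra.adjoin ℂ (simpleGenerators n) ∧
      E s r ∈ Algebra.adjoin ℂ (simpleGenerators n) := by
    intro d
    induction d with
    | zero =>
      intro r s h
      exact ⟨Algebra.subset_adjoin ⟨r, s, by omega, by omega, rfl⟩,
        Algebra.subset_adjoin ⟨s, r, by omega, by omega, rfl⟩⟩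
    | succ d ih =>
      intro r s h
      have hs := s.2
      obtain ⟨h1, h2⟩ := ih r ⟨r.val + d, by omega⟩ rfl
      have h3 : E ⟨r.val + d, by omega⟩ s ∈ Algebra.adjoin ℂ (simpleGenerators n) :=
        Algebra.subset_adjoin ⟨_, s, by simp; omega, by simp; omega, rfl⟩
      have h4 : E s ⟨r.val + d, by omega⟩ ∈ Algebra.adjoin ℂ (simpleGenerators n) :=
        Algebra.subset_adjoin ⟨s, _, by simp; omega, by simp; omega, rfl⟩
      have hrs : r ≠ s := fun h' => by subst h'; omega
      refine ⟨?_, ?_⟩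
      · rw [← E_mul_sub_mul (s := ⟨r.val + d, by omega⟩) hrs]
        exact sub_mem (mul_mem h1 h3) (mul_mem h3 h1)
      · rw [← E_mul_sub_mul (s := ⟨r.val + d, by omega⟩) hrs.symm]
        exact sub_mem (mul_mem h4 h2) (mul_mem h2 h4)
  rcases le_total r.val s.val with h | h
  · exact (up (s.val - r.val) r s (by omega)).1
  · exact (up (r.val - s.val) s r (by omega)).2

/-- `U(gl(n))` is generated by the `E_{rs}` with `|r - s| ≤ 1`. -/
theorem adjoin_simpleGenerators (n : ℕ) : Algebra.adjoin ℂ (simpleGenerators n) = ⊤ := by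
  set S := Algebra.adjoin ℂ (simpleGenerators n) with hS
  have hι : ∀ M : Matrix (Fin n) (Fin n) ℂ, UniversalEnvelopingAlgebra.ι ℂ M ∈ S := by
    intro M
    induction M using Matrix.induction_on' with
    | h_zero => rw [map_zero]; exact zero_mem _
    | h_add M N h1 h2 => rw [map_add]; exact add_mem h1 h2
    | h_std_basis i j x =>
      have : Matrix.single i j x = x • Matrix.single i j (1 : ℂ) := by simp
      rw [this, map_smul]
      exact S.smul_mem (E_mem_adjoin i j) x
  let g : Matrix (Fin n) (Fin n) ℂ →ₗ⁅ℂ⁆ S :=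
    { toFun := fun M => ⟨UniversalEnvelopingAlgebra.ι ℂ M, hι M⟩
      map_add' := fun M N => by ext; simp
      map_smul' := fun c M => by ext; simp
      map_lie' := fun {M N} => by
        apply Subtype.ext
        change UniversalEnvelopingAlgebra.ι ℂ ⁅M, N⁆ = _
        rw [LieHom.map_lie, Ring.lie_def, Ring.lie_def]
        rfl }
  have hid : S.val.comp (UniversalEnvelopingAlgebra.lift ℂ g) = AlgHom.id ℂ (U n) := by
    apply UniversalEnvelopingAlgebra.hom_ext
    ext M
    simp [g]
  rw [eq_top_iff]
  intro x _
  have := congrArg (fun F : U n →ₐ[ℂ] U n => F x) hid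
  simp only [AlgHom.comp_apply, AlgHom.id_apply] at this
  rw [← this]
  exact Subtype.prop _

/-- Induction over `U(gl(n))` along the generators `E_{rs}`, `|r - s| ≤ 1`. -/
theorem U_induction {n : ℕ} {p : U n → Prop} (u : U n)
    (hE : ∀ r s : Fin n, r.val ≤ s.val + 1 → s.val ≤ r.val + 1 → p (E r s))
    (hc : ∀ c : ℂ, p (algebraMap ℂ (U n) c)) (hadd : ∀ x y, p x → p y → p (x + y))
    (hmul : ∀ x y, p x → p y → p (x * y)) : p u := by
  have hu : u ∈ Algebra.adjoin ℂ (simpleGenerators n) := by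
    rw [adjoin_simpleGenerators]; trivial
  induction hu using Algebra.adjoin_induction with
  | mem x hx => obtain ⟨r, s, h1, h2, rfl⟩ := hx; exact hE r s h1 h2
  | algebraMap c => exact hc c
  | add x y _ _ hx hy => exact hadd x y hx hy
  | mul x y _ _ hx hy => exact hmul x y hx hy

end SingularGT

/-! ### Weighted shift operators -/

noncomputable section

namespace SingularGT

variable {n : ℕ}

/-- Entries of one row below the top row never differ by an integer. -/
def IsGeneric (v : Vec n) : Prop :=
  ∀ p q : Pos n, p.row = q.row → p.row < n → p ≠ q → ∀ m : ℤ, v p - v q ≠ m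

theorem addShift_add (v : Vec n) (z d : Shift n) :
    addShift v (z + d) = addShift (addShift v z) d := by
  funext p
  unfold addShift
  split_ifs
  · simp only [Pi.add_apply]; push_cast; ring
  · ring

theorem addShift_zero (v : Vec n) : addShift v 0 = v := by
  funext p
  simp [addShift]

theorem IsGeneric.addShift {v : Vec n} (hv : IsGeneric v) (z : Shift n) :
    IsGeneric (addShift v z) := by
  intro p q hpq hp hne m h
  refine hv p q hpq hp hne (m - z ⟨p, hp⟩ + z ⟨q, hpq ▸ hp⟩) ?_
  simp only [SingularGT.addShift, dif_pos hp, dif_pos (show q.row < n from hpq ▸ hp)] at h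
  push_cast
  linear_combination h

/-- The vector `x + ε δ^p`. -/
def bump (x : Vec n) (p : Pos n) (ε : ℤ) : Vec n := Function.update x p (x p + ε)

@[simp] theorem bump_self (x : Vec n) (p : Pos n) (ε : ℤ) : bump x p ε p = x p + ε := by
  simp [bump]

theorem bump_of_ne (x : Vec n) {p q : Pos n} (ε : ℤ) (h : q ≠ p) : bump x p ε q = x q := by
  simp [bump, h]

theorem bump_comm (x : Vec n) (p q : Pos n) (ε ε' : ℤ) :
    bump (bump x p ε) q ε' = bump (bump x q ε') p ε := by
  rcases eq_or_ne p q with rfl | h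
  · funext r
    rcases eq_or_ne r p with rfl | hr
    · simp; ring
    · simp [bump_of_ne, hr]
  · funext r
    rcases eq_or_ne r p with rfl | hr
    · simp [bump_of_ne, h]
    · rcases eq_or_ne r q with rfl | hr'
      · simp [bump_of_ne, hr]
      · simp [bump_of_ne, hr, hr']

theorem addShift_single (x : Vec n) (p : LPos n) (ε : ℤ) :
    addShift x (Pi.single p ε) = bump x p.1 ε := by
  funext q
  rcases eq_or_ne q p.1 with rfl | h
  · simp [addShift, p.2]
  · rw [bump_of_ne _ _ h, addShift]
    split_ifs with hq
    · rw [Pi.single_eq_of_ne]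
      · simp
      · intro h'
        exact h (congrArg Subtype.val h')
    · simp

/-- The operator `T(v + z) ↦ c(v + z) T(v + z + d)`. -/
def wshift (v : Vec n) (c : Vec n → ℂ) (d : Shift n) : Module.End ℂ (V n) :=
  Finsupp.linearCombination ℂ (fun z : Shift n => c (addShift v z) • (Tab (z + d) : V n))

theorem wshift_Tab (v : Vec n) (c : Vec n → ℂ) (d z : Shift n) :
    wshift v c d (Tab z) = c (addShift v z) • Tab (z + d) := by
  simp [wshift, Tab]

theorem end_ext {F G : Module.End ℂ (V n)} (h : ∀ z, F (Tab z) = G (Tab z)) : F = G := by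
  apply Finsupp.lhom_ext
  intro z c
  have : (Finsupp.single z c : V n) = c • Tab z := by simp [Tab]
  rw [this, map_smul, map_smul, h]

theorem wshift_mul (v : Vec n) (c c' : Vec n → ℂ) (d d' : Shift n) :
    wshift v c d * wshift v c' d' = wshift v (fun x => c' x * c (addShift x d')) (d + d') := by
  apply end_ext
  intro z
  rw [Module.End.mul_apply, wshift_Tab, map_smul, wshift_Tab, wshift_Tab, smul_smul,
    addShift_add, add_assoc, add_comm d']

theorem wshift_add (v : Vec n) (c c' : Vec n → ℂ) (d : Shift n) :
    wshift v c d + wshift v c' d = wshift v (fun x => c x + c' x) d := by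
  apply end_ext
  intro z
  simp [wshift_Tab, add_smul]

theorem wshift_sub (v : Vec n) (c c' : Vec n → ℂ) (d : Shift n) :
    wshift v c d - wshift v c' d = wshift v (fun x => c x - c' x) d := by
  apply end_ext
  intro z
  simp [wshift_Tab, sub_smul]

theorem wshift_sum {ι : Type*} (s : Finset ι) (v : Vec n) (c : ι → Vec n → ℂ) (d : Shift n) :
    ∑ i ∈ s, wshift v (c i) d = wshift v (fun x => ∑ i ∈ s, c i x) d := by
  apply end_ext
  intro z
  simp [wshift_Tab, Finset.sum_smul]

theorem wshift_congr {v : Vec n} (hv : IsGeneric v) {c c' : Vec n → ℂ}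
    (h : ∀ x, IsGeneric x → c x = c' x) (d : Shift n) : wshift v c d = wshift v c' d := by
  apply end_ext
  intro z
  rw [wshift_Tab, wshift_Tab, h _ (hv.addShift z)]

theorem wshift_eq_zero {v : Vec n} (hv : IsGeneric v) {c : Vec n → ℂ}
    (h : ∀ x, IsGeneric x → c x = 0) (d : Shift n) : wshift v c d = 0 := by
  apply end_ext
  intro z
  rw [wshift_Tab, h _ (hv.addShift z), zero_smul, LinearMap.zero_apply]

/-- The bracket of `Module.End` is found by an instance on which `sum_lie`, `smul_lie` and the like
do not rewrite; the bilinearity of the commutator is therefore restated here. -/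
theorem lie_end (F G : Module.End ℂ (V n)) : ⁅F, G⁆ = F * G - G * F := rfl

theorem sum_lie_end {ι : Type*} (s : Finset ι) (F : ι → Module.End ℂ (V n))
    (G : Module.End ℂ (V n)) : ⁅∑ i ∈ s, F i, G⁆ = ∑ i ∈ s, ⁅F i, G⁆ := by
  simp only [lie_end, Finset.sum_mul, Finset.mul_sum]
  exact (Finset.sum_sub_distrib (G := Module.End ℂ (V n)) _ _).symm

theorem lie_end_sum {ι : Type*} (s : Finset ι) (F : Module.End ℂ (V n))
    (G : ι → Module.End ℂ (V n)) : ⁅F, ∑ i ∈ s, G i⁆ = ∑ i ∈ s, ⁅F, G i⁆ := by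
  simp only [lie_end, Finset.sum_mul, Finset.mul_sum]
  exact (Finset.sum_sub_distrib (G := Module.End ℂ (V n)) _ _).symm

theorem smul_lie_end (c : ℂ) (F G : Module.End ℂ (V n)) : ⁅c • F, G⁆ = c • ⁅F, G⁆ := by
  simp only [lie_end, smul_mul_assoc, mul_smul_comm]
  exact (smul_sub (A := Module.End ℂ (V n)) c _ _).symm

theorem lie_smul_end (c : ℂ) (F G : Module.End ℂ (V n)) : ⁅F, c • G⁆ = c • ⁅F, G⁆ := by
  simp only [lie_end, smul_mul_assoc, mul_smul_comm]
  exact (smul_sub (A := Module.End ℂ (V n)) c _ _).symm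

theorem lie_wshift (v : Vec n) (a b : Vec n → ℂ) (α β : Shift n) :
    ⁅wshift v a α, wshift v b β⁆ =
      wshift v (fun x => b x * a (addShift x β) - a x * b (addShift x α)) (α + β) := by
  rw [lie_end, wshift_mul, wshift_mul, add_comm β α, wshift_sub]

theorem lie_lie_wshift (v : Vec n) (a b c : Vec n → ℂ) (α β γ : Shift n) :
    ⁅wshift v a α, ⁅wshift v b β, wshift v c γ⁆⁆ =
      wshift v (fun x =>
        (c x * b (addShift x γ) - b x * c (addShift x β)) * a (addShift (addShift x γ) β) -
        a x * (c (addShift x α) * b (addShift (addShift x α) γ) -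
          b (addShift x α) * c (addShift (addShift x α) β))) (α + (β + γ)) := by
  rw [lie_wshift, lie_wshift]
  congr 1
  funext x
  rw [add_comm β γ, addShift_add]

/-- The Gelfand–Tsetlin coefficient of the position `p` with numerator running over `S`: for `S`
the row above or below `p` this is, up to sign, `raiseCoeff` or `lowerCoeff`. -/
def gtCoeff (S : Finset (Pos n)) (p : Pos n) (x : Vec n) : ℂ :=
  (∏ q ∈ S, (x p - x q)) / ∏ q ∈ (rowSet n p.row).erase p, (x p - x q)

theorem mem_rowSet {m : ℕ} {p : Pos n} : p ∈ rowSet n m ↔ p.row = m := by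
  simp [rowSet]

theorem gtCoeff_bump_of_notMem {S : Finset (Pos n)} {p q : Pos n} (x : Vec n) (ε : ℤ)
    (hq : q ∉ S) (hrow : q.row ≠ p.row) : gtCoeff S p (bump x q ε) = gtCoeff S p x := by
  have hpq : p ≠ q := fun h => hrow (h ▸ rfl)
  unfold gtCoeff
  congr 1
  · refine Finset.prod_congr rfl fun r hr => ?_
    rw [bump_of_ne _ _ hpq, bump_of_ne _ _ (fun h : r = q => hq (h ▸ hr))]
  · refine Finset.prod_congr rfl fun r hr => ?_
    rw [Finset.mem_erase, mem_rowSet] at hr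
    rw [bump_of_ne _ _ hpq, bump_of_ne]
    rintro rfl
    exact hrow hr.2

/-- Moving another entry of the row of `p` changes one factor of the denominator. -/
theorem gtCoeff_bump_row {S : Finset (Pos n)} {p q : Pos n} (x : Vec n) (ε : ℤ)
    (hq : q ∉ S) (hrow : q.row = p.row) (hpq : p ≠ q) (h0 : x p - x q ≠ 0) :
    gtCoeff S p (bump x q ε) = gtCoeff S p x * ((x p - x q) / (x p - x q - ε)) := by
  unfold gtCoeff
  have hmem : q ∈ (rowSet n p.row).erase p := by
    rw [Finset.mem_erase, mem_rowSet]; exact ⟨hpq.symm, hrow⟩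
  rw [← Finset.mul_prod_erase _ _ hmem, ← Finset.mul_prod_erase _ (fun r => x p - x r) hmem]
  have h1 : ∏ r ∈ S, (bump x q ε p - bump x q ε r) = ∏ r ∈ S, (x p - x r) := by
    refine Finset.prod_congr rfl fun r hr => ?_
    rw [bump_of_ne _ _ hpq, bump_of_ne _ _ (fun h : r = q => hq (h ▸ hr))]
  have h2 : ∏ r ∈ ((rowSet n p.row).erase p).erase q, (bump x q ε p - bump x q ε r) =
      ∏ r ∈ ((rowSet n p.row).erase p).erase q, (x p - x r) := by
    refine Finset.prod_congr rfl fun r hr => ?_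
    rw [Finset.mem_erase] at hr
    rw [bump_of_ne _ _ hpq, bump_of_ne _ _ hr.1]
  rw [h1, h2, bump_of_ne _ _ hpq, bump_self, sub_add_eq_sub_sub, div_mul_div_comm,
    mul_comm (∏ r ∈ S, (x p - x r)), mul_right_comm (x p - x q), mul_assoc (x p - x q),
    mul_div_mul_left _ _ h0, mul_comm (x p - x q - _)]

theorem gtCoeff_erase {S : Finset (Pos n)} {q : Pos n} (hq : q ∈ S) (p : Pos n) (x : Vec n) :
    gtCoeff S p x = (x p - x q) * gtCoeff (S.erase q) p x := by
  unfold gtCoeff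
  rw [← Finset.mul_prod_erase _ _ hq, mul_div_assoc]

/-- The summand of a Chevalley generator that moves the entry at `p` by `ε`. -/
def gtOp (v : Vec n) (S : Finset (Pos n)) (ε : ℤ) (p : LPos n) : Module.End ℂ (V n) :=
  wshift v (gtCoeff S p.1) (Pi.single p ε)

theorem IsGeneric.sub_ne_zero {x : Vec n} (hx : IsGeneric x) {p q : Pos n}
    (hpq : p.row = q.row) (hp : p.row < n) (hne : p ≠ q) : x p - x q ≠ 0 := by
  simpa using hx p q hpq hp hne 0

theorem IsGeneric.sub_sub_ne_zero {x : Vec n} (hx : IsGeneric x) {p q : Pos n}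
    (hpq : p.row = q.row) (hp : p.row < n) (hne : p ≠ q) (ε : ℤ) : x p - x q - ε ≠ 0 :=
  _root_.sub_ne_zero.mpr (hx p q hpq hp hne ε)

/-- The Serre relation for two positions `p, p'` in one row whose coefficients involve the entry
at `q`, while the coefficient of `q` does not involve the row of `p` and `p'`. -/
theorem serre_lower {v : Vec n} (hv : IsGeneric v) {S S' : Finset (Pos n)} (ε : ℤ)
    {p p' q : LPos n} (hpp : p.1.row = p'.1.row) (hpq : p.1.row ≠ q.1.row)
    (hS : ∀ r ∈ S, r.row ≠ p.1.row) (hS' : ∀ r ∈ S', r.row ≠ p.1.row) (hq : q.1 ∈ S) :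
    ⁅gtOp v S ε p, ⁅gtOp v S ε p', gtOp v S' ε q⁆⁆ +
      ⁅gtOp v S ε p', ⁅gtOp v S ε p, gtOp v S' ε q⁆⁆ = 0 := by
  unfold gtOp
  rw [lie_lie_wshift, lie_lie_wshift, add_left_comm (Pi.single (M := fun _ => ℤ) p' ε), wshift_add]
  apply wshift_eq_zero hv
  intro x hx
  simp only [addShift_single]
  obtain ⟨p, hp⟩ := p
  obtain ⟨p', hp'⟩ := p'
  obtain ⟨q, hqn⟩ := q
  simp only at *
  have hqp : q ≠ p := fun h => hpq (h ▸ rfl)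
  have hqp' : q ≠ p' := fun h => hpq (h ▸ hpp)
  have B1 : ∀ y, gtCoeff S' q (bump y p ε) = gtCoeff S' q y := fun y =>
    gtCoeff_bump_of_notMem y ε (fun h => hS' _ h rfl) hpq
  have B2 : ∀ y, gtCoeff S' q (bump y p' ε) = gtCoeff S' q y := fun y =>
    gtCoeff_bump_of_notMem y ε (fun h => hS' _ h hpp.symm) (hpp ▸ hpq)
  have C1 : ∀ y, gtCoeff (S.erase q) p (bump y q ε) = gtCoeff (S.erase q) p y := fun y =>
    gtCoeff_bump_of_notMem y ε (Finset.notMem_erase _ _) hpq.symm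
  have C2 : ∀ y, gtCoeff (S.erase q) p' (bump y q ε) = gtCoeff (S.erase q) p' y := fun y =>
    gtCoeff_bump_of_notMem y ε (Finset.notMem_erase _ _) (hpp ▸ hpq.symm)
  simp only [B1, B2, gtCoeff_erase hq]
  rcases eq_or_ne p p' with rfl | hne
  · simp only [C1, bump_comm x q p, bump_self, bump_of_ne _ _ hqp, bump_of_ne _ _ hqp.symm]
    ring
  · have D1 : gtCoeff (S.erase q) p (bump x p' ε) =
        gtCoeff (S.erase q) p x * ((x p - x p') / (x p - x p' - ε)) :=
      gtCoeff_bump_row x ε (fun h => hS _ (Finset.mem_of_mem_erase h) hpp.symm) hpp.symm hne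
        (hx.sub_ne_zero hpp hp hne)
    have D2 : gtCoeff (S.erase q) p' (bump x p ε) =
        gtCoeff (S.erase q) p' x * ((x p' - x p) / (x p' - x p - ε)) :=
      gtCoeff_bump_row x ε (fun h => hS _ (Finset.mem_of_mem_erase h) rfl) hpp hne.symm
        (hx.sub_ne_zero hpp.symm hp' hne.symm)
    simp only [C1, C2, bump_comm x q p, bump_comm x q p', bump_self, bump_of_ne _ _ hqp,
      bump_of_ne _ _ hqp', bump_of_ne _ _ hqp.symm, bump_of_ne _ _ hqp'.symm,
      bump_of_ne _ _ hne, bump_of_ne _ _ hne.symm, D1, D2]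
    have n1 := hx.sub_sub_ne_zero hpp hp hne ε
    have n2 := hx.sub_sub_ne_zero hpp.symm hp' hne.symm ε
    generalize gtCoeff (S.erase q) p x = c
    generalize gtCoeff (S.erase q) p' x = c'
    field_simp
    ring

/-- The Serre relation for two positions `q, q'` in one row, the entries at which occur in the
coefficient of `p`, while their coefficients do not involve the entry at `p`. -/
theorem serre_upper {v : Vec n} (hv : IsGeneric v) {S S' : Finset (Pos n)} (ε : ℤ)
    {p q q' : LPos n} (hqq : q.1.row = q'.1.row) (hpq : p.1.row ≠ q.1.row)
    (hS' : ∀ r ∈ S', r.row ≠ q.1.row) (hp : p.1 ∉ S') (hq : q.1 ∈ S)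
    (hq' : q'.1 ∈ S) :
    ⁅gtOp v S' ε q, ⁅gtOp v S' ε q', gtOp v S ε p⁆⁆ +
      ⁅gtOp v S' ε q', ⁅gtOp v S' ε q, gtOp v S ε p⁆⁆ = 0 := by
  unfold gtOp
  rw [lie_lie_wshift, lie_lie_wshift, add_left_comm (Pi.single (M := fun _ => ℤ) q' ε), wshift_add]
  apply wshift_eq_zero hv
  intro x hx
  simp only [addShift_single]
  obtain ⟨p, hpn⟩ := p
  obtain ⟨q, hqn⟩ := q
  obtain ⟨q', hqn'⟩ := q'
  simp only at *
  have hqp : q ≠ p := fun h => hpq (h ▸ rfl)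
  have hqp' : q' ≠ p := fun h => hpq (h ▸ hqq.symm)
  have B1 : ∀ y, gtCoeff S' q (bump y p ε) = gtCoeff S' q y := fun y =>
    gtCoeff_bump_of_notMem y ε hp hpq
  have B2 : ∀ y, gtCoeff S' q' (bump y p ε) = gtCoeff S' q' y := fun y =>
    gtCoeff_bump_of_notMem y ε hp (hqq ▸ hpq)
  have C1 : ∀ y, gtCoeff (S.erase q) p (bump y q ε) = gtCoeff (S.erase q) p y := fun y =>
    gtCoeff_bump_of_notMem y ε (Finset.notMem_erase _ _) hpq.symm
  rcases eq_or_ne q q' with rfl | hne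
  · simp only [B1, gtCoeff_erase hq p, C1, bump_comm x p q, bump_self,
      bump_of_ne _ _ hqp.symm]
    ring
  · have hmem : q' ∈ S.erase q := Finset.mem_erase.mpr ⟨hne.symm, hq'⟩
    have E1 : ∀ y, gtCoeff ((S.erase q).erase q') p (bump y q ε) =
        gtCoeff ((S.erase q).erase q') p y := fun y =>
      gtCoeff_bump_of_notMem y ε
        (fun h => Finset.notMem_erase q S (Finset.mem_of_mem_erase h)) hpq.symm
    have E2 : ∀ y, gtCoeff ((S.erase q).erase q') p (bump y q' ε) =
        gtCoeff ((S.erase q).erase q') p y := fun y =>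
      gtCoeff_bump_of_notMem y ε (Finset.notMem_erase _ _) (hqq ▸ hpq.symm)
    have D1 : gtCoeff S' q (bump x q' ε) =
        gtCoeff S' q x * ((x q - x q') / (x q - x q' - ε)) :=
      gtCoeff_bump_row x ε (fun h => hS' _ h hqq.symm) hqq.symm hne
        (hx.sub_ne_zero hqq hqn hne)
    have D2 : gtCoeff S' q' (bump x q ε) =
        gtCoeff S' q' x * ((x q' - x q) / (x q' - x q - ε)) :=
      gtCoeff_bump_row x ε (fun h => hS' _ h rfl) hqq hne.symm
        (hx.sub_ne_zero hqq.symm hqn' hne.symm)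
    simp only [gtCoeff_erase hq p, gtCoeff_erase hmem p, B1, B2, E1, E2, bump_comm x p q,
      bump_comm x p q', bump_self, bump_of_ne _ _ hqp.symm, bump_of_ne _ _ hqp'.symm,
      bump_of_ne _ _ hne, bump_of_ne _ _ hne.symm, D1, D2]
    have n1 := hx.sub_sub_ne_zero hqq hqn hne ε
    have n2 := hx.sub_sub_ne_zero hqq.symm hqn' hne.symm ε
    generalize gtCoeff ((S.erase q).erase q') p x = c
    field_simp
    ring

theorem lie_gtOp_far {v : Vec n} {S S' : Finset (Pos n)} (ε ε' : ℤ)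
    {p q : LPos n} (hpq : p.1.row ≠ q.1.row) (hp : p.1 ∉ S') (hq : q.1 ∉ S) :
    ⁅gtOp v S ε p, gtOp v S' ε' q⁆ = 0 := by
  unfold gtOp
  rw [lie_wshift]
  simp only [addShift_single, gtCoeff_bump_of_notMem _ _ hp hpq,
    gtCoeff_bump_of_notMem _ _ hq hpq.symm]
  apply end_ext
  intro z
  rw [wshift_Tab, mul_comm, sub_self, zero_smul, LinearMap.zero_apply]

/-- For positions in neighbouring rows each coefficient has one factor, `x_p - x_q` up to sign, that
the other shift changes, and in opposite directions of shift these changes agree. -/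
theorem lie_gtOp_adjacent {v : Vec n} {S S' : Finset (Pos n)} (ε : ℤ)
    {p q : LPos n} (hpq : p.1.row ≠ q.1.row) (hp : p.1 ∈ S') (hq : q.1 ∈ S) :
    ⁅gtOp v S ε p, gtOp v S' (-ε) q⁆ = 0 := by
  unfold gtOp
  rw [lie_wshift]
  have hqp : q.1 ≠ p.1 := fun h => hpq (h ▸ rfl)
  have C1 : ∀ y, gtCoeff (S.erase q) p.1 (bump y q (-ε)) = gtCoeff (S.erase q) p.1 y := fun y =>
    gtCoeff_bump_of_notMem y _ (Finset.notMem_erase _ _) hpq.symm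
  have C2 : ∀ y, gtCoeff (S'.erase p) q.1 (bump y p ε) = gtCoeff (S'.erase p) q.1 y := fun y =>
    gtCoeff_bump_of_notMem y _ (Finset.notMem_erase _ _) hpq
  apply end_ext
  intro z
  simp only [wshift_Tab, addShift_single, gtCoeff_erase hp q.1, gtCoeff_erase hq p.1, C1, C2,
    bump_self, bump_of_ne _ _ hqp, bump_of_ne _ _ hqp.symm]
  rw [LinearMap.zero_apply]
  convert zero_smul ℂ _ using 2
  push_cast
  ring

end SingularGT

end

/-! ### Commutators of raising and lowering operators as sums of residues -/

noncomputable section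

namespace SingularGT

open Polynomial

variable {n : ℕ}

/-- Lagrange interpolation as a residue theorem: the sum of the residues of `N / D` at the simple
roots of `D` is the top coefficient of the remainder of `N` modulo `D`. -/
theorem sum_eval_div_derivative {ι : Type*} [DecidableEq ι] (s : Finset ι)
    (u : ι → ℂ) (hu : Set.InjOn u s) (N : ℂ[X]) :
    ∑ i ∈ s, N.eval (u i) / (derivative (Lagrange.nodal s u)).eval (u i) =
      (N %ₘ Lagrange.nodal s u).coeff (s.card - 1) := by
  have hm : (Lagrange.nodal s u).Monic := Lagrange.nodal_monic
  rw [Lagrange.coeff_eq_sum hu]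
  · refine Finset.sum_congr rfl fun i hi => ?_
    rw [Lagrange.eval_nodal_derivative_eval_node_eq hi, Lagrange.eval_nodal]
    congr 1
    conv_lhs => rw [← modByMonic_add_div N (Lagrange.nodal s u)]
    rw [eval_add, eval_mul, Lagrange.eval_nodal_at_node hi, zero_mul, add_zero]
  · rw [← Lagrange.degree_nodal (v := u)]
    exact degree_modByMonic_lt _ hm

/-- The polynomial whose roots are the entries of the `m`-th row. -/
def rowPoly (m : ℕ) (x : Vec n) : ℂ[X] := Lagrange.nodal (rowSet n m) x

theorem rowPoly_monic (m : ℕ) (x : Vec n) : (rowPoly m x).Monic := Lagrange.nodal_monic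

theorem card_rowSet {m : ℕ} (hm : m ≤ n) : (rowSet n m).card = m := by
  rcases m with _ | m
  · rw [Finset.card_eq_zero, Finset.eq_empty_iff_forall_notMem]
    intro p hp
    rw [mem_rowSet] at hp
    simp [Pos.row] at hp
  · have : rowSet n (m + 1) =
        Finset.univ.image (fun c : Fin (m + 1) => (⟨⟨m, hm⟩, c⟩ : Pos n)) := by
      ext ⟨r, c⟩
      simp only [mem_rowSet, Pos.row, Finset.mem_image, Finset.mem_univ, true_and]
      constructor
      · intro h
        obtain ⟨r, hr⟩ := r
        obtain rfl : r = m := by simpa using h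
        exact ⟨c, rfl⟩
      · rintro ⟨c', h⟩
        rw [Sigma.mk.injEq] at h
        rw [← h.1]
    rw [this, Finset.card_image_of_injective, Finset.card_univ, Fintype.card_fin]
    intro c c' h
    simpa using h

theorem natDegree_rowPoly {m : ℕ} (hm : m ≤ n) (x : Vec n) : (rowPoly m x).natDegree = m := by
  rw [rowPoly, Lagrange.natDegree_nodal, card_rowSet hm]

theorem rowPoly_comp (m : ℕ) (x : Vec n) :
    (rowPoly m x).comp (X + 1) = Lagrange.nodal (rowSet n m) (fun q => x q - 1) := by
  rw [rowPoly, Lagrange.nodal, Lagrange.nodal, prod_comp]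
  refine Finset.prod_congr rfl fun q _ => ?_
  simp only [sub_comp, X_comp, C_comp, C_sub, C_1]
  ring

/-- The denominator `A_m(u) A_m(u + 1)` for the row `m = k + 1`. -/
def denPoly (k : ℕ) (x : Vec n) : ℂ[X] := rowPoly (k + 1) x * (rowPoly (k + 1) x).comp (X + 1)

/-- The numerator `A_{m+1}(u) A_{m-1}(u + 1)` for the row `m = k + 1`. -/
def numPoly (k : ℕ) (x : Vec n) : ℂ[X] := rowPoly (k + 2) x * (rowPoly k x).comp (X + 1)

theorem denPoly_eq (k : ℕ) (x : Vec n) : denPoly k x =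
    Lagrange.nodal ((rowSet n (k + 1)).disjSum (rowSet n (k + 1)))
      (Sum.elim x (fun q => x q - 1)) := by
  rw [denPoly, rowPoly_comp, rowPoly, Lagrange.nodal, Lagrange.nodal, Lagrange.nodal,
    Finset.prod_disjSum]
  rfl

theorem denPoly_monic (k : ℕ) (x : Vec n) : (denPoly k x).Monic := by
  rw [denPoly_eq]; exact Lagrange.nodal_monic

theorem natDegree_denPoly {k : ℕ} (hk : k + 1 ≤ n) (x : Vec n) :
    (denPoly k x).natDegree = 2 * k + 2 := by
  rw [denPoly_eq, Lagrange.natDegree_nodal, Finset.card_disjSum, card_rowSet hk]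
  ring

/-- The residue functional `N ↦ ∑ res (N / D)` for `D = A_m(u) A_m(u + 1)`, `m = k + 1`. -/
def resFun (k : ℕ) (x : Vec n) (N : ℂ[X]) : ℂ := (N %ₘ denPoly k x).coeff (2 * k + 1)

theorem sum_lpos_row {M : Type*} [AddCommMonoid M] {m : ℕ} (hm : m < n) (f : Pos n → M) :
    ∑ p : LPos n with p.1.row = m, f p.1 = ∑ p ∈ rowSet n m, f p := by
  refine Finset.sum_bij (fun p _ => p.1) ?_ ?_ ?_ ?_
  · intro p hp
    rw [mem_rowSet]
    simpa using hp
  · intro p _ q _ h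
    exact Subtype.ext h
  · intro p hp
    rw [mem_rowSet] at hp
    exact ⟨⟨p, by omega⟩, by simpa using hp, rfl⟩
  · intro p _
    rfl

theorem gtCoeff_bump_self {S : Finset (Pos n)} {p : Pos n} (hp : p ∉ S) (x : Vec n) (ε : ℤ) :
    gtCoeff S p (bump x p ε) =
      (∏ q ∈ S, (x p + ε - x q)) / ∏ q ∈ (rowSet n p.row).erase p, (x p + ε - x q) := by
  unfold gtCoeff
  congr 1
  · refine Finset.prod_congr rfl fun q hq => ?_
    rw [bump_self, bump_of_ne _ _ (fun h : q = p => hp (h ▸ hq))]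
  · refine Finset.prod_congr rfl fun q hq => ?_
    rw [bump_self, bump_of_ne _ _ (Finset.mem_erase.mp hq).1]

theorem eval_rowPoly (m : ℕ) (x : Vec n) (c : ℂ) :
    (rowPoly m x).eval c = ∏ q ∈ rowSet n m, (c - x q) := Lagrange.eval_nodal

theorem eval_derivative_rowPoly {p : Pos n} (x : Vec n) :
    (derivative (rowPoly p.row x)).eval (x p) =
      ∏ q ∈ (rowSet n p.row).erase p, (x p - x q) := by
  rw [rowPoly, Lagrange.eval_nodal_derivative_eval_node_eq (mem_rowSet.mpr rfl),
    Lagrange.eval_nodal]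

theorem eval_numPoly (k : ℕ) (x : Vec n) (c : ℂ) : (numPoly k x).eval c =
    (∏ q ∈ rowSet n (k + 2), (c - x q)) * ∏ q ∈ rowSet n k, (c + 1 - x q) := by
  rw [numPoly, eval_mul, eval_comp, eval_rowPoly, eval_rowPoly]
  simp

theorem eval_derivative_denPoly {k : ℕ} {p : Pos n} (hp : p.row = k + 1) (x : Vec n) :
    (derivative (denPoly k x)).eval (x p) =
      (∏ q ∈ (rowSet n p.row).erase p, (x p - x q)) *
        ∏ q ∈ (rowSet n p.row).erase p, (x p + 1 - x q) := by
  have h0 : (rowPoly p.row x).eval (x p) = 0 :=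
    Lagrange.eval_nodal_at_node (mem_rowSet.mpr rfl)
  rw [denPoly, ← hp, derivative_mul, eval_add, eval_mul, eval_mul, eval_derivative_rowPoly, h0,
    zero_mul, add_zero, eval_comp, eval_rowPoly,
    ← Finset.mul_prod_erase _ _ (mem_rowSet.mpr (rfl : p.row = p.row))]
  simp

theorem eval_derivative_denPoly_sub_one {k : ℕ} {p : Pos n} (hp : p.row = k + 1) (x : Vec n) :
    (derivative (denPoly k x)).eval (x p - 1) =
      -((∏ q ∈ (rowSet n p.row).erase p, (x p - x q)) *
        ∏ q ∈ (rowSet n p.row).erase p, (x p - 1 - x q)) := by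
  have h0 : (rowPoly p.row x).eval (x p) = 0 :=
    Lagrange.eval_nodal_at_node (mem_rowSet.mpr rfl)
  rw [denPoly, ← hp, derivative_mul, eval_add, eval_mul, eval_mul, eval_comp, derivative_comp,
    eval_mul, eval_comp]
  simp only [eval_add, eval_X, eval_one, sub_add_cancel, h0, derivative_add, derivative_X,
    derivative_one, add_zero, mul_zero, zero_add, one_mul, eval_derivative_rowPoly, eval_rowPoly]
  rw [← Finset.mul_prod_erase _ _ (mem_rowSet.mpr (rfl : p.row = p.row))]
  ring

/-- At a generic vector the roots of `denPoly` are simple. -/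
theorem injOn_den {k : ℕ} (hk : k + 1 < n) {x : Vec n} (hx : IsGeneric x) :
    Set.InjOn (Sum.elim x (fun q => x q - 1))
      ((rowSet n (k + 1)).disjSum (rowSet n (k + 1)) : Finset (Pos n ⊕ Pos n)) := by
  intro s hs t ht hst
  rw [Finset.mem_coe] at hs ht
  have key : ∀ p q : Pos n, p ∈ rowSet n (k + 1) → q ∈ rowSet n (k + 1) → ∀ m : ℤ,
      x p - x q = m → p = q := by
    intro p q hp hq m h
    rw [mem_rowSet] at hp hq
    by_contra hne
    exact hx p q (hp.trans hq.symm) (by omega) hne m h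
  rcases s with p | p <;> rcases t with q | q <;>
    simp only [Finset.inl_mem_disjSum, Finset.inr_mem_disjSum] at hs ht <;>
    simp only [Sum.elim_inl, Sum.elim_inr] at hst
  · rw [key p q hs ht 0 (by push_cast; linear_combination hst)]
  · have := key p q hs ht (-1) (by push_cast; linear_combination hst)
    subst this
    exact absurd hst (by intro h; exact one_ne_zero (by linear_combination h : (1 : ℂ) = 0))
  · have := key p q hs ht 1 (by push_cast; linear_combination hst)
    subst this
    exact absurd hst (by intro h; exact one_ne_zero (by linear_combination -h : (1 : ℂ) = 0))
  · rw [key p q hs ht 0 (by push_cast; linear_combination hst)]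

/-- The raising operator weighted by a polynomial: `T(v) ↦ ∑_p G(v_p) (raiseCoeff) T(v + δ^p)`,
the sum being over the row `k + 1`. -/
def raiseOp (v : Vec n) (k : ℕ) (G : ℂ[X]) : Module.End ℂ (V n) :=
  ∑ p : LPos n with p.1.row = k + 1,
    wshift v (fun x => -(G.eval (x p.1) * gtCoeff (rowSet n (k + 2)) p.1 x)) (Pi.single p 1)

/-- The operator of `E_{k+2,k+1}` (numbered from one). -/
def lowerOp (v : Vec n) (k : ℕ) : Module.End ℂ (V n) :=
  ∑ p : LPos n with p.1.row = k + 1, gtOp v (rowSet n k) (-1) p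

theorem lie_raise_lower_ne {v : Vec n} (hv : IsGeneric v) (k : ℕ) (G : ℂ[X]) {p q : LPos n}
    (hp : p.1.row = k + 1) (hq : q.1.row = k + 1) (hpq : p ≠ q) :
    ⁅wshift v (fun x => -(G.eval (x p.1) * gtCoeff (rowSet n (k + 2)) p.1 x)) (Pi.single p 1),
      gtOp v (rowSet n k) (-1) q⁆ = 0 := by
  have hne : p.1 ≠ q.1 := fun h => hpq (Subtype.ext h)
  rw [gtOp, lie_wshift]
  apply wshift_eq_zero hv
  intro x hx
  have hrow : q.1.row = p.1.row := hq.trans hp.symm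
  rw [addShift_single, addShift_single, bump_of_ne _ _ hne,
    gtCoeff_bump_row x (-1) (by rw [mem_rowSet]; omega) hrow hne
      (hx.sub_ne_zero hrow.symm p.2 hne),
    gtCoeff_bump_row x 1 (by rw [mem_rowSet]; omega) hrow.symm hne.symm
      (hx.sub_ne_zero hrow q.2 hne.symm)]
  have n1 := hx.sub_sub_ne_zero hrow.symm p.2 hne (-1)
  have n2 := hx.sub_sub_ne_zero hrow q.2 hne.symm 1
  generalize gtCoeff (rowSet n (k + 2)) p.1 x = c
  generalize gtCoeff (rowSet n k) q.1 x = c'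
  push_cast at n1 n2 ⊢
  field_simp
  ring

/-- The terms that return to `T(v)` are the residues of `G N / D` at `v_p` and `v_p - 1`, for
`N` and `D` the polynomials `numPoly` and `denPoly`. -/
theorem lie_raise_lower_self {v : Vec n} (hv : IsGeneric v) (k : ℕ) (G : ℂ[X]) {p : LPos n}
    (hp : p.1.row = k + 1) :
    ⁅wshift v (fun x => -(G.eval (x p.1) * gtCoeff (rowSet n (k + 2)) p.1 x)) (Pi.single p 1),
      gtOp v (rowSet n k) (-1) p⁆ =
    wshift v (fun x => (G * numPoly k x).eval (x p.1) / (derivative (denPoly k x)).eval (x p.1) +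
      (G * numPoly k x).eval (x p.1 - 1) / (derivative (denPoly k x)).eval (x p.1 - 1)) 0 := by
  rw [gtOp, lie_wshift, ← Pi.single_add]
  simp only [add_neg_cancel, Pi.single_zero]
  apply wshift_congr hv
  intro x hx
  rw [addShift_single, addShift_single, gtCoeff_bump_self (by rw [mem_rowSet]; omega),
    gtCoeff_bump_self (by rw [mem_rowSet]; omega), bump_self, eval_derivative_denPoly hp,
    eval_derivative_denPoly_sub_one hp, eval_mul, eval_mul, eval_numPoly, eval_numPoly, gtCoeff,
    gtCoeff]
  push_cast
  rw [← sub_eq_add_neg, sub_add_cancel, div_neg]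
  simp only [div_eq_mul_inv, mul_inv]
  ring

/-- The commutator of a weighted raising operator with the lowering operator is diagonal; its
eigenvalue is a sum of residues. -/
theorem lie_raiseOp_lowerOp {v : Vec n} (hv : IsGeneric v) {k : ℕ} (hk : k + 1 < n) (G : ℂ[X]) :
    ⁅raiseOp v k G, lowerOp v k⁆ = wshift v (fun x => resFun k x (G * numPoly k x)) 0 := by
  have h1 : ⁅raiseOp v k G, lowerOp v k⁆ =
      ∑ p : LPos n with p.1.row = k + 1,
        ⁅wshift v (fun x => -(G.eval (x p.1) * gtCoeff (rowSet n (k + 2)) p.1 x))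
          (Pi.single p 1), gtOp v (rowSet n k) (-1) p⁆ := by
    rw [raiseOp, lowerOp, sum_lie_end]
    refine Finset.sum_congr rfl fun p hp => ?_
    rw [lie_end_sum]
    refine Finset.sum_eq_single_of_mem p hp fun q hq hqp => ?_
    simp only [Finset.mem_filter, Finset.mem_univ, true_and] at hp hq
    exact lie_raise_lower_ne hv k G hp hq hqp.symm
  rw [h1, Finset.sum_congr rfl fun p hp => lie_raise_lower_self hv k G (Finset.mem_filter.mp hp).2,
    wshift_sum]
  apply wshift_congr hv
  intro x hx
  rw [sum_lpos_row hk (fun p => (G * numPoly k x).eval (x p) /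
      (derivative (denPoly k x)).eval (x p) + (G * numPoly k x).eval (x p - 1) /
      (derivative (denPoly k x)).eval (x p - 1)), Finset.sum_add_distrib]
  have hcard : ((rowSet n (k + 1)).disjSum (rowSet n (k + 1))).card - 1 = 2 * k + 1 := by
    rw [Finset.card_disjSum, card_rowSet hk.le]; omega
  have := sum_eval_div_derivative _ _ (injOn_den hk hx) (G * numPoly k x)
  rw [← denPoly_eq, hcard, Finset.sum_disjSum] at this
  exact this

theorem nextCoeff_nodal (s : Finset (Pos n)) (u : Pos n → ℂ) :
    (Lagrange.nodal s u).nextCoeff = -∑ q ∈ s, u q := by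
  rw [Lagrange.nodal, prod_X_sub_C_nextCoeff]

theorem nextCoeff_numPoly {k : ℕ} (hk : k ≤ n) (x : Vec n) : (numPoly k x).nextCoeff =
    -∑ q ∈ rowSet n (k + 2), x q - ∑ q ∈ rowSet n k, x q + k := by
  rw [numPoly, rowPoly_comp, rowPoly, Monic.nextCoeff_mul Lagrange.nodal_monic
    Lagrange.nodal_monic, nextCoeff_nodal, nextCoeff_nodal, Finset.sum_sub_distrib,
    Finset.sum_const, card_rowSet hk]
  simp
  ring

theorem nextCoeff_denPoly {k : ℕ} (hk : k + 1 ≤ n) (x : Vec n) : (denPoly k x).nextCoeff =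
    -2 * ∑ q ∈ rowSet n (k + 1), x q + (k + 1) := by
  rw [denPoly, rowPoly_comp, rowPoly, Monic.nextCoeff_mul Lagrange.nodal_monic
    Lagrange.nodal_monic, nextCoeff_nodal, nextCoeff_nodal, Finset.sum_sub_distrib,
    Finset.sum_const, card_rowSet hk]
  simp
  ring

theorem numPoly_monic (k : ℕ) (x : Vec n) : (numPoly k x).Monic := by
  rw [numPoly, rowPoly_comp]
  exact Lagrange.nodal_monic.mul Lagrange.nodal_monic

theorem natDegree_numPoly {k : ℕ} (hk : k + 2 ≤ n) (x : Vec n) :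
    (numPoly k x).natDegree = 2 * k + 2 := by
  rw [numPoly, rowPoly_comp, rowPoly, Monic.natDegree_mul Lagrange.nodal_monic
    Lagrange.nodal_monic, Lagrange.natDegree_nodal, Lagrange.natDegree_nodal, card_rowSet hk,
    card_rowSet (by omega)]
  ring

/-- As `N` and `D` are monic of the same degree, the sum of the residues of `N / D` is the
difference of their subleading coefficients. -/
theorem resFun_numPoly {k : ℕ} (hk : k + 1 < n) (x : Vec n) :
    resFun k x (numPoly k x) = diagCoeff (k + 1) x - diagCoeff (k + 2) x := by
  have hN := natDegree_numPoly (x := x) (show k + 2 ≤ n by omega)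
  have hD := natDegree_denPoly (x := x) (show k + 1 ≤ n by omega)
  have hmod : numPoly k x %ₘ denPoly k x = numPoly k x - denPoly k x := by
    refine (div_modByMonic_unique 1 _ (denPoly_monic k x) ⟨by ring, ?_⟩).2
    have hdeg : (numPoly k x).degree = (denPoly k x).degree := by
      rw [degree_eq_natDegree (numPoly_monic k x).ne_zero,
        degree_eq_natDegree (denPoly_monic k x).ne_zero, hN, hD]
    rw [← hdeg]
    exact degree_sub_lt_left hdeg (numPoly_monic k x).ne_zero
      ((numPoly_monic k x).leadingCoeff.trans (denPoly_monic k x).leadingCoeff.symm)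
  have h1 : (numPoly k x).coeff (2 * k + 1) = (numPoly k x).nextCoeff := by
    rw [nextCoeff_of_natDegree_pos (by omega), hN]
    rfl
  have h2 : (denPoly k x).coeff (2 * k + 1) = (denPoly k x).nextCoeff := by
    rw [nextCoeff_of_natDegree_pos (by omega), hD]
    rfl
  rw [resFun, hmod, coeff_sub, h1, h2, nextCoeff_numPoly (by omega),
    nextCoeff_denPoly (by omega), diagCoeff, diagCoeff]
  simp only [Nat.add_sub_cancel, show k + 2 - 1 = k + 1 from rfl]
  push_cast
  ring

end SingularGT

end

/-! ### Generic Gelfand–Tsetlin modules -/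

noncomputable section

namespace SingularGT

open Polynomial

variable {n : ℕ}

/-- The sum of the operators `gtOp v S ε p` over the positions `p` of row `m`. -/
def rowOp (v : Vec n) (S : Finset (Pos n)) (ε : ℤ) (m : ℕ) : Module.End ℂ (V n) :=
  ∑ p : LPos n with p.1.row = m, gtOp v S ε p

/-- The operator of `E_{i+1,i+1}` (numbered from one). -/
def diagOp (v : Vec n) (i : ℕ) : Module.End ℂ (V n) := wshift v (diagCoeff (i + 1)) 0

theorem raiseOp_one (v : Vec n) (k : ℕ) :
    raiseOp v k 1 = (-1 : ℂ) • rowOp v (rowSet n (k + 2)) 1 (k + 1) := by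
  rw [raiseOp, rowOp, Finset.smul_sum]
  refine Finset.sum_congr rfl fun p _ => end_ext fun z => ?_
  rw [gtOp, LinearMap.smul_apply, wshift_Tab, wshift_Tab, smul_smul]
  simp

theorem sum_bump (x : Vec n) (p : Pos n) (ε : ℤ) (m : ℕ) :
    ∑ q ∈ rowSet n m, bump x p ε q =
      ∑ q ∈ rowSet n m, x q + if p.row = m then (ε : ℂ) else 0 := by
  have : ∀ q, bump x p ε q = x q + if p = q then (ε : ℂ) else 0 := by
    intro q
    rcases eq_or_ne q p with rfl | h
    · simp
    · simp [bump_of_ne _ _ h, h.symm]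
  simp only [this, Finset.sum_add_distrib, Finset.sum_ite_eq, mem_rowSet]

theorem diagCoeff_bump (x : Vec n) (p : Pos n) (ε : ℤ) (i : ℕ) :
    diagCoeff (i + 1) (bump x p ε) = diagCoeff (i + 1) x +
      ε * ((if p.row = i + 1 then 1 else 0) - if p.row = i then 1 else 0) := by
  rw [diagCoeff, diagCoeff, sum_bump, sum_bump]
  simp only [Nat.add_sub_cancel]
  split_ifs <;> ring

theorem lie_diagOp_rowOp (v : Vec n) (S : Finset (Pos n)) (ε : ℤ) (m i : ℕ) :
    ⁅diagOp v i, rowOp v S ε m⁆ =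
      ((ε : ℂ) * ((if m = i + 1 then 1 else 0) - if m = i then 1 else 0)) • rowOp v S ε m := by
  rw [rowOp, lie_end_sum, Finset.smul_sum]
  refine Finset.sum_congr rfl fun p hp => ?_
  obtain rfl : p.1.row = m := (Finset.mem_filter.mp hp).2
  rw [diagOp, gtOp, lie_wshift, zero_add]
  apply end_ext
  intro z
  rw [LinearMap.smul_apply, wshift_Tab, wshift_Tab, smul_smul, addShift_single, addShift_zero,
    diagCoeff_bump]
  congr 1
  ring

theorem lie_rowOp_rowOp_eq_zero {v : Vec n} {S S' : Finset (Pos n)} {ε ε' : ℤ} {m m' : ℕ}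
    (h : ∀ p q : LPos n, p.1.row = m → q.1.row = m' → ⁅gtOp v S ε p, gtOp v S' ε' q⁆ = 0) :
    ⁅rowOp v S ε m, rowOp v S' ε' m'⁆ = 0 := by
  rw [rowOp, rowOp, sum_lie_end]
  refine Finset.sum_eq_zero fun p hp => ?_
  rw [lie_end_sum]
  refine Finset.sum_eq_zero fun q hq => ?_
  exact h p q (Finset.mem_filter.mp hp).2 (Finset.mem_filter.mp hq).2

/-- The Serre relations hold for the terms only after symmetrization in `p` and `p'`. -/
theorem lie_lie_rowOp_eq_zero {v : Vec n} {S S' : Finset (Pos n)} {ε ε' : ℤ} {m m' : ℕ}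
    (h : ∀ p p' q : LPos n, p.1.row = m → p'.1.row = m → q.1.row = m' →
      ⁅gtOp v S ε p, ⁅gtOp v S ε p', gtOp v S' ε' q⁆⁆ +
        ⁅gtOp v S ε p', ⁅gtOp v S ε p, gtOp v S' ε' q⁆⁆ = 0) :
    ⁅rowOp v S ε m, ⁅rowOp v S ε m, rowOp v S' ε' m'⁆⁆ = 0 := by
  have expand : ⁅rowOp v S ε m, ⁅rowOp v S ε m, rowOp v S' ε' m'⁆⁆ =
      ∑ p : LPos n with p.1.row = m, ∑ p' : LPos n with p'.1.row = m,
        ∑ q : LPos n with q.1.row = m', ⁅gtOp v S ε p, ⁅gtOp v S ε p', gtOp v S' ε' q⁆⁆ := by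
    rw [rowOp, sum_lie_end]
    refine Finset.sum_congr rfl fun p _ => ?_
    rw [sum_lie_end, lie_end_sum]
    refine Finset.sum_congr rfl fun p' _ => ?_
    rw [rowOp, lie_end_sum, lie_end_sum]
  have double : (2 : ℂ) • ⁅rowOp v S ε m, ⁅rowOp v S ε m, rowOp v S' ε' m'⁆⁆ = 0 := by
    rw [two_smul]
    nth_rw 2 [expand]
    rw [Finset.sum_comm, expand, ← Finset.sum_add_distrib]
    refine Finset.sum_eq_zero fun p hp => ?_
    rw [← Finset.sum_add_distrib]
    refine Finset.sum_eq_zero fun p' hp' => ?_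
    rw [← Finset.sum_add_distrib]
    refine Finset.sum_eq_zero fun q hq => ?_
    exact h p p' q (Finset.mem_filter.mp hp).2 (Finset.mem_filter.mp hp').2
      (Finset.mem_filter.mp hq).2
  exact (smul_eq_zero.mp double).resolve_left two_ne_zero

/-- The Gelfand–Tsetlin formulas at a generic vector satisfy the Chevalley–Serre relations. -/
theorem isSerreSystem_generic {v : Vec n} (hv : IsGeneric v) :
    IsSerreSystem n (fun k => raiseOp v k 1) (lowerOp v) (diagOp v) := by
  have hl : ∀ k, lowerOp v k = rowOp v (rowSet n k) (-1) (k + 1) := fun k => rfl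
  constructor
  · intro i j _ _
    change ⁅diagOp v i, diagOp v j⁆ = 0
    rw [diagOp, diagOp, lie_wshift]
    apply wshift_eq_zero hv
    intro x _
    rw [addShift_zero]
    ring
  · intro m _
    change ⁅diagOp v m, raiseOp v m 1⁆ = raiseOp v m 1
    rw [raiseOp_one, lie_smul_end, lie_diagOp_rowOp]
    simp
  · intro m _
    change ⁅diagOp v (m + 1), raiseOp v m 1⁆ = -raiseOp v m 1
    rw [raiseOp_one, lie_smul_end, lie_diagOp_rowOp]
    rw [if_neg (by omega), if_pos rfl, show ((1 : ℤ) : ℂ) * (0 - 1) = -1 by norm_num]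
    exact neg_one_smul ℂ (_ : Module.End ℂ (V n))
  · intro i m _ _ h1 h2
    change ⁅diagOp v i, raiseOp v m 1⁆ = 0
    rw [raiseOp_one, lie_smul_end, lie_diagOp_rowOp, if_neg (by omega), if_neg (by omega)]
    simp
  · intro m _
    change ⁅diagOp v m, lowerOp v m⁆ = -lowerOp v m
    rw [hl, lie_diagOp_rowOp]
    rw [if_pos rfl, if_neg (by omega), show ((-1 : ℤ) : ℂ) * (1 - 0) = -1 by norm_num]
    exact neg_one_smul ℂ (_ : Module.End ℂ (V n))
  · intro m _
    change ⁅diagOp v (m + 1), lowerOp v m⁆ = lowerOp v m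
    rw [hl, lie_diagOp_rowOp]
    simp
  · intro i m _ _ h1 h2
    change ⁅diagOp v i, lowerOp v m⁆ = 0
    rw [hl, lie_diagOp_rowOp, if_neg (by omega), if_neg (by omega)]
    simp
  · intro m hm
    change ⁅raiseOp v m 1, lowerOp v m⁆ = diagOp v m - diagOp v (m + 1)
    rw [lie_raiseOp_lowerOp hv hm, diagOp, diagOp, wshift_sub]
    congr 1
    funext x
    rw [one_mul, resFun_numPoly hm]
  · intro m l _ _ hml
    change ⁅raiseOp v m 1, lowerOp v l⁆ = 0
    have : ⁅rowOp v (rowSet n (m + 2)) 1 (m + 1), rowOp v (rowSet n l) (-1) (l + 1)⁆ = 0 := by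
      apply lie_rowOp_rowOp_eq_zero
      intro p q hp hq
      by_cases h : l = m + 1
      · exact lie_gtOp_adjacent 1 (by omega) (by rw [mem_rowSet]; omega) (by rw [mem_rowSet]; omega)
      · exact lie_gtOp_far _ _ (by omega) (by rw [mem_rowSet]; omega) (by rw [mem_rowSet]; omega)
    rw [raiseOp_one, hl, smul_lie_end, this, smul_zero]
  · intro m l hml _
    change ⁅raiseOp v m 1, raiseOp v l 1⁆ = 0
    have : ⁅rowOp v (rowSet n (m + 2)) 1 (m + 1), rowOp v (rowSet n (l + 2)) 1 (l + 1)⁆ = 0 := by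
      apply lie_rowOp_rowOp_eq_zero
      intro p q hp hq
      exact lie_gtOp_far _ _ (by omega) (by rw [mem_rowSet]; omega) (by rw [mem_rowSet]; omega)
    rw [raiseOp_one, raiseOp_one, smul_lie_end, lie_smul_end, this, smul_zero, smul_zero]
  · intro m l hml _
    change ⁅lowerOp v m, lowerOp v l⁆ = 0
    rw [hl, hl]
    apply lie_rowOp_rowOp_eq_zero
    intro p q hp hq
    exact lie_gtOp_far _ _ (by omega) (by rw [mem_rowSet]; omega) (by rw [mem_rowSet]; omega)
  · intro m _
    change ⁅raiseOp v m 1, ⁅raiseOp v m 1, raiseOp v (m + 1) 1⁆⁆ = 0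
    rw [raiseOp_one, raiseOp_one, smul_lie_end, smul_lie_end, lie_smul_end, lie_smul_end,
      lie_smul_end, lie_lie_rowOp_eq_zero, smul_zero, smul_zero, smul_zero]
    intro p p' q hp hp' hq
    exact serre_lower hv 1 (by omega) (by omega) (fun r hr => by rw [mem_rowSet] at hr; omega)
      (fun r hr => by rw [mem_rowSet] at hr; omega) (by rw [mem_rowSet]; omega)
  · intro m _
    change ⁅raiseOp v (m + 1) 1, ⁅raiseOp v (m + 1) 1, raiseOp v m 1⁆⁆ = 0
    rw [raiseOp_one, raiseOp_one, smul_lie_end, smul_lie_end, lie_smul_end, lie_smul_end,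
      lie_smul_end, lie_lie_rowOp_eq_zero, smul_zero, smul_zero, smul_zero]
    intro p p' q hp hp' hq
    exact serre_upper hv 1 (by omega) (by omega) (fun r hr => by rw [mem_rowSet] at hr; omega)
      (by rw [mem_rowSet]; omega) (by rw [mem_rowSet]; omega) (by rw [mem_rowSet]; omega)
  · intro m _
    change ⁅lowerOp v m, ⁅lowerOp v m, lowerOp v (m + 1)⁆⁆ = 0
    rw [hl, hl]
    apply lie_lie_rowOp_eq_zero
    intro p p' q hp hp' hq
    exact serre_upper hv (-1) (by omega) (by omega) (fun r hr => by rw [mem_rowSet] at hr; omega)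
      (by rw [mem_rowSet]; omega) (by rw [mem_rowSet]; omega) (by rw [mem_rowSet]; omega)
  · intro m _
    change ⁅lowerOp v (m + 1), ⁅lowerOp v (m + 1), lowerOp v m⁆⁆ = 0
    rw [hl, hl]
    apply lie_lie_rowOp_eq_zero
    intro p p' q hp hp' hq
    exact serre_lower hv (-1) (by omega) (by omega) (fun r hr => by rw [mem_rowSet] at hr; omega)
      (fun r hr => by rw [mem_rowSet] at hr; omega) (by rw [mem_rowSet]; omega)

/-- Evaluation of the coefficients of a formal sum at the vector `v`. -/
def evalAt (v : Vec n) : (Shift n →₀ (Vec n → ℂ)) →ₗ[ℂ] V n :=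
  Finsupp.mapRange.linearMap (LinearMap.proj v)

theorem evalAt_single (v : Vec n) (y : Shift n) (f : Vec n → ℂ) :
    evalAt v (Finsupp.single y f) = f v • Tab y := by
  simp [evalAt, Tab]

/-- `ρ` is the `U(gl(n))`-module with basis `T(v + z)` given by the Gelfand–Tsetlin formulas. -/
def IsGTAction (v : Vec n) (ρ : U n →ₐ[ℂ] Module.End ℂ (V n)) : Prop :=
  ∀ r s : Fin n, r.val ≤ s.val + 1 → s.val ≤ r.val + 1 → ∀ z : Shift n,
    ρ (E r s) (Tab z) = evalAt v (gtFormula r s z)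

theorem raiseOp_one_Tab (v : Vec n) {r s : Fin n} (h : r.val + 1 = s.val) (z : Shift n) :
    raiseOp v r 1 (Tab z) = evalAt v (gtFormula r s z) := by
  rw [gtFormula, if_pos h, map_sum, raiseOp, LinearMap.sum_apply]
  refine Finset.sum_congr rfl fun p hp => ?_
  rw [evalAt_single, wshift_Tab, raiseCoeff, gtCoeff, (Finset.mem_filter.mp hp).2, eval_one,
    one_mul]

theorem lowerOp_Tab (v : Vec n) {r s : Fin n} (h : s.val + 1 = r.val) (z : Shift n) :
    lowerOp v s (Tab z) = evalAt v (gtFormula r s z) := by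
  rw [gtFormula, if_neg (by omega), if_pos h, map_sum, lowerOp, LinearMap.sum_apply]
  refine Finset.sum_congr rfl fun p hp => ?_
  rw [evalAt_single, gtOp, wshift_Tab, lowerCoeff, gtCoeff, (Finset.mem_filter.mp hp).2,
    Pi.single_neg, ← sub_eq_add_neg, Nat.add_sub_cancel]

theorem diagOp_Tab (v : Vec n) (r : Fin n) (z : Shift n) :
    diagOp v r (Tab z) = evalAt v (gtFormula r r z) := by
  rw [gtFormula, if_neg (by omega), if_neg (by omega), if_pos rfl, evalAt_single, diagOp,
    wshift_Tab, add_zero]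

/-- The Gelfand–Tsetlin formulas at a generic vector define a representation. -/
theorem exists_isGTAction {v : Vec n} (hv : IsGeneric v) :
    ∃ ρ : U n →ₐ[ℂ] Module.End ℂ (V n), IsGTAction v ρ := by
  obtain ⟨ρ, hρ⟩ := exists_algHom_of_isUnitSystem
    (isUnitSystem_unitOf (isSerreSystem_generic hv) n le_rfl)
  refine ⟨ρ, fun r s h1 h2 z => ?_⟩
  rw [hρ]
  rcases lt_trichotomy r.val s.val with h | h | h
  · have hs : s.val = r.val + 1 := by omega
    rw [hs, unitOf_last_self, raiseOp_one_Tab v hs.symm]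
  · obtain rfl := Fin.ext h
    rw [unitOf_self, diagOp_Tab]
  · have hr : r.val = s.val + 1 := by omega
    rw [← lowerOp_Tab v hr.symm, hr]
    simp [unitOf, lowerRoot]

theorem IsGTAction.raise {v : Vec n} {ρ : U n →ₐ[ℂ] Module.End ℂ (V n)} (H : IsGTAction v ρ)
    {k : ℕ} (hk : k + 1 < n) :
    ρ (E ⟨k, by omega⟩ ⟨k + 1, hk⟩) = raiseOp v k 1 :=
  end_ext fun z => by
    rw [H _ _ (by simp; omega) (by simp)]
    exact (raiseOp_one_Tab v (r := ⟨k, by omega⟩) (s := ⟨k + 1, hk⟩) rfl z).symm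

theorem IsGTAction.lower {v : Vec n} {ρ : U n →ₐ[ℂ] Module.End ℂ (V n)} (H : IsGTAction v ρ)
    {k : ℕ} (hk : k + 1 < n) :
    ρ (E ⟨k + 1, hk⟩ ⟨k, by omega⟩) = lowerOp v k :=
  end_ext fun z => by
    rw [H _ _ (by simp) (by simp; omega)]
    exact (lowerOp_Tab v (r := ⟨k + 1, hk⟩) (s := ⟨k, by omega⟩) rfl z).symm

theorem IsGTAction.diag {v : Vec n} {ρ : U n →ₐ[ℂ] Module.End ℂ (V n)} (H : IsGTAction v ρ)
    (r : Fin n) : ρ (E r r) = diagOp v r :=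
  end_ext fun z => by
    rw [H _ _ (by omega) (by omega)]
    exact (diagOp_Tab v r z).symm

end SingularGT

end

/-! ### Symmetric functions of the rows as eigenvalues -/

noncomputable section

namespace SingularGT

open Polynomial

variable {n : ℕ}

/-- The functions `γ` for which some element of `U(gl(n))`, the same for all generic `v`, acts on
the generic modules by `T(v + z) ↦ γ(v + z) T(v + z)`. -/
def eigenfunctions (n : ℕ) : Subalgebra ℂ (Vec n → ℂ) where
  carrier := {γ | ∃ u : U n, ∀ v, IsGeneric v → ∀ ρ, IsGTAction v ρ → ρ u = wshift v γ 0}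
  mul_mem' := by
    rintro γ γ' ⟨u, hu⟩ ⟨u', hu'⟩
    refine ⟨u * u', fun v hv ρ hρ => ?_⟩
    rw [map_mul, hu v hv ρ hρ, hu' v hv ρ hρ, wshift_mul, add_zero]
    congr 1
    funext x
    rw [addShift_zero, mul_comm, Pi.mul_apply]
  add_mem' := by
    rintro γ γ' ⟨u, hu⟩ ⟨u', hu'⟩
    refine ⟨u + u', fun v hv ρ hρ => ?_⟩
    rw [map_add, hu v hv ρ hρ, hu' v hv ρ hρ, wshift_add]
    rfl
  algebraMap_mem' := by
    intro c
    refine ⟨algebraMap ℂ _ c, fun v hv ρ hρ => end_ext fun z => ?_⟩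
    rw [AlgHom.commutes, wshift_Tab, Module.algebraMap_end_apply, add_zero]
    rfl

/-- Some element of `U(gl(n))` acts on all generic modules by `raiseOp v k G`. -/
def IsRaising (n k : ℕ) (G : ℂ[X]) : Prop :=
  ∃ u : U n, ∀ v, IsGeneric v → ∀ ρ, IsGTAction v ρ → ρ u = raiseOp v k G

theorem rowPoly_eq_mul (p : Pos n) (x : Vec n) :
    rowPoly p.row x =
      (X - C (x p)) * ∏ q ∈ (rowSet n p.row).erase p, (X - C (x q)) := by
  rw [rowPoly, Lagrange.nodal,
    Finset.mul_prod_erase _ (fun q => X - C (x q)) (mem_rowSet.mpr rfl)]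

theorem coeff_rowPoly_self {m : ℕ} (hm : m ≤ n) (x : Vec n) : (rowPoly m x).coeff m = 1 := by
  have := rowPoly_monic m x
  rwa [Monic, leadingCoeff, natDegree_rowPoly hm] at this

/-- The second elementary symmetric function of a row changes by a linear function when an entry
of the row is raised by one. -/
theorem coeff_X_mul_rowPoly_bump {k : ℕ} (hk : k + 1 ≤ n) {p : Pos n} (hp : p.row = k + 1)
    (x : Vec n) :
    (X * rowPoly (k + 1) (bump x p 1)).coeff k =
      (X * rowPoly (k + 1) x).coeff k - ((X * rowPoly (k + 1) x).coeff (k + 1) + x p) := by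
  set Q : ℂ[X] := ∏ q ∈ (rowSet n p.row).erase p, (X - C (x q)) with hQ
  have hQm : (X * Q).Monic := monic_X.mul (monic_prod_of_monic _ _ fun q _ => monic_X_sub_C _)
  have hQd : (X * Q).natDegree = k + 1 := by
    rw [Monic.natDegree_mul monic_X (monic_prod_of_monic _ _ fun q _ => monic_X_sub_C _),
      natDegree_X, natDegree_prod_of_monic _ _ (fun q _ => monic_X_sub_C _)]
    simp only [natDegree_X_sub_C, Finset.sum_const, smul_eq_mul, mul_one]
    rw [Finset.card_erase_of_mem (mem_rowSet.mpr rfl), hp, card_rowSet hk]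
    omega
  have hQ1 : (X * Q).coeff (k + 1) = 1 := by
    rw [← hQd]; exact hQm
  have h1 : X * rowPoly (k + 1) x = X * (X * Q) - C (x p) * (X * Q) := by
    rw [← hp, rowPoly_eq_mul, ← hQ]; ring
  have h2 : X * rowPoly (k + 1) (bump x p 1) = X * (X * Q) - C (x p + 1) * (X * Q) := by
    rw [← hp, rowPoly_eq_mul, bump_self]
    have : ∏ q ∈ (rowSet n p.row).erase p, (X - C (bump x p 1 q)) = Q :=
      Finset.prod_congr rfl fun q hq => by rw [bump_of_ne _ _ (Finset.mem_erase.mp hq).1]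
    rw [this, Int.cast_one]
    ring
  rw [h1, h2]
  simp only [coeff_sub, coeff_C_mul, coeff_X_mul, hQ1]
  ring

/-- The commutator of a raising operator with the second elementary symmetric function of its row
multiplies the weight by `X`, up to a multiple of the first symmetric function. -/
theorem IsRaising.X_mul {k : ℕ} (hk : k + 1 < n) {G : ℂ[X]} (hG : IsRaising n k G)
    (h1 : (fun x : Vec n => (X * rowPoly (k + 1) x).coeff (k + 1)) ∈ eigenfunctions n)
    (h2 : (fun x : Vec n => (X * rowPoly (k + 1) x).coeff k) ∈ eigenfunctions n) :
    IsRaising n k (X * G) := by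
  obtain ⟨u, hu⟩ := hG
  obtain ⟨u1, hu1⟩ := h1
  obtain ⟨u2, hu2⟩ := h2
  refine ⟨u * u2 - u2 * u - u * u1, fun v hv ρ hρ => ?_⟩
  rw [map_sub, map_sub, map_mul, map_mul, map_mul, hu v hv ρ hρ, hu1 v hv ρ hρ, hu2 v hv ρ hρ,
    raiseOp, Finset.sum_mul, Finset.mul_sum, Finset.sum_mul]
  apply end_ext
  intro z
  rw [LinearMap.sub_apply, LinearMap.sub_apply, raiseOp]
  simp only [LinearMap.sum_apply]
  rw [← Finset.sum_sub_distrib, ← Finset.sum_sub_distrib]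
  refine Finset.sum_congr rfl fun p hp => ?_
  rw [wshift_mul, wshift_mul, wshift_mul]
  simp only [wshift_Tab, add_zero, zero_add]
  rw [← sub_smul, ← sub_smul, addShift_zero, addShift_single,
    coeff_X_mul_rowPoly_bump hk.le (Finset.mem_filter.mp hp).2, eval_mul, eval_X]
  congr 1
  ring

/-- A family of polynomials that is the evaluation of one polynomial with coefficients in the
algebra of eigenfunctions. Division with remainder can then be done over this algebra, which shows
that the coefficients of the remainders are eigenfunctions. -/
def IsLiftable (P : Vec n → ℂ[X]) : Prop :=
  ∃ Q : (eigenfunctions n)[X], ∀ x,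
    Q.map ((Pi.evalRingHom (fun _ : Vec n => ℂ) x).comp (eigenfunctions n).val.toRingHom) = P x

theorem IsLiftable.coeff_mem {P : Vec n → ℂ[X]} (h : IsLiftable P) (j : ℕ) :
    (fun x => (P x).coeff j) ∈ eigenfunctions n := by
  obtain ⟨Q, hQ⟩ := h
  convert (Q.coeff j).2 using 1
  funext x
  rw [← hQ, coeff_map]
  rfl

theorem IsLiftable.of_coeff_mem {P : Vec n → ℂ[X]} (d : ℕ) (hd : ∀ x, (P x).natDegree ≤ d)
    (h : ∀ j, (fun x => (P x).coeff j) ∈ eigenfunctions n) : IsLiftable P := by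
  refine ⟨∑ j ∈ Finset.range (d + 1), C ⟨_, h j⟩ * X ^ j, fun x => ?_⟩
  rw [Polynomial.map_sum, (P x).as_sum_range_C_mul_X_pow' (Nat.lt_succ_of_le (hd x))]
  refine Finset.sum_congr rfl fun j _ => ?_
  rw [Polynomial.map_mul, Polynomial.map_pow, map_X, map_C]
  rfl

theorem IsLiftable.mul {P P' : Vec n → ℂ[X]} (h : IsLiftable P) (h' : IsLiftable P') :
    IsLiftable (fun x => P x * P' x) := by
  obtain ⟨Q, hQ⟩ := h
  obtain ⟨Q', hQ'⟩ := h'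
  exact ⟨Q * Q', fun x => by rw [Polynomial.map_mul, hQ, hQ']⟩

theorem isLiftable_X_pow (j : ℕ) : IsLiftable (fun _ : Vec n => (X ^ j : ℂ[X])) :=
  ⟨X ^ j, fun x => by simp⟩

theorem IsLiftable.comp_X_add_one {P : Vec n → ℂ[X]} (h : IsLiftable P) :
    IsLiftable (fun x => (P x).comp (X + 1)) := by
  obtain ⟨Q, hQ⟩ := h
  exact ⟨Q.comp (X + 1), fun x => by rw [map_comp, hQ]; simp⟩

theorem IsLiftable.modByMonic {P D : Vec n → ℂ[X]} (h : IsLiftable P) (hD : IsLiftable D)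
    (d : ℕ) (hd : ∀ x, (D x).natDegree = d) (hm : ∀ x, (D x).Monic) :
    IsLiftable (fun x => P x %ₘ D x) := by
  obtain ⟨Q, hQ⟩ := h
  obtain ⟨Q', hQ'⟩ := hD
  have hcoeff : ∀ j x, (Q'.coeff j).1 x = (D x).coeff j := by
    intro j x
    rw [← hQ', coeff_map]
    rfl
  have hmonic : Q'.Monic := by
    apply monic_of_natDegree_le_of_coeff_eq_one d
    · rw [natDegree_le_iff_coeff_eq_zero]
      intro j hj
      apply Subtype.ext
      funext x
      rw [hcoeff, coeff_eq_zero_of_natDegree_lt (by rw [hd]; exact hj)]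
      rfl
    · apply Subtype.ext
      funext x
      rw [hcoeff, ← hd x]
      exact hm x
  exact ⟨Q %ₘ Q', fun x => by rw [map_modByMonic _ hmonic, hQ, hQ']⟩

theorem resFun_add (k : ℕ) (x : Vec n) (P Q : ℂ[X]) :
    resFun k x (P + Q) = resFun k x P + resFun k x Q := by
  rw [resFun, add_modByMonic, coeff_add]; rfl

theorem resFun_C_mul (k : ℕ) (x : Vec n) (c : ℂ) (P : ℂ[X]) :
    resFun k x (C c * P) = c * resFun k x P := by
  rw [resFun, ← smul_eq_C_mul, smul_modByMonic, coeff_smul, smul_eq_mul]; rfl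

theorem resFun_sum {ι : Type*} (k : ℕ) (x : Vec n) (s : Finset ι) (P : ι → ℂ[X]) :
    resFun k x (∑ i ∈ s, P i) = ∑ i ∈ s, resFun k x (P i) := by
  classical
  induction s using Finset.induction_on with
  | empty => simp [resFun]
  | insert i s hi ih => rw [Finset.sum_insert hi, Finset.sum_insert hi, resFun_add, ih]

theorem resFun_of_degree_lt {k : ℕ} (hk : k + 1 ≤ n) (x : Vec n) {P : ℂ[X]}
    (hP : P.natDegree < 2 * k + 2) : resFun k x P = P.coeff (2 * k + 1) := by
  rw [resFun, (modByMonic_eq_self_iff (denPoly_monic k x)).mpr]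
  apply degree_lt_degree
  rwa [natDegree_denPoly hk]

/-- The inductive step: if the elementary symmetric functions of the rows `k` and `k + 1` are
eigenfunctions, so are those of the row `k + 2`. They are found from the highest degree downwards
in the residues of `u ^ j A_{k+2}(u) A_k(u + 1) / (A_{k+1}(u) A_{k+1}(u + 1))`. -/
theorem coeff_rowPoly_mem_succ {k : ℕ} (hk : k + 1 < n)
    (h0 : ∀ j, (fun x : Vec n => (rowPoly k x).coeff j) ∈ eigenfunctions n)
    (h1 : ∀ j, (fun x : Vec n => (rowPoly (k + 1) x).coeff j) ∈ eigenfunctions n) (i : ℕ) :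
    (fun x : Vec n => (rowPoly (k + 2) x).coeff i) ∈ eigenfunctions n := by
  have l0 : IsLiftable (fun x : Vec n => rowPoly k x) :=
    IsLiftable.of_coeff_mem k (fun x => (natDegree_rowPoly (by omega) x).le) h0
  have l1 : IsLiftable (fun x : Vec n => rowPoly (k + 1) x) :=
    IsLiftable.of_coeff_mem (k + 1) (fun x => (natDegree_rowPoly (by omega) x).le) h1
  have lX : IsLiftable (fun x : Vec n => X * rowPoly (k + 1) x) := by
    simpa using (isLiftable_X_pow 1).mul l1
  have lB : IsLiftable (fun x : Vec n => (rowPoly k x).comp (X + 1)) := l0.comp_X_add_one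
  have lD : IsLiftable (fun x : Vec n => denPoly k x) := l1.mul l1.comp_X_add_one
  have raising : ∀ j, IsRaising n k (X ^ j) := by
    intro j
    induction j with
    | zero =>
      refine ⟨E ⟨k, by omega⟩ ⟨k + 1, hk⟩, fun v hv ρ hρ => ?_⟩
      rw [hρ.raise hk, pow_zero]
    | succ j ih =>
      rw [pow_succ']
      exact ih.X_mul hk (lX.coeff_mem _) (lX.coeff_mem _)
  have residue : ∀ j, (fun x : Vec n => resFun k x (X ^ j * numPoly k x)) ∈
      eigenfunctions n := by
    intro j
    obtain ⟨u, hu⟩ := raising j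
    refine ⟨u * E ⟨k + 1, hk⟩ ⟨k, by omega⟩ - E ⟨k + 1, hk⟩ ⟨k, by omega⟩ * u,
      fun v hv ρ hρ => ?_⟩
    rw [map_sub, map_mul, map_mul, hu v hv ρ hρ, hρ.lower hk, ← lie_raiseOp_lowerOp hv hk]
    rfl
  -- The sums `∑ l, c l * r (l + j)`, for `c l` the coefficients of `A_{k+2}`, are eigenfunctions. As
  -- `r l` is zero for `l < k + 1` and one for `l = k + 1`, taking `j = k + 1 - i` expresses `c i`
  -- through the `c l` with `l > i`.
  set r : ℕ → Vec n → ℂ := fun j x => resFun k x (X ^ j * (rowPoly k x).comp (X + 1)) with hr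
  have r_mem : ∀ j, r j ∈ eigenfunctions n := fun j =>
    (((isLiftable_X_pow j).mul lB).modByMonic lD (2 * k + 2)
      (fun x => natDegree_denPoly hk.le x) (denPoly_monic k)).coeff_mem _
  have hBm : ∀ j (x : Vec n), (X ^ j * (rowPoly k x).comp (X + 1)).Monic := fun j x => by
    rw [rowPoly_comp]
    exact (monic_X_pow j).mul Lagrange.nodal_monic
  have hBd : ∀ j (x : Vec n), (X ^ j * (rowPoly k x).comp (X + 1)).natDegree = j + k := by
    intro j x
    rw [rowPoly_comp, Monic.natDegree_mul (monic_X_pow j) Lagrange.nodal_monic, natDegree_X_pow,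
      Lagrange.natDegree_nodal, card_rowSet (by omega)]
  have r_small : ∀ j x, j < k + 1 → r j x = 0 := by
    intro j x hj
    rw [hr]
    simp only
    rw [resFun_of_degree_lt hk.le x (by rw [hBd]; omega),
      coeff_eq_zero_of_natDegree_lt (by rw [hBd]; omega)]
  have r_one : ∀ x, r (k + 1) x = 1 := by
    intro x
    rw [hr]
    simp only
    rw [resFun_of_degree_lt hk.le x (by rw [hBd]; omega), show 2 * k + 1 = k + 1 + k by ring,
      ← hBd (k + 1) x]
    exact hBm _ x
  have expand : ∀ j x, resFun k x (X ^ j * numPoly k x) =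
      ∑ i ∈ Finset.range (k + 3), (rowPoly (k + 2) x).coeff i * r (i + j) x := by
    intro j x
    rw [numPoly]
    conv_lhs =>
      rw [(rowPoly (k + 2) x).as_sum_range_C_mul_X_pow' (n := k + 3)
        (by rw [natDegree_rowPoly (by omega)]; omega)]
    rw [Finset.sum_mul, Finset.mul_sum, resFun_sum]
    refine Finset.sum_congr rfl fun i _ => ?_
    have : ∀ c B : ℂ[X], X ^ j * (c * X ^ i * B) = c * (X ^ (i + j) * B) := fun c B => by ring
    rw [this, resFun_C_mul]
  have main : ∀ d i, k + 2 ≤ i + d →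
      (fun x : Vec n => (rowPoly (k + 2) x).coeff i) ∈ eigenfunctions n := by
    intro d
    induction d with
    | zero =>
      intro i hi
      rcases (show k + 2 ≤ i by omega).lt_or_eq with h | rfl
      · convert zero_mem (eigenfunctions n) using 1
        funext x
        exact coeff_eq_zero_of_natDegree_lt (by rw [natDegree_rowPoly (by omega)]; exact h)
      · convert one_mem (eigenfunctions n) using 1
        funext x
        exact coeff_rowPoly_self (by omega) x
    | succ d ih =>
      intro i hi
      by_cases hi' : k + 2 ≤ i + d
      · exact ih i hi'
      have hik : i ≤ k + 1 := by omega
      have key : (fun x : Vec n => (rowPoly (k + 2) x).coeff i) =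
          (fun x : Vec n => resFun k x (X ^ (k + 1 - i) * numPoly k x)) -
            ∑ l ∈ Finset.Ico (i + 1) (k + 3),
              (fun x : Vec n => (rowPoly (k + 2) x).coeff l) * r (l + (k + 1 - i)) := by
        funext x
        rw [Pi.sub_apply, expand, Finset.sum_apply, Finset.range_eq_Ico,
          ← Finset.sum_Ico_consecutive _ (Nat.zero_le i) (show i ≤ k + 3 by omega),
          Finset.sum_eq_zero, Finset.sum_eq_sum_Ico_succ_bot (show i < k + 3 by omega)]
        · rw [show i + (k + 1 - i) = k + 1 by omega, r_one]
          simp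
        · intro l hl
          rw [Finset.mem_Ico] at hl
          rw [r_small _ x (by omega), mul_zero]
      rw [key]
      refine sub_mem (residue _) (sum_mem fun l hl => mul_mem (ih l ?_) (r_mem _))
      rw [Finset.mem_Ico] at hl
      omega
  exact main (k + 2) i (by omega)

/-- The elementary symmetric functions of every row are eigenfunctions. -/
theorem coeff_rowPoly_mem (m : ℕ) (hm : m ≤ n) (j : ℕ) :
    (fun x : Vec n => (rowPoly m x).coeff j) ∈ eigenfunctions n := by
  have main : ∀ m, (m ≤ n → ∀ j, (fun x : Vec n => (rowPoly m x).coeff j) ∈ eigenfunctions n) ∧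
      (m + 1 ≤ n → ∀ j, (fun x : Vec n => (rowPoly (m + 1) x).coeff j) ∈ eigenfunctions n) := by
    intro m
    induction m with
    | zero =>
      have zero : ∀ x : Vec n, rowPoly 0 x = 1 := by
        intro x
        have : rowSet n 0 = ∅ := Finset.card_eq_zero.mp (card_rowSet (Nat.zero_le n))
        rw [rowPoly, this, Lagrange.nodal_empty]
      refine ⟨fun _ j => ?_, fun hn j => ?_⟩
      · simp only [zero, coeff_one]
        exact (eigenfunctions n).algebraMap_mem _
      · rw [zero_add]
        have hd : ∀ x : Vec n, (rowPoly 1 x).natDegree = 1 := fun x => natDegree_rowPoly hn x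
        rcases j with _ | _ | j
        · have hcoeff : (fun x : Vec n => (rowPoly 1 x).coeff 0) = -diagCoeff 1 := by
            funext x
            have h1 : (rowPoly 1 x).coeff 0 = (rowPoly 1 x).nextCoeff := by
              rw [nextCoeff_of_natDegree_pos (by rw [hd]; omega), hd]
            have h2 : rowSet n 0 = ∅ := Finset.card_eq_zero.mp (card_rowSet (Nat.zero_le n))
            rw [h1, rowPoly, nextCoeff_nodal, Pi.neg_apply, diagCoeff, Nat.sub_self, h2]
            simp
          rw [hcoeff]
          refine neg_mem ⟨E ⟨0, hn⟩ ⟨0, hn⟩, fun v hv ρ hρ => ?_⟩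
          rw [hρ.diag, diagOp]
        · convert one_mem (eigenfunctions n) using 1
          funext x
          exact coeff_rowPoly_self hn x
        · convert zero_mem (eigenfunctions n) using 1
          funext x
          exact coeff_eq_zero_of_natDegree_lt (by rw [hd]; omega)
    | succ m ih =>
      exact ⟨ih.2, fun hn => coeff_rowPoly_mem_succ (by omega) (ih.1 (by omega))
        (ih.2 (by omega))⟩
  exact (main m).1 hm j

theorem eval_rowPoly_mem (m : ℕ) (hm : m ≤ n) (c : ℂ) :
    (fun x : Vec n => ∏ q ∈ rowSet n m, (c - x q)) ∈ eigenfunctions n := by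
  have : (fun x : Vec n => ∏ q ∈ rowSet n m, (c - x q)) =
      ∑ j ∈ Finset.range (m + 1), c ^ j • (fun x : Vec n => (rowPoly m x).coeff j) := by
    funext x
    rw [← eval_rowPoly, eval_eq_sum_range, natDegree_rowPoly hm, Finset.sum_apply]
    refine Finset.sum_congr rfl fun j _ => ?_
    rw [Pi.smul_apply, smul_eq_mul, mul_comm]
  rw [this]
  exact sum_mem fun j _ => (eigenfunctions n).smul_mem (coeff_rowPoly_mem m hm j) _

end SingularGT

end

/-! ### Limits of representations -/

noncomputable section

namespace SingularGT

open Filter Topology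

variable {n : ℕ}

/-- Convergence in `V` as `t → 0`, `t ≠ 0`: coordinatewise, with supports eventually contained in
one finite set. The condition on the supports makes strong limits of operators multiplicative. -/
def HasLim (m : ℂ → V n) (m₀ : V n) : Prop :=
  (∃ S : Finset (Shift n), ∀ᶠ t in 𝓝[≠] (0 : ℂ), (m t).support ⊆ S) ∧
    ∀ y, Tendsto (fun t => m t y) (𝓝[≠] 0) (𝓝 (m₀ y))

theorem HasLim.congr {m m' : ℂ → V n} {m₀ : V n} (h : HasLim m m₀)
    (hm : ∀ᶠ t in 𝓝[≠] (0 : ℂ), m t = m' t) : HasLim m' m₀ := by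
  obtain ⟨⟨S, hS⟩, hlim⟩ := h
  refine ⟨⟨S, ?_⟩, fun y => (hlim y).congr' ?_⟩
  · filter_upwards [hS, hm] with t h1 h2
    rw [← h2]; exact h1
  · filter_upwards [hm] with t h
    rw [h]

theorem HasLim.unique {m : ℂ → V n} {m₀ m₁ : V n} (h : HasLim m m₀) (h' : HasLim m m₁) :
    m₀ = m₁ :=
  Finsupp.ext fun y => tendsto_nhds_unique (h.2 y) (h'.2 y)

theorem HasLim.add {m m' : ℂ → V n} {m₀ m₀' : V n} (h : HasLim m m₀) (h' : HasLim m' m₀') :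
    HasLim (fun t => m t + m' t) (m₀ + m₀') := by
  classical
  obtain ⟨⟨S, hS⟩, hlim⟩ := h
  obtain ⟨⟨S', hS'⟩, hlim'⟩ := h'
  refine ⟨⟨S ∪ S', ?_⟩, fun y => (hlim y).add (hlim' y)⟩
  filter_upwards [hS, hS'] with t h1 h2
  exact Finsupp.support_add.trans (Finset.union_subset_union h1 h2)

theorem HasLim.smul {m : ℂ → V n} {m₀ : V n} {c : ℂ → ℂ} {c₀ : ℂ} (h : HasLim m m₀)
    (hc : Tendsto c (𝓝[≠] 0) (𝓝 c₀)) : HasLim (fun t => c t • m t) (c₀ • m₀) := by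
  obtain ⟨⟨S, hS⟩, hlim⟩ := h
  refine ⟨⟨S, ?_⟩, fun y => hc.mul (hlim y)⟩
  filter_upwards [hS] with t h1
  exact Finsupp.support_smul.trans h1

theorem hasLim_const (m : V n) : HasLim (fun _ => m) m :=
  ⟨⟨m.support, Eventually.of_forall fun _ => subset_rfl⟩, fun _ => tendsto_const_nhds⟩

theorem HasLim.sum {ι : Type*} (s : Finset ι) {m : ι → ℂ → V n} {m₀ : ι → V n}
    (h : ∀ i ∈ s, HasLim (m i) (m₀ i)) : HasLim (fun t => ∑ i ∈ s, m i t) (∑ i ∈ s, m₀ i) := by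
  classical
  induction s using Finset.induction_on with
  | empty => simpa using hasLim_const (0 : V n)
  | insert i s hi ih =>
    simp only [Finset.sum_insert hi]
    exact (h i (Finset.mem_insert_self i s)).add
      (ih fun j hj => h j (Finset.mem_insert_of_mem hj))

theorem eq_sum_Tab (x : V n) {S : Finset (Shift n)} (hS : x.support ⊆ S) :
    x = ∑ y ∈ S, x y • Tab y := by
  conv_lhs => rw [← Finsupp.sum_single x]
  rw [Finsupp.sum_of_support_subset x hS _ (by simp)]
  refine Finset.sum_congr rfl fun y _ => ?_
  simp [Tab]

theorem HasLim.support_subset {m : ℂ → V n} {m₀ : V n} (h : HasLim m m₀) {S : Finset (Shift n)}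
    (hS : ∀ᶠ t in 𝓝[≠] (0 : ℂ), (m t).support ⊆ S) : m₀.support ⊆ S := by
  intro y hy
  by_contra hyS
  rw [Finsupp.mem_support_iff] at hy
  refine hy (tendsto_nhds_unique (h.2 y) (tendsto_const_nhds.congr' ?_))
  filter_upwards [hS] with t ht
  exact (Finsupp.notMem_support_iff.mp fun h => hyS (ht h)).symm

/-- Strong convergence of operators as `t → 0`. -/
def OpLim (X : ℂ → Module.End ℂ (V n)) (X₀ : Module.End ℂ (V n)) : Prop :=
  ∀ x, HasLim (fun t => X t x) (X₀ x)

theorem OpLim.unique {X : ℂ → Module.End ℂ (V n)} {X₀ X₁ : Module.End ℂ (V n)}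
    (h : OpLim X X₀) (h' : OpLim X X₁) : X₀ = X₁ :=
  LinearMap.ext fun x => (h x).unique (h' x)

theorem OpLim.apply {X : ℂ → Module.End ℂ (V n)} {X₀ : Module.End ℂ (V n)} (h : OpLim X X₀)
    {m : ℂ → V n} {m₀ : V n} (hm : HasLim m m₀) : HasLim (fun t => X t (m t)) (X₀ m₀) := by
  obtain ⟨S, hS⟩ := hm.1
  have h0 := hm.support_subset hS
  rw [eq_sum_Tab m₀ h0, map_sum]
  simp only [map_smul]
  refine (HasLim.sum S (m := fun y t => m t y • X t (Tab y))
    fun y _ => (h (Tab y)).smul (hm.2 y)).congr ?_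
  filter_upwards [hS] with t ht
  conv_rhs => rw [eq_sum_Tab (m t) ht, map_sum]
  simp only [map_smul]

theorem OpLim.mul {X Y : ℂ → Module.End ℂ (V n)} {X₀ Y₀ : Module.End ℂ (V n)}
    (h : OpLim X X₀) (h' : OpLim Y Y₀) : OpLim (fun t => X t * Y t) (X₀ * Y₀) := fun x =>
  h.apply (h' x)

theorem OpLim.add {X Y : ℂ → Module.End ℂ (V n)} {X₀ Y₀ : Module.End ℂ (V n)}
    (h : OpLim X X₀) (h' : OpLim Y Y₀) : OpLim (fun t => X t + Y t) (X₀ + Y₀) := fun x =>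
  (h x).add (h' x)

theorem opLim_const (X : Module.End ℂ (V n)) : OpLim (fun _ => X) X := fun x => hasLim_const (X x)

theorem opLim_of_Tab {X : ℂ → Module.End ℂ (V n)} {x₀ : Shift n → V n}
    (h : ∀ w, HasLim (fun t => X t (Tab w)) (x₀ w)) :
    OpLim X (Finsupp.linearCombination ℂ x₀) := by
  intro x
  have e0 : Finsupp.linearCombination ℂ x₀ x = ∑ y ∈ x.support, x y • x₀ y := rfl
  rw [e0]
  refine (HasLim.sum x.support (m := fun y t => x y • X t (Tab y))
    fun y _ => (h y).smul tendsto_const_nhds).congr (Eventually.of_forall fun t => ?_)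
  conv_rhs => rw [eq_sum_Tab x subset_rfl, map_sum]
  simp only [map_smul]

/-- A strong limit of representations exists as soon as it exists on the generators. -/
theorem exists_limit_algHom {R : ℂ → U n →ₐ[ℂ] Module.End ℂ (V n)}
    (h : ∀ r s : Fin n, r.val ≤ s.val + 1 → s.val ≤ r.val + 1 →
      ∃ X₀, OpLim (fun t => R t (E r s)) X₀) :
    ∃ ρ : U n →ₐ[ℂ] Module.End ℂ (V n), ∀ u, OpLim (fun t => R t u) (ρ u) := by
  have ex : ∀ u, ∃ X₀, OpLim (fun t => R t u) X₀ := by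
    intro u
    induction u using U_induction with
    | hE r s h1 h2 => exact h r s h1 h2
    | hc c =>
      simp only [AlgHom.commutes]
      exact ⟨_, opLim_const _⟩
    | hadd x y hx hy =>
      obtain ⟨X, hX⟩ := hx
      obtain ⟨Y, hY⟩ := hy
      simp only [map_add]
      exact ⟨_, hX.add hY⟩
    | hmul x y hx hy =>
      obtain ⟨X, hX⟩ := hx
      obtain ⟨Y, hY⟩ := hy
      simp only [map_mul]
      exact ⟨_, hX.mul hY⟩
  choose L hL using ex
  refine ⟨{ toFun := L, map_one' := ?_, map_mul' := ?_, map_zero' := ?_, map_add' := ?_,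
            commutes' := ?_ }, hL⟩
  · exact (hL 1).unique (by simpa only [map_one] using opLim_const 1)
  · intro x y
    exact (hL _).unique (by simpa only [map_mul] using (hL x).mul (hL y))
  · exact (hL 0).unique (by simpa only [map_zero] using opLim_const 0)
  · intro x y
    exact (hL _).unique (by simpa only [map_add] using (hL x).add (hL y))
  · intro c
    exact (hL _).unique (by simpa only [AlgHom.commutes] using opLim_const (algebraMap ℂ _ c))

end SingularGT

end

/-! ### The degeneration of generic modules at a singular vector -/

noncomputable section

namespace SingularGT

open Filter Topology

variable {n : ℕ}

/-- The curve `v̄ + t (δ^a - δ^b)` of vectors, generic for small `t ≠ 0`. -/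
def curve (a b : LPos n) (vbar : Vec n) (t : ℂ) : Vec n :=
  vbar + t • (Pi.single a.1 1 - Pi.single b.1 1)

theorem IsOneSingular.ne {a b : LPos n} {vbar : Vec n} (hv : IsOneSingular a b vbar) : a ≠ b :=
  fun h => absurd hv.col_lt (by rw [h]; exact lt_irrefl _)

theorem curve_zero (a b : LPos n) (vbar : Vec n) : curve a b vbar 0 = vbar := by
  simp [curve]

theorem curve_left {a b : LPos n} (hab : a ≠ b) (vbar : Vec n) (t : ℂ) :
    curve a b vbar t a.1 = vbar a.1 + t := by
  have : a.1 ≠ b.1 := fun h => hab (Subtype.ext h)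
  simp [curve, this]

theorem curve_right {a b : LPos n} (hab : a ≠ b) (vbar : Vec n) (t : ℂ) :
    curve a b vbar t b.1 = vbar b.1 - t := by
  have : b.1 ≠ a.1 := fun h => hab (Subtype.ext h.symm)
  simp [curve, this, sub_eq_add_neg]

theorem curve_of_ne {a b : LPos n} (vbar : Vec n) (t : ℂ) {p : Pos n} (ha : p ≠ a.1)
    (hb : p ≠ b.1) : curve a b vbar t p = vbar p := by
  simp [curve, ha, hb]

theorem hasDerivAt_curve (a b : LPos n) (vbar : Vec n) (t : ℂ) :
    HasDerivAt (curve a b vbar) (Pi.single a.1 1 - Pi.single b.1 1) t := by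
  unfold curve
  have := ((hasDerivAt_id t).smul_const
    (Pi.single a.1 1 - Pi.single b.1 1 : Vec n)).const_add vbar
  simpa using this

/-- The transposition of the entries at the two singular positions. -/
def swapVec (a b : LPos n) (x : Vec n) : Vec n := fun p => x (Equiv.swap a.1 b.1 p)

theorem swapVec_curve {a b : LPos n} {vbar : Vec n} (hv : IsOneSingular a b vbar) (t : ℂ) :
    swapVec a b (curve a b vbar t) = curve a b vbar (-t) := by
  funext p
  unfold swapVec
  rcases eq_or_ne p a.1 with rfl | ha
  · rw [Equiv.swap_apply_left, curve_right hv.ne, curve_left hv.ne, hv.eq, sub_eq_add_neg]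
  · rcases eq_or_ne p b.1 with rfl | hb
    · rw [Equiv.swap_apply_right, curve_right hv.ne, curve_left hv.ne, hv.eq, sub_neg_eq_add]
    · rw [Equiv.swap_apply_of_ne_of_ne ha hb, curve_of_ne _ _ ha hb, curve_of_ne _ _ ha hb]

theorem IsOneSingular.sub_ne_int {a b : LPos n} {vbar : Vec n} (hv : IsOneSingular a b vbar)
    {p q : Pos n} (hrow : p.row = q.row) (hp : p.row < n) (hpq : p ≠ q)
    (h1 : ¬(p = a.1 ∧ q = b.1)) (h2 : ¬(p = b.1 ∧ q = a.1)) (m : ℤ) :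
    vbar p - vbar q ≠ m := by
  have hq : q.row < n := hrow ▸ hp
  have hcol : p.col ≠ q.col := by
    intro h
    apply hpq
    obtain ⟨r, c⟩ := p
    obtain ⟨r', c'⟩ := q
    simp only [Pos.row, Pos.col, Nat.add_right_cancel_iff] at hrow h
    obtain rfl := Fin.ext hrow
    rw [Fin.ext h]
  rcases lt_or_gt_of_ne hcol with hlt | hlt
  · refine hv.generic ⟨p, hp⟩ ⟨q, hq⟩ hrow hlt (fun h => h1 ?_) m
    rw [Prod.mk.injEq] at h
    exact ⟨congrArg Subtype.val h.1, congrArg Subtype.val h.2⟩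
  · intro h
    refine hv.generic ⟨q, hq⟩ ⟨p, hp⟩ hrow.symm hlt (fun h => h2 ?_) (-m) ?_
    · rw [Prod.mk.injEq] at h
      exact ⟨congrArg Subtype.val h.2, congrArg Subtype.val h.1⟩
    · push_cast
      linear_combination -h

theorem eventually_add_mul_ne_int {α β : ℂ} (h : (∀ m : ℤ, α ≠ m) ∨ (α = 0 ∧ β ≠ 0)) :
    ∀ᶠ t in 𝓝[≠] (0 : ℂ), ∀ m : ℤ, α + t * β ≠ m := by
  rcases h with h | ⟨rfl, hβ⟩
  · have hopen : IsOpen (Set.range ((↑) : ℤ → ℂ))ᶜ := Complex.isClosed_range_intCast.isOpen_compl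
    have hcont : ContinuousAt (fun t : ℂ => α + t * β) 0 := by fun_prop
    have hmem : (Set.range ((↑) : ℤ → ℂ))ᶜ ∈ 𝓝 (α + 0 * β) := by
      apply hopen.mem_nhds
      rintro ⟨m, hm⟩
      exact h m (by rw [hm]; ring)
    filter_upwards [nhdsWithin_le_nhds (hcont hmem)] with t ht m hm
    exact ht ⟨m, hm.symm⟩
  · have hcont : ContinuousAt (fun t : ℂ => ‖t * β‖) 0 := by fun_prop
    have hsmall : ∀ᶠ t in 𝓝 (0 : ℂ), ‖t * β‖ < 1 :=
      hcont.eventually_lt continuousAt_const (by simp)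
    filter_upwards [nhdsWithin_le_nhds hsmall, self_mem_nhdsWithin] with t ht ht0 m hm
    rw [zero_add] at hm
    rw [hm, Complex.norm_intCast] at ht
    have : m = 0 := by
      have : |m| < 1 := by exact_mod_cast ht
      exact Int.abs_lt_one_iff.mp this
    rw [this, Int.cast_zero] at hm
    exact (mul_ne_zero ht0 hβ) hm

theorem eventually_isGeneric {a b : LPos n} {vbar : Vec n} (hv : IsOneSingular a b vbar) :
    ∀ᶠ t in 𝓝[≠] (0 : ℂ), IsGeneric (curve a b vbar t) := by
  unfold IsGeneric
  rw [eventually_all]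
  intro p
  rw [eventually_all]
  intro q
  by_cases hrow : p.row = q.row
  swap
  · exact Eventually.of_forall fun t h => absurd h hrow
  by_cases hp : p.row < n
  swap
  · exact Eventually.of_forall fun t _ h => absurd h hp
  by_cases hpq : p = q
  · exact Eventually.of_forall fun t _ _ h => absurd hpq h
  have hab : a.1 ≠ b.1 := fun h => hv.ne (Subtype.ext h)
  have key : ∀ᶠ t in 𝓝[≠] (0 : ℂ), ∀ m : ℤ, (vbar p - vbar q) + t *
      ((Pi.single a.1 1 - Pi.single b.1 1 : Vec n) p -
        (Pi.single a.1 1 - Pi.single b.1 1 : Vec n) q) ≠ m := by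
    apply eventually_add_mul_ne_int
    by_cases h1 : p = a.1 ∧ q = b.1
    · right
      obtain ⟨rfl, rfl⟩ := h1
      refine ⟨by rw [hv.eq, sub_self], ?_⟩
      simp [hab, hab.symm]
    by_cases h2 : p = b.1 ∧ q = a.1
    · right
      obtain ⟨rfl, rfl⟩ := h2
      refine ⟨by rw [hv.eq, sub_self], ?_⟩
      simp [hab, hab.symm]
      norm_num
    left
    exact hv.sub_ne_int hrow hp hpq h1 h2
  filter_upwards [key] with t ht _ _ _ m hm
  apply ht m
  rw [← hm]
  simp only [curve, Pi.add_apply, Pi.smul_apply, smul_eq_mul]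
  ring

/-- The map `T(v̄ + z) ↦ T(v + z) + T(v + τ(z))`, `𝒟T(v̄ + z) ↦ (T(v + z) - T(v + τ(z))) / 2t` to the
generic module at `v = v̄ + t (δ^a - δ^b)`. -/
def toGeneric (a b : LPos n) (t : ℂ) : Module.End ℂ (V n) :=
  Finsupp.linearCombination ℂ fun w : Shift n =>
    if w a ≤ w b then (Tab w + Tab (tau a b w) : V n)
    else (2 * t)⁻¹ • (Tab w - Tab (tau a b w))

/-- The inverse `T(v + z) ↦ T(v̄ + z) / 2 + t 𝒟T(v̄ + z)` of `toGeneric`, for `t ≠ 0`. -/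
def ofGeneric (a b : LPos n) (t : ℂ) : Module.End ℂ (V n) :=
  Finsupp.linearCombination ℂ fun z : Shift n =>
    (1 / 2 : ℂ) • regTab a b z + t • derTab a b z

theorem tau_left (a b : LPos n) (w : Shift n) : tau a b w a = w b := by simp [tau]

theorem tau_right (a b : LPos n) (w : Shift n) : tau a b w b = w a := by simp [tau]

theorem toGeneric_Tab (a b : LPos n) (t : ℂ) (w : Shift n) : toGeneric a b t (Tab w) =
    if w a ≤ w b then (Tab w + Tab (tau a b w) : V n)
    else (2 * t)⁻¹ • (Tab w - Tab (tau a b w)) := by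
  simp [toGeneric, Tab]

theorem ofGeneric_Tab (a b : LPos n) (t : ℂ) (z : Shift n) :
    ofGeneric a b t (Tab z) = (1 / 2 : ℂ) • regTab a b z + t • derTab a b z := by
  simp [ofGeneric, Tab]

theorem derTab_tau (a b : LPos n) (w : Shift n) : derTab a b (tau a b w) = -derTab a b w := by
  rw [eq_neg_iff_add_eq_zero, add_comm]
  exact derTab_add_tau a b w

theorem toGeneric_regTab (a b : LPos n) (t : ℂ) (z : Shift n) :
    toGeneric a b t (regTab a b z) = Tab z + Tab (tau a b z) := by
  unfold regTab
  split_ifs with h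
  · rw [toGeneric_Tab, if_pos h]
  · rw [toGeneric_Tab, tau_left, tau_right, if_pos (le_of_not_ge h), tau_tau, add_comm]

theorem toGeneric_derTab (a b : LPos n) (t : ℂ) (z : Shift n) :
    toGeneric a b t (derTab a b z) = (2 * t)⁻¹ • (Tab z - Tab (tau a b z)) := by
  unfold derTab
  split_ifs with h h'
  · rw [toGeneric_Tab, if_neg h.not_ge]
  · rw [tau_eq_self a b z h', sub_self, smul_zero, map_zero]
  · have hlt : z a < z b := lt_of_le_of_ne (le_of_not_gt h) h'
    rw [map_neg, toGeneric_Tab, tau_left, tau_right, if_neg hlt.not_ge, tau_tau, ← smul_neg,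
      neg_sub]

theorem ofGeneric_mul_toGeneric (a b : LPos n) {t : ℂ} (ht : t ≠ 0) :
    ofGeneric a b t * toGeneric a b t = 1 := by
  apply end_ext
  intro w
  rw [Module.End.mul_apply, Module.End.one_apply]
  by_cases h : w a ≤ w b
  · have hw : Tab w = regTab a b w := by rw [regTab, if_pos h]
    rw [hw, toGeneric_regTab, map_add, ofGeneric_Tab, ofGeneric_Tab, regTab_tau, derTab_tau]
    module
  · have hw : Tab w = derTab a b w := by rw [derTab, if_pos (lt_of_not_ge h)]
    rw [hw, toGeneric_derTab, map_smul, map_sub, ofGeneric_Tab, ofGeneric_Tab, regTab_tau,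
      derTab_tau]
    have : (1 / 2 : ℂ) • regTab a b w + t • derTab a b w -
        ((1 / 2 : ℂ) • regTab a b w + t • -derTab a b w) = (2 * t) • derTab a b w := by module
    rw [this, smul_smul, inv_mul_cancel₀ (mul_ne_zero two_ne_zero ht), one_smul]

theorem toGeneric_mul_ofGeneric (a b : LPos n) {t : ℂ} (ht : t ≠ 0) :
    toGeneric a b t * ofGeneric a b t = 1 := by
  apply end_ext
  intro w
  rw [Module.End.mul_apply, Module.End.one_apply, ofGeneric_Tab, map_add, map_smul, map_smul,
    toGeneric_regTab, toGeneric_derTab, smul_smul, mul_inv, mul_comm (2 : ℂ)⁻¹, ← mul_assoc,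
    mul_inv_cancel₀ ht]
  module

/-- The map of `V` induced by `τ`. -/
def tauMap (a b : LPos n) : V n →ₗ[ℂ] V n := Finsupp.lmapDomain ℂ ℂ (tau a b)

theorem tauMap_Tab (a b : LPos n) (w : Shift n) : tauMap a b (Tab w) = Tab (tau a b w) := by
  simp [tauMap, Tab]

theorem evalAt_eq_sum (v : Vec n) (F : Shift n →₀ (Vec n → ℂ)) :
    evalAt v F = ∑ y ∈ F.support, F y v • Tab y := by
  conv_lhs => rw [← Finsupp.sum_single F]
  rw [Finsupp.sum, map_sum]
  exact Finset.sum_congr rfl fun y _ => evalAt_single v y _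

/-- `f` extends from the complement of the hyperplane `v_a = v_b` to a function that is
differentiable near `v̄`. -/
def IsRegularAt (a b : LPos n) (vbar : Vec n) (f : Vec n → ℂ) : Prop :=
  ∃ g : Vec n → ℂ, (∀ᶠ x in 𝓝 vbar, DifferentiableAt ℂ g x) ∧
    ∀ᶠ x in 𝓝 vbar, x a.1 ≠ x b.1 → f x = g x

theorem dense_ne {a b : LPos n} (hab : a ≠ b) (x : Vec n) :
    x ∈ closure {v : Vec n | v a.1 ≠ v b.1} := by
  have hab' : b.1 ≠ a.1 := fun h => hab (Subtype.ext h.symm)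
  by_cases hx : x a.1 = x b.1
  · have hcont : Tendsto (fun t : ℂ => curve a b x t) (𝓝[≠] 0) (𝓝 x) := by
      have : ContinuousAt (fun t : ℂ => curve a b x t) 0 := by
        unfold curve
        fun_prop
      have h := this.tendsto
      rw [curve_zero] at h
      exact h.mono_left nhdsWithin_le_nhds
    refine mem_closure_of_tendsto hcont ?_
    filter_upwards [self_mem_nhdsWithin] with t ht
    rw [curve_left hab, curve_right hab, hx]
    intro h
    have h2 : (2 : ℂ) * t = 0 := by linear_combination h
    exact ht ((mul_eq_zero.mp h2).resolve_left two_ne_zero)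
  · exact subset_closure hx

theorem smoothExt_eventuallyEq {a b : LPos n} (hab : a ≠ b) {vbar : Vec n} {f g : Vec n → ℂ}
    (hg : ∀ᶠ x in 𝓝 vbar, DifferentiableAt ℂ g x)
    (hfg : ∀ᶠ x in 𝓝 vbar, x a.1 ≠ x b.1 → f x = g x) : smoothExt a b f =ᶠ[𝓝 vbar] g := by
  filter_upwards [hg, hfg.eventually_nhds] with x h1 h2
  refine extendFrom_eq (dense_ne hab x) ?_
  have h3 : Tendsto g (𝓝[{v : Vec n | v a.1 ≠ v b.1}] x) (𝓝 (g x)) :=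
    h1.continuousAt.tendsto.mono_left nhdsWithin_le_nhds
  refine h3.congr' ?_
  filter_upwards [nhdsWithin_le_nhds h2, self_mem_nhdsWithin] with y h4 h5
  exact (h4 h5).symm

/-- Along the curve, a regular function has the value `smoothExt` and the derivative
`2 𝒟^{v̄}` at `t = 0`. -/
theorem IsRegularAt.exists_curve {a b : LPos n} (hab : a ≠ b) {vbar : Vec n}
    (heq : vbar a.1 = vbar b.1) {f : Vec n → ℂ} (hf : IsRegularAt a b vbar f) :
    ∃ h : ℂ → ℂ, HasDerivAt h (2 * scalarD a b vbar f) 0 ∧ h 0 = smoothExt a b f vbar ∧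
      ∀ᶠ t in 𝓝[≠] (0 : ℂ), f (curve a b vbar t) = h t := by
  obtain ⟨g, hg, hfg⟩ := hf
  have hext := smoothExt_eventuallyEq hab hg hfg
  have hcurve := hasDerivAt_curve a b vbar 0
  refine ⟨fun t => g (curve a b vbar t), ?_, ?_, ?_⟩
  · have hgd : HasFDerivAt g (fderiv ℂ g vbar) (curve a b vbar 0) := by
      rw [curve_zero]
      exact hg.self_of_nhds.hasFDerivAt
    have hD : 2 * scalarD a b vbar f =
        fderiv ℂ g vbar (Pi.single a.1 1 - Pi.single b.1 1) := by
      rw [scalarD, hext.fderiv_eq, map_sub]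
      ring
    rw [hD]
    exact hgd.comp_hasDerivAt (0 : ℂ) hcurve
  · simp only [curve_zero]
    exact hext.self_of_nhds.symm
  · have htend : Tendsto (curve a b vbar) (𝓝[≠] 0) (𝓝 vbar) := by
      have := hcurve.continuousAt.tendsto
      rw [curve_zero] at this
      exact this.mono_left nhdsWithin_le_nhds
    filter_upwards [htend.eventually hfg, self_mem_nhdsWithin] with t h1 h2
    apply h1
    rw [curve_left hab, curve_right hab, heq]
    intro h
    have h3 : (2 : ℂ) * t = 0 := by linear_combination h
    exact h2 ((mul_eq_zero.mp h3).resolve_left two_ne_zero)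

theorem tendsto_even {h : ℂ → ℂ} {d : ℂ} (hd : HasDerivAt h d 0) :
    Tendsto (fun t => (h t + h (-t)) / 2) (𝓝[≠] 0) (𝓝 (h 0)) := by
  have h1 : ContinuousAt h 0 := hd.continuousAt
  have h2 : ContinuousAt (fun t : ℂ => h (-t)) 0 := by
    apply ContinuousAt.comp (g := h) (f := fun t : ℂ => -t)
    · simpa using h1
    · fun_prop
  have h3 := ((h1.tendsto.add h2.tendsto).div_const 2).mono_left
    (nhdsWithin_le_nhds (s := ({0}ᶜ : Set ℂ)))
  simpa using h3

theorem tendsto_odd {h : ℂ → ℂ} {d : ℂ} (hd : HasDerivAt h d 0) :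
    Tendsto (fun t => (h t - h (-t)) / (2 * t)) (𝓝[≠] 0) (𝓝 d) := by
  have h1 : HasDerivAt (fun t : ℂ => h (-t)) (-d) 0 := by
    have h0 : HasDerivAt h d (-0 : ℂ) := by simpa using hd
    have := h0.comp (0 : ℂ) (hasDerivAt_neg (0 : ℂ))
    rw [mul_neg_one] at this
    exact this
  have h2 := ((hd.sub h1).tendsto_slope_zero).div_const 2
  have h3 : (d - -d) / 2 = d := by ring
  rw [h3] at h2
  refine h2.congr fun t => ?_
  simp
  field_simp

theorem tendsto_neg_punctured : Tendsto (fun t : ℂ => -t) (𝓝[≠] 0) (𝓝[≠] 0) := by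
  refine tendsto_nhdsWithin_iff.mpr ⟨?_, ?_⟩
  · have : ContinuousAt (fun t : ℂ => -t) 0 := by fun_prop
    have h := this.tendsto
    rw [neg_zero] at h
    exact h.mono_left nhdsWithin_le_nhds
  · filter_upwards [self_mem_nhdsWithin] with t ht
    simpa using ht

theorem isRegularAt_zero (a b : LPos n) (vbar : Vec n) : IsRegularAt a b vbar 0 :=
  ⟨0, Eventually.of_forall fun _ => differentiableAt_const 0, Eventually.of_forall fun _ _ => rfl⟩

theorem scalarD_zero {a b : LPos n} (hab : a ≠ b) (vbar : Vec n) : scalarD a b vbar 0 = 0 := by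
  have := smoothExt_eventuallyEq hab (vbar := vbar) (f := 0) (g := 0)
    (Eventually.of_forall fun _ => differentiableAt_const 0) (Eventually.of_forall fun _ _ => rfl)
  rw [scalarD, this.fderiv_eq]
  simp

theorem smoothExt_zero {a b : LPos n} (hab : a ≠ b) (vbar : Vec n) :
    smoothExt a b 0 vbar = 0 :=
  (smoothExt_eventuallyEq hab (vbar := vbar) (f := 0) (g := 0)
    (Eventually.of_forall fun _ => differentiableAt_const 0)
    (Eventually.of_forall fun _ _ => rfl)).self_of_nhds

theorem opD_eq_sum {a b : LPos n} (hab : a ≠ b) (vbar : Vec n) (F : Shift n →₀ (Vec n → ℂ))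
    {S : Finset (Shift n)} (hS : F.support ⊆ S) : opD a b vbar F =
      ∑ y ∈ S, (scalarD a b vbar (F y) • regTab a b y +
        smoothExt a b (F y) vbar • derTab a b y) := by
  refine Finset.sum_subset hS fun y _ hy => ?_
  rw [Finsupp.notMem_support_iff.mp hy, scalarD_zero hab, smoothExt_zero hab]
  simp

theorem ofGeneric_evalAt_add (a b : LPos n) (t : ℂ) (v v' : Vec n)
    (F : Shift n →₀ (Vec n → ℂ)) :
    ofGeneric a b t (evalAt v F + tauMap a b (evalAt v' F)) =
      ∑ y ∈ F.support, (((F y v + F y v') / 2) • regTab a b y +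
        (t * (F y v - F y v')) • derTab a b y) := by
  rw [evalAt_eq_sum, evalAt_eq_sum, map_sum, ← Finset.sum_add_distrib, map_sum]
  refine Finset.sum_congr rfl fun y _ => ?_
  rw [map_smul, tauMap_Tab, map_add, map_smul, map_smul, ofGeneric_Tab, ofGeneric_Tab,
    regTab_tau, derTab_tau]
  module

theorem ofGeneric_evalAt_sub (a b : LPos n) (t : ℂ) (v v' : Vec n)
    (F : Shift n →₀ (Vec n → ℂ)) :
    ofGeneric a b t (evalAt v F - tauMap a b (evalAt v' F)) =
      ∑ y ∈ F.support, (((F y v - F y v') / 2) • regTab a b y +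
        (t * (F y v + F y v')) • derTab a b y) := by
  rw [evalAt_eq_sum, evalAt_eq_sum, map_sum, ← Finset.sum_sub_distrib, map_sum]
  refine Finset.sum_congr rfl fun y _ => ?_
  rw [map_smul, tauMap_Tab, map_sub, map_smul, map_smul, ofGeneric_Tab, ofGeneric_Tab,
    regTab_tau, derTab_tau]
  module

/-- The limit of the action on a regular tableau. -/
theorem hasLim_reg {a b : LPos n} (hab : a ≠ b) {vbar : Vec n} (heq : vbar a.1 = vbar b.1)
    (F : Shift n →₀ (Vec n → ℂ)) (hF : ∀ y, IsRegularAt a b vbar (mulDiff a b F y)) :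
    HasLim (fun t => ofGeneric a b t (evalAt (curve a b vbar t) F +
      tauMap a b (evalAt (curve a b vbar (-t)) F))) (opD a b vbar (mulDiff a b F)) := by
  have hsupp : (mulDiff a b F).support ⊆ F.support := Finsupp.support_mapRange
  rw [opD_eq_sum hab vbar _ hsupp]
  simp only [ofGeneric_evalAt_add]
  refine HasLim.sum _ fun y _ => ?_
  obtain ⟨h, hd, h0, hc⟩ := (hF y).exists_curve hab heq
  have hval : ∀ᶠ t in 𝓝[≠] (0 : ℂ), F y (curve a b vbar t) = h t / (2 * t) := by
    filter_upwards [hc, self_mem_nhdsWithin] with t ht ht0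
    have ht0 : t ≠ 0 := ht0
    rw [← ht, mulDiff, Finsupp.mapRange_apply, curve_left hab, curve_right hab, heq]
    field_simp
    ring
  have hval' := tendsto_neg_punctured.eventually hval
  refine ((hasLim_const _).smul ?_).add ((hasLim_const _).smul ?_)
  · have := (tendsto_odd hd).div_const 2
    rw [mul_div_cancel_left₀ _ two_ne_zero] at this
    refine this.congr' ?_
    filter_upwards [hval, hval', self_mem_nhdsWithin] with t h1 h2 ht0
    have ht0 : t ≠ 0 := ht0
    rw [h1, h2]
    field_simp
    ring
  · rw [← h0]
    refine (tendsto_even hd).congr' ?_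
    filter_upwards [hval, hval', self_mem_nhdsWithin] with t h1 h2 ht0
    have ht0 : t ≠ 0 := ht0
    rw [h1, h2]
    field_simp
    ring

/-- The limit of the action on a derivative tableau. -/
theorem hasLim_der {a b : LPos n} (hab : a ≠ b) {vbar : Vec n} (heq : vbar a.1 = vbar b.1)
    (F : Shift n →₀ (Vec n → ℂ)) (hF : ∀ y, IsRegularAt a b vbar (F y)) :
    HasLim (fun t => ofGeneric a b t ((2 * t)⁻¹ • (evalAt (curve a b vbar t) F -
      tauMap a b (evalAt (curve a b vbar (-t)) F)))) (opD a b vbar F) := by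
  rw [opD_eq_sum hab vbar _ subset_rfl]
  simp only [map_smul, ofGeneric_evalAt_sub, Finset.smul_sum, smul_add, smul_smul]
  refine HasLim.sum _ fun y _ => ?_
  obtain ⟨h, hd, h0, hc⟩ := (hF y).exists_curve hab heq
  have hc' := tendsto_neg_punctured.eventually hc
  refine ((hasLim_const _).smul ?_).add ((hasLim_const _).smul ?_)
  · have := (tendsto_odd hd).div_const 2
    rw [mul_div_cancel_left₀ _ two_ne_zero] at this
    refine this.congr' ?_
    filter_upwards [hc, hc', self_mem_nhdsWithin] with t h1 h2 ht0
    have ht0 : t ≠ 0 := ht0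
    rw [h1, h2]
    field_simp
  · rw [← h0]
    refine (tendsto_even hd).congr' ?_
    filter_upwards [hc, hc', self_mem_nhdsWithin] with t h1 h2 ht0
    have ht0 : t ≠ 0 := ht0
    rw [h1, h2]
    field_simp

end SingularGT

end

/-! ### The singular module -/

noncomputable section

namespace SingularGT

open Filter Topology

variable {n : ℕ}

theorem isRegularAt_div {a b : LPos n} {vbar : Vec n} {f N D : Vec n → ℂ}
    (hN : Differentiable ℂ N) (hD : Differentiable ℂ D) (h0 : D vbar ≠ 0)
    (hf : ∀ x, x a.1 ≠ x b.1 → f x = N x / D x) : IsRegularAt a b vbar f := by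
  refine ⟨fun x => N x / D x, ?_, Eventually.of_forall hf⟩
  filter_upwards [hD.continuous.continuousAt.eventually_ne h0] with x hx
  simpa only [div_eq_mul_inv] using (hN x).fun_mul ((hD x).fun_inv hx)

theorem isRegularAt_of_differentiable {a b : LPos n} {vbar : Vec n} {f : Vec n → ℂ}
    (hf : Differentiable ℂ f) : IsRegularAt a b vbar f :=
  ⟨f, Eventually.of_forall fun x => hf x, Eventually.of_forall fun _ _ => rfl⟩

theorem IsRegularAt.add {a b : LPos n} {vbar : Vec n} {f f' : Vec n → ℂ}
    (h : IsRegularAt a b vbar f) (h' : IsRegularAt a b vbar f') :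
    IsRegularAt a b vbar (f + f') := by
  obtain ⟨g, hg, hfg⟩ := h
  obtain ⟨g', hg', hfg'⟩ := h'
  refine ⟨g + g', ?_, ?_⟩
  · filter_upwards [hg, hg'] with x h1 h2
    exact h1.add h2
  · filter_upwards [hfg, hfg'] with x h1 h2 hx
    rw [Pi.add_apply, Pi.add_apply, h1 hx, h2 hx]

/-- A property of the coefficients in the Gelfand–Tsetlin formulas that is closed under sums may
be checked on the single terms. -/
theorem gtFormula_induction {P : (Vec n → ℂ) → Prop} {z : Shift n} (h0 : P 0)
    (hadd : ∀ f g, P f → P g → P (f + g))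
    (hraise : ∀ p : LPos n, P (fun v => raiseCoeff p.1 (addShift v z)))
    (hlower : ∀ p : LPos n, P (fun v => lowerCoeff p.1 (addShift v z)))
    (hdiag : ∀ m, P (fun v => diagCoeff (m + 1) (addShift v z))) (r s : Fin n) (y : Shift n) :
    P (gtFormula r s z y) := by
  classical
  have hsingle : ∀ (y' : Shift n) (f : Vec n → ℂ), P f → P (Finsupp.single y' f y) := by
    intro y' f hf
    rw [Finsupp.single_apply]
    split_ifs
    · exact hf
    · exact h0
  have hsum : ∀ (S : Finset (LPos n)) (F : LPos n → Shift n →₀ (Vec n → ℂ)),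
      (∀ p, P (F p y)) → P ((∑ p ∈ S, F p) y) := by
    intro S F hF
    induction S using Finset.induction_on with
    | empty => exact h0
    | insert i S hi ih =>
      rw [Finset.sum_insert hi]
      exact hadd _ _ (hF i) ih
  unfold gtFormula
  split_ifs
  · exact hsum _ _ fun p => hsingle _ _ (hraise p)
  · exact hsum _ _ fun p => hsingle _ _ (hlower p)
  · exact hsingle _ _ (hdiag _)
  · exact h0

theorem raiseCoeff_eq (p : Pos n) (x : Vec n) :
    raiseCoeff p x = -gtCoeff (rowSet n (p.row + 1)) p x := rfl

theorem lowerCoeff_eq (p : Pos n) (x : Vec n) :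
    lowerCoeff p x = gtCoeff (rowSet n (p.row - 1)) p x := rfl

theorem differentiable_addShift_apply (z : Shift n) (p : Pos n) :
    Differentiable ℂ (fun v : Vec n => addShift v z p) := by
  unfold addShift
  fun_prop

theorem differentiable_prod_sub (S : Finset (Pos n)) (p : Pos n) (z : Shift n) :
    Differentiable ℂ (fun v : Vec n => ∏ q ∈ S, (addShift v z p - addShift v z q)) := by
  have := differentiable_addShift_apply z (n := n)
  fun_prop

/-- Two entries of one row of `v̄ + z` differ, unless they are the singular pair and `z_a = z_b`. -/
theorem addShift_sub_ne_zero {a b : LPos n} {vbar : Vec n} (hv : IsOneSingular a b vbar)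
    (z : Shift n) {p q : Pos n} (hrow : p.row = q.row) (hp : p.row < n) (hpq : p ≠ q)
    (h1 : z a ≠ z b ∨ (¬(p = a.1 ∧ q = b.1) ∧ ¬(p = b.1 ∧ q = a.1))) :
    addShift vbar z p - addShift vbar z q ≠ 0 := by
  intro h
  simp only [addShift, dif_pos hp, dif_pos (show q.row < n from hrow ▸ hp)] at h
  by_cases h2 : p = a.1 ∧ q = b.1
  · obtain ⟨rfl, rfl⟩ := h2
    have hz : z a ≠ z b := h1.resolve_right fun h => h.1 ⟨rfl, rfl⟩
    rw [hv.eq] at h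
    apply hz
    have : (z a : ℂ) = z b := by linear_combination h
    exact_mod_cast this
  by_cases h3 : p = b.1 ∧ q = a.1
  · obtain ⟨rfl, rfl⟩ := h3
    have hz : z a ≠ z b := h1.resolve_right fun h => h.2 ⟨rfl, rfl⟩
    rw [hv.eq] at h
    apply hz
    have : (z a : ℂ) = z b := by linear_combination -h
    exact_mod_cast this
  refine hv.sub_ne_int hrow hp hpq h2 h3 (z ⟨q, hrow ▸ hp⟩ - z ⟨p, hp⟩) ?_
  push_cast
  linear_combination h

theorem isRegularAt_gtCoeff {a b : LPos n} {vbar : Vec n} (hv : IsOneSingular a b vbar)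
    {z : Shift n} (S : Finset (Pos n)) {p : LPos n} (g : Vec n → ℂ) (hg : Differentiable ℂ g)
    (h : z a ≠ z b ∨ (p ≠ a ∧ p ≠ b)) :
    IsRegularAt a b vbar (fun v => g v * gtCoeff S p.1 (addShift v z)) := by
  refine isRegularAt_div (hg.mul (differentiable_prod_sub S p.1 z))
    (differentiable_prod_sub ((rowSet n p.1.row).erase p.1) p.1 z) ?_
    (fun x _ => by rw [gtCoeff]; exact (mul_div_assoc _ _ _).symm)
  rw [Finset.prod_ne_zero_iff]
  intro q hq
  rw [Finset.mem_erase, mem_rowSet] at hq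
  exact addShift_sub_ne_zero hv z hq.2.symm p.2 hq.1.symm
    (h.imp_right fun h' => ⟨fun e => h'.1 (Subtype.ext e.1), fun e => h'.2 (Subtype.ext e.1)⟩)

/-- At a singular position the coefficient has a simple pole, which `v_a - v_b` cancels. -/
theorem isRegularAt_mul_gtCoeff_of_pair {a b : LPos n} {vbar : Vec n}
    (hv : IsOneSingular a b vbar) {z : Shift n} (hz : z a = z b) (S : Finset (Pos n))
    {p q : LPos n} (hpq : (p = a ∧ q = b) ∨ (p = b ∧ q = a)) :
    IsRegularAt a b vbar (fun v => (v p.1 - v q.1) * gtCoeff S p.1 (addShift v z)) := by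
  have hne : q.1 ≠ p.1 := by
    rcases hpq with ⟨rfl, rfl⟩ | ⟨rfl, rfl⟩
    · exact fun h => hv.ne (Subtype.ext h.symm)
    · exact fun h => hv.ne (Subtype.ext h)
  have hrow : q.1.row = p.1.row := by
    rcases hpq with ⟨rfl, rfl⟩ | ⟨rfl, rfl⟩
    · exact hv.row_eq.symm
    · exact hv.row_eq
  have hzpq : z p = z q := by
    rcases hpq with ⟨rfl, rfl⟩ | ⟨rfl, rfl⟩
    · exact hz
    · exact hz.symm
  have hmem : q.1 ∈ (rowSet n p.1.row).erase p.1 :=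
    Finset.mem_erase.mpr ⟨hne, mem_rowSet.mpr hrow⟩
  refine isRegularAt_div (differentiable_prod_sub S p.1 z)
    (differentiable_prod_sub (((rowSet n p.1.row).erase p.1).erase q.1) p.1 z) ?_ fun x hx => ?_
  · rw [Finset.prod_ne_zero_iff]
    intro r hr
    rw [Finset.mem_erase, Finset.mem_erase, mem_rowSet] at hr
    refine addShift_sub_ne_zero hv z hr.2.2.symm p.2 hr.2.1.symm (Or.inr ⟨?_, ?_⟩) <;>
      rintro ⟨h1, h2⟩ <;> rcases hpq with ⟨rfl, rfl⟩ | ⟨rfl, rfl⟩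
    · exact hr.1 h2
    · exact hne h1.symm
    · exact hne h1.symm
    · exact hr.1 h2
  · have hx' : x p.1 - x q.1 ≠ 0 := by
      rcases hpq with ⟨rfl, rfl⟩ | ⟨rfl, rfl⟩
      · exact sub_ne_zero.mpr hx
      · exact sub_ne_zero.mpr hx.symm
    have hdiff : addShift x z p.1 - addShift x z q.1 = x p.1 - x q.1 := by
      simp only [addShift, dif_pos p.2, dif_pos q.2]
      rw [show z ⟨p.1, p.2⟩ = z p from rfl, show z ⟨q.1, q.2⟩ = z q from rfl, hzpq]
      ring
    rw [gtCoeff, ← Finset.mul_prod_erase _ _ hmem, hdiff, ← mul_div_assoc,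
      mul_div_mul_left _ _ hx']

theorem isRegularAt_mulDiff_gtCoeff {a b : LPos n} {vbar : Vec n}
    (hv : IsOneSingular a b vbar) {z : Shift n} (S : Finset (Pos n)) {p : LPos n} (c : ℂ) :
    IsRegularAt a b vbar
      (fun v => (v a.1 - v b.1) * (c * gtCoeff S p.1 (addShift v z))) := by
  have hc : ∀ {f : Vec n → ℂ} (c : ℂ), IsRegularAt a b vbar f →
      IsRegularAt a b vbar (fun v => c * f v) := by
    rintro f c ⟨g, hg, hfg⟩
    refine ⟨fun v => c * g v, ?_, ?_⟩
    · filter_upwards [hg] with x hx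
      exact hx.const_mul c
    · filter_upwards [hfg] with x hx h
      rw [hx h]
  by_cases hz : z a = z b
  · by_cases hpa : p = a
    · convert hc c (isRegularAt_mul_gtCoeff_of_pair hv hz S (Or.inl ⟨hpa, rfl⟩)) using 2
      rw [hpa]
      ring
    by_cases hpb : p = b
    · convert hc (-c) (isRegularAt_mul_gtCoeff_of_pair hv hz S (Or.inr ⟨hpb, rfl⟩)) using 2
      rw [hpb]
      ring
    convert isRegularAt_gtCoeff hv S (fun v => c * (v a.1 - v b.1)) (by fun_prop)
      (Or.inr ⟨hpa, hpb⟩) using 2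
    ring
  · convert isRegularAt_gtCoeff hv S (fun v => c * (v a.1 - v b.1)) (by fun_prop)
      (Or.inl hz) using 2
    ring

theorem differentiable_diagCoeff (m : ℕ) (z : Shift n) :
    Differentiable ℂ (fun v : Vec n => diagCoeff m (addShift v z)) := by
  have := differentiable_addShift_apply z (n := n)
  unfold diagCoeff
  fun_prop

theorem isRegularAt_gtFormula {a b : LPos n} {vbar : Vec n} (hv : IsOneSingular a b vbar)
    {z : Shift n} (hz : z a ≠ z b) (r s : Fin n) (y : Shift n) :
    IsRegularAt a b vbar (gtFormula r s z y) := by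
  refine gtFormula_induction (isRegularAt_zero a b vbar) (fun f g => IsRegularAt.add)
    (fun p => ?_) (fun p => ?_)
    (fun m => isRegularAt_of_differentiable (differentiable_diagCoeff _ z)) r s y
  · simpa only [neg_one_mul, ← raiseCoeff_eq] using
      isRegularAt_gtCoeff hv (z := z) (rowSet n (p.1.row + 1)) (p := p) (fun _ => -1)
        (differentiable_const _) (Or.inl hz)
  · simpa only [one_mul, ← lowerCoeff_eq] using
      isRegularAt_gtCoeff hv (z := z) (rowSet n (p.1.row - 1)) (p := p) (fun _ => 1)
        (differentiable_const _) (Or.inl hz)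

theorem isRegularAt_mulDiff_gtFormula {a b : LPos n} {vbar : Vec n}
    (hv : IsOneSingular a b vbar) (z : Shift n) (r s : Fin n) (y : Shift n) :
    IsRegularAt a b vbar (mulDiff a b (gtFormula r s z) y) := by
  refine gtFormula_induction
    (P := fun f => IsRegularAt a b vbar (fun v => (v a.1 - v b.1) * f v)) ?_ ?_
    (fun p => ?_) (fun p => ?_) (fun m => isRegularAt_of_differentiable ?_) r s y
  · convert isRegularAt_zero a b vbar using 2
    simp
  · intro f g hf hg
    convert hf.add hg using 2
    simp [mul_add]
  · simpa only [neg_one_mul, ← raiseCoeff_eq] using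
      isRegularAt_mulDiff_gtCoeff hv (z := z) (rowSet n (p.1.row + 1)) (p := p) (-1)
  · simpa only [one_mul, ← lowerCoeff_eq] using
      isRegularAt_mulDiff_gtCoeff hv (z := z) (rowSet n (p.1.row - 1)) (p := p) 1
  · exact Differentiable.mul (by fun_prop) (differentiable_diagCoeff _ z)

theorem row_swap {a b : LPos n} (hrow : a.1.row = b.1.row) (p : Pos n) :
    (Equiv.swap a.1 b.1 p).row = p.row := by
  rcases eq_or_ne p a.1 with rfl | ha
  · rw [Equiv.swap_apply_left, hrow]
  · rcases eq_or_ne p b.1 with rfl | hb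
    · rw [Equiv.swap_apply_right, hrow]
    · rw [Equiv.swap_apply_of_ne_of_ne ha hb]

theorem val_swap (a b p : LPos n) : (Equiv.swap a b p).1 = Equiv.swap a.1 b.1 p.1 :=
  Subtype.val_injective.map_swap a b p

theorem swapVec_swap (a b : LPos n) (x : Vec n) (p : Pos n) :
    swapVec a b x (Equiv.swap a.1 b.1 p) = x p := by
  simp [swapVec]

theorem addShift_tau {a b : LPos n} (hrow : a.1.row = b.1.row) (v : Vec n) (z : Shift n) :
    addShift v (tau a b z) = swapVec a b (addShift (swapVec a b v) z) := by
  funext p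
  simp only [addShift, swapVec, row_swap hrow, Equiv.swap_apply_self]
  congr 1
  split_ifs with h
  · rw [tau]
    congr 2
    exact Subtype.ext (val_swap a b ⟨p, h⟩)
  · rfl

theorem prod_rowSet_swapVec {a b : LPos n} (hrow : a.1.row = b.1.row) (m : ℕ) (x : Vec n)
    (g : ℂ → ℂ) :
    ∏ q ∈ rowSet n m, g (swapVec a b x q) = ∏ q ∈ rowSet n m, g (x q) :=
  Finset.prod_equiv (Equiv.swap a.1 b.1) (fun q => by rw [mem_rowSet, mem_rowSet, row_swap hrow])
    fun q _ => rfl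

theorem sum_rowSet_swapVec {a b : LPos n} (hrow : a.1.row = b.1.row) (m : ℕ) (x : Vec n) :
    ∑ q ∈ rowSet n m, swapVec a b x q = ∑ q ∈ rowSet n m, x q :=
  Finset.sum_equiv (Equiv.swap a.1 b.1) (fun q => by rw [mem_rowSet, mem_rowSet, row_swap hrow])
    fun q _ => rfl

theorem gtCoeff_swap {a b : LPos n} (hrow : a.1.row = b.1.row) (m : ℕ) (p : Pos n) (x : Vec n) :
    gtCoeff (rowSet n m) (Equiv.swap a.1 b.1 p) (swapVec a b x) = gtCoeff (rowSet n m) p x := by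
  unfold gtCoeff
  rw [swapVec_swap, row_swap hrow, prod_rowSet_swapVec hrow m x (fun c => x p - c)]
  congr 1
  refine Finset.prod_equiv (Equiv.swap a.1 b.1) (fun q => ?_) fun q _ => rfl
  rw [Finset.mem_erase, Finset.mem_erase, mem_rowSet, mem_rowSet, row_swap hrow, Ne, Ne,
    Equiv.swap_apply_eq_iff]

theorem tau_add (a b : LPos n) (z w : Shift n) : tau a b (z + w) = tau a b z + tau a b w := rfl

theorem tau_sub (a b : LPos n) (z w : Shift n) : tau a b (z - w) = tau a b z - tau a b w := rfl

theorem tau_single (a b p : LPos n) :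
    tau a b (Pi.single p 1) = Pi.single (Equiv.swap a b p) 1 := by
  funext q
  unfold tau
  by_cases h : q = Equiv.swap a b p
  · rw [h, Equiv.swap_apply_self, Pi.single_eq_same, Pi.single_eq_same]
  · rw [Pi.single_eq_of_ne h, Pi.single_eq_of_ne]
    rwa [Ne, Equiv.swap_apply_eq_iff]

/-- The Gelfand–Tsetlin formulas are symmetric under `τ`. -/
theorem evalAt_gtFormula_tau {a b : LPos n} (hrow : a.1.row = b.1.row) (r s : Fin n)
    (v : Vec n) (z : Shift n) :
    evalAt v (gtFormula r s (tau a b z)) =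
      tauMap a b (evalAt (swapVec a b v) (gtFormula r s z)) := by
  have hfil : ∀ (m : ℕ) (p : LPos n), p ∈ Finset.univ.filter (fun p : LPos n => p.1.row = m) ↔
      Equiv.swap a b p ∈ Finset.univ.filter (fun p : LPos n => p.1.row = m) := by
    intro m p
    simp only [Finset.mem_filter, Finset.mem_univ, true_and]
    rw [val_swap, row_swap hrow]
  unfold gtFormula
  split_ifs
  · rw [map_sum, map_sum, map_sum]
    refine (Finset.sum_equiv (Equiv.swap a b) (hfil _) fun p _ => ?_).symm
    rw [evalAt_single, evalAt_single, map_smul, tauMap_Tab, tau_add, tau_single, addShift_tau hrow,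
      raiseCoeff_eq, raiseCoeff_eq, val_swap, gtCoeff_swap hrow, row_swap hrow]
  · rw [map_sum, map_sum, map_sum]
    refine (Finset.sum_equiv (Equiv.swap a b) (hfil _) fun p _ => ?_).symm
    rw [evalAt_single, evalAt_single, map_smul, tauMap_Tab, tau_sub, tau_single, addShift_tau hrow,
      lowerCoeff_eq, lowerCoeff_eq, val_swap, gtCoeff_swap hrow, row_swap hrow]
  · rw [evalAt_single, evalAt_single, map_smul, tauMap_Tab, addShift_tau hrow, diagCoeff,
      diagCoeff, sum_rowSet_swapVec hrow, sum_rowSet_swapVec hrow]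
  · simp

theorem exists_conjugate_algHom (a b : LPos n) {t : ℂ} (ht : t ≠ 0)
    (ρ : U n →ₐ[ℂ] Module.End ℂ (V n)) :
    ∃ R : U n →ₐ[ℂ] Module.End ℂ (V n),
      ∀ u, R u = ofGeneric a b t * ρ u * toGeneric a b t := by
  have h1 := ofGeneric_mul_toGeneric a b ht
  have h2 := toGeneric_mul_ofGeneric a b ht
  refine ⟨{ toFun := fun u => ofGeneric a b t * ρ u * toGeneric a b t, map_one' := ?_,
            map_mul' := ?_, map_zero' := ?_, map_add' := ?_, commutes' := ?_ }, fun u => rfl⟩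
  · rw [map_one, mul_one, h1]
  · intro x y
    rw [map_mul]
    calc ofGeneric a b t * (ρ x * ρ y) * toGeneric a b t
        = ofGeneric a b t * ρ x * 1 * ρ y * toGeneric a b t := by simp only [mul_one, mul_assoc]
      _ = _ := by rw [← h2]; simp only [mul_assoc]
  · rw [map_zero, mul_zero, zero_mul]
  · intro x y
    rw [map_add, mul_add, add_mul]
  · intro c
    rw [AlgHom.commutes, ← Algebra.commutes, mul_assoc, h1, mul_one]

/-- `ρ` is the strong limit, as `t → 0`, of the generic modules at `v̄ + t (δ^a - δ^b)`, in the
bases given by `toGeneric`. -/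
def IsGenericLimit (a b : LPos n) (vbar : Vec n) (ρ : U n →ₐ[ℂ] Module.End ℂ (V n)) : Prop :=
  ∃ R : ℂ → U n →ₐ[ℂ] Module.End ℂ (V n), (∀ u, OpLim (fun t => R t u) (ρ u)) ∧
    ∀ᶠ t in 𝓝[≠] (0 : ℂ), IsGeneric (curve a b vbar t) ∧ ∃ ρ', IsGTAction (curve a b vbar t) ρ' ∧
      ∀ u, R t u = ofGeneric a b t * ρ' u * toGeneric a b t

/-- The formulas for the singular module are the limits of the Gelfand–Tsetlin formulas at
`v̄ + t (δ^a - δ^b)`, and a limit of representations is a representation. -/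
theorem exists_singular_action {a b : LPos n} {vbar : Vec n} (hv : IsOneSingular a b vbar) :
    ∃ ρ, IsSingularGTAction a b vbar ρ ∧ IsGenericLimit a b vbar ρ := by
  have ex : ∀ t : ℂ, ∃ R : U n →ₐ[ℂ] Module.End ℂ (V n), t ≠ 0 ∧ IsGeneric (curve a b vbar t) →
      ∃ ρ', IsGTAction (curve a b vbar t) ρ' ∧
        ∀ u, R u = ofGeneric a b t * ρ' u * toGeneric a b t := by
    intro t
    by_cases h : t ≠ 0 ∧ IsGeneric (curve a b vbar t)
    · obtain ⟨ρ', hρ'⟩ := exists_isGTAction h.2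
      obtain ⟨R, hR⟩ := exists_conjugate_algHom a b h.1 ρ'
      exact ⟨R, fun _ => ⟨ρ', hρ', hR⟩⟩
    · exact ⟨UniversalEnvelopingAlgebra.lift ℂ
        (0 : Matrix (Fin n) (Fin n) ℂ →ₗ⁅ℂ⁆ Module.End ℂ (V n)), fun h' => absurd h' h⟩
  choose R hR using ex
  have hgen : ∀ᶠ t in 𝓝[≠] (0 : ℂ), IsGeneric (curve a b vbar t) ∧
      ∃ ρ', IsGTAction (curve a b vbar t) ρ' ∧
        ∀ u, R t u = ofGeneric a b t * ρ' u * toGeneric a b t := by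
    filter_upwards [eventually_isGeneric hv, self_mem_nhdsWithin] with t h1 h2
    exact ⟨h1, hR t ⟨h2, h1⟩⟩
  have limReg : ∀ r s : Fin n, r.val ≤ s.val + 1 → s.val ≤ r.val + 1 → ∀ z,
      HasLim (fun t => R t (E r s) (regTab a b z))
        (opD a b vbar (mulDiff a b (gtFormula r s z))) := by
    intro r s h1 h2 z
    refine (hasLim_reg hv.ne hv.eq _ (isRegularAt_mulDiff_gtFormula hv z r s)).congr ?_
    filter_upwards [hgen] with t ht
    obtain ⟨_, ρ', hρ', hRt⟩ := ht
    rw [hRt, Module.End.mul_apply, Module.End.mul_apply, toGeneric_regTab, map_add (ρ' (E r s)),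
      hρ' r s h1 h2, hρ' r s h1 h2, evalAt_gtFormula_tau hv.row_eq, swapVec_curve hv]
  have limDer : ∀ r s : Fin n, r.val ≤ s.val + 1 → s.val ≤ r.val + 1 → ∀ z, z a ≠ z b →
      HasLim (fun t => R t (E r s) (derTab a b z)) (opD a b vbar (gtFormula r s z)) := by
    intro r s h1 h2 z hz
    refine (hasLim_der hv.ne hv.eq _ (isRegularAt_gtFormula hv hz r s)).congr ?_
    filter_upwards [hgen] with t ht
    obtain ⟨_, ρ', hρ', hRt⟩ := ht
    rw [hRt, Module.End.mul_apply, Module.End.mul_apply, toGeneric_derTab, map_smul (ρ' (E r s)),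
      map_sub (ρ' (E r s)), hρ' r s h1 h2, hρ' r s h1 h2, evalAt_gtFormula_tau hv.row_eq,
      swapVec_curve hv]
  obtain ⟨ρ, hρ⟩ := exists_limit_algHom (R := R) fun r s h1 h2 => by
    refine ⟨_, opLim_of_Tab (x₀ := fun w => if w a ≤ w b then
      opD a b vbar (mulDiff a b (gtFormula r s w)) else opD a b vbar (gtFormula r s w))
      fun w => ?_⟩
    split_ifs with h
    · have hw : Tab w = regTab a b w := by rw [regTab, if_pos h]
      rw [hw]
      exact limReg r s h1 h2 w
    · have hw : Tab w = derTab a b w := by rw [derTab, if_pos (lt_of_not_ge h)]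
      rw [hw]
      exact limDer r s h1 h2 w (ne_of_gt (lt_of_not_ge h))
  refine ⟨ρ, ⟨fun r s h1 h2 z => ?_, fun r s h1 h2 z hz => ?_⟩, R, hρ, hgen⟩
  · exact (hρ (E r s) (regTab a b z)).unique (limReg r s h1 h2 z)
  · exact (hρ (E r s) (derTab a b z)).unique
      (limDer r s h1 h2 z fun h => hz (tau_eq_self a b z h))

/-- The action is determined by the formulas, as the generators generate `U(gl(n))`. -/
theorem IsSingularGTAction.unique {a b : LPos n} {vbar : Vec n}
    {ρ ρ' : U n →ₐ[ℂ] Module.End ℂ (V n)} (h : IsSingularGTAction a b vbar ρ)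
    (h' : IsSingularGTAction a b vbar ρ') : ρ = ρ' := by
  apply AlgHom.ext
  intro u
  induction u using U_induction with
  | hE r s h1 h2 =>
    apply end_ext
    intro w
    rw [tab_eq a b w]
    split_ifs with hw
    · rw [h.reg r s h1 h2, h'.reg r s h1 h2]
    · have hne : tau a b w ≠ w := by
        intro he
        have := congrFun he a
        rw [tau_left] at this
        omega
      rw [h.der r s h1 h2 w hne, h'.der r s h1 h2 w hne]
  | hc c => rw [AlgHom.commutes, AlgHom.commutes]
  | hadd x y hx hy => rw [map_add, map_add, hx, hy]
  | hmul x y hx hy => rw [map_mul, map_mul, hx, hy]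

end SingularGT

end

/-! ### Jordan blocks of the row polynomials -/

noncomputable section

namespace SingularGT

open Filter Topology

variable {n : ℕ}

theorem smoothExt_eventuallyEq_of_differentiable {a b : LPos n} (hab : a ≠ b) {vbar : Vec n}
    {g : Vec n → ℂ} (hg : Differentiable ℂ g) : smoothExt a b g =ᶠ[𝓝 vbar] g :=
  smoothExt_eventuallyEq hab (Eventually.of_forall fun x => hg x)
    (Eventually.of_forall fun _ _ => rfl)

theorem hasDerivAt_comp_curve {a b : LPos n} (hab : a ≠ b) (vbar : Vec n) {g : Vec n → ℂ}
    (hg : Differentiable ℂ g) :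
    HasDerivAt (fun t => g (curve a b vbar t)) (2 * scalarD a b vbar g) 0 := by
  have hD : 2 * scalarD a b vbar g =
      fderiv ℂ g vbar (Pi.single a.1 1 - Pi.single b.1 1) := by
    rw [scalarD, (smoothExt_eventuallyEq_of_differentiable hab hg).fderiv_eq, map_sub]
    ring
  have hgd : HasFDerivAt g (fderiv ℂ g vbar) (curve a b vbar 0) := by
    rw [curve_zero]
    exact (hg vbar).hasFDerivAt
  rw [hD]
  exact hgd.comp_hasDerivAt (0 : ℂ) (hasDerivAt_curve a b vbar 0)

theorem scalarD_sub_mul {a b : LPos n} {vbar : Vec n} (hv : IsOneSingular a b vbar)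
    {g : Vec n → ℂ} (hg : Differentiable ℂ g) :
    scalarD a b vbar (fun v => (v a.1 - v b.1) * g v) = g vbar := by
  have h1 := hasDerivAt_comp_curve hv.ne vbar (g := fun v => (v a.1 - v b.1) * g v)
    (Differentiable.mul (by fun_prop) hg)
  have h2 : HasDerivAt (fun t : ℂ => (2 * t) * g (curve a b vbar t))
      (2 * 1 * g (curve a b vbar 0) + 2 * 0 * (2 * scalarD a b vbar g)) 0 :=
    ((hasDerivAt_id (0 : ℂ)).const_mul 2).mul (hasDerivAt_comp_curve hv.ne vbar hg)
  have h3 : (fun t : ℂ => (2 * t) * g (curve a b vbar t)) =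
      fun t => (curve a b vbar t a.1 - curve a b vbar t b.1) * g (curve a b vbar t) := by
    funext t
    rw [curve_left hv.ne, curve_right hv.ne, hv.eq]
    ring
  rw [h3] at h2
  have h4 := h1.unique h2
  rw [curve_zero] at h4
  linear_combination h4 / 2

theorem opD_single {a b : LPos n} (hab : a ≠ b) (vbar : Vec n) (z : Shift n) (g : Vec n → ℂ) :
    opD a b vbar (Finsupp.single z g) =
      scalarD a b vbar g • regTab a b z + smoothExt a b g vbar • derTab a b z := by
  rw [opD_eq_sum hab vbar _ Finsupp.support_single_subset, Finset.sum_singleton,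
    Finsupp.single_eq_same]

/-- The limit of an element of `U(gl(n))` that is diagonal on the generic modules: it is scalar on
`T(v̄ + z)`, and a Jordan block on `T(v̄ + z)`, `𝒟T(v̄ + z)` as soon as the derivative of the
eigenvalue is nonzero. -/
theorem IsGenericLimit.exists_jordan {a b : LPos n} {vbar : Vec n} (hv : IsOneSingular a b vbar)
    {ρ : U n →ₐ[ℂ] Module.End ℂ (V n)} (hρ : IsGenericLimit a b vbar ρ) {γ : Vec n → ℂ}
    (hγ : γ ∈ eigenfunctions n) (hsym : ∀ x, γ (swapVec a b x) = γ x)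
    (hd : Differentiable ℂ γ) :
    ∃ u, ∀ z, ρ u (regTab a b z) = γ (addShift vbar z) • regTab a b z ∧
      ρ u (derTab a b z) = γ (addShift vbar z) • derTab a b z +
        scalarD a b vbar (fun v => γ (addShift v z)) • regTab a b z := by
  obtain ⟨u, hu⟩ := hγ
  obtain ⟨R, hR, hgen⟩ := hρ
  refine ⟨u, fun z => ?_⟩
  have hg : Differentiable ℂ (fun v : Vec n => γ (addShift v z)) :=
    hd.comp (differentiable_pi.mpr fun p => differentiable_addShift_apply z p)
  have hg' : Differentiable ℂ (fun v : Vec n => (v a.1 - v b.1) * γ (addShift v z)) :=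
    Differentiable.mul (by fun_prop) hg
  have hmul : mulDiff a b (Finsupp.single z fun v : Vec n => γ (addShift v z)) =
      Finsupp.single z fun v => (v a.1 - v b.1) * γ (addShift v z) :=
    Finsupp.mapRange_single
  have hsingle : ∀ {f : Vec n → ℂ}, Differentiable ℂ f → ∀ y,
      IsRegularAt a b vbar ((Finsupp.single z f : Shift n →₀ (Vec n → ℂ)) y) := by
    intro f hf y
    rw [Finsupp.single_apply]
    split_ifs
    · exact isRegularAt_of_differentiable hf
    · exact isRegularAt_zero a b vbar
  have hact : ∀ {t : ℂ} {ρ' : U n →ₐ[ℂ] Module.End ℂ (V n)}, IsGeneric (curve a b vbar t) →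
      IsGTAction (curve a b vbar t) ρ' →
      ρ' u (Tab z) = evalAt (curve a b vbar t) (Finsupp.single z fun v => γ (addShift v z)) ∧
      ρ' u (Tab (tau a b z)) = tauMap a b (evalAt (curve a b vbar (-t))
        (Finsupp.single z fun v => γ (addShift v z))) := by
    intro t ρ' h1 h2
    rw [hu _ h1 _ h2, wshift_Tab, wshift_Tab, evalAt_single, evalAt_single, map_smul, tauMap_Tab,
      addShift_tau hv.row_eq, hsym, swapVec_curve hv, add_zero, add_zero]
    exact ⟨rfl, rfl⟩
  constructor
  · have h1 := hasLim_reg hv.ne hv.eq (Finsupp.single z fun v => γ (addShift v z))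
      (hmul ▸ hsingle hg')
    have h0 : smoothExt a b (fun v => (v a.1 - v b.1) * γ (addShift v z)) vbar = 0 := by
      rw [(smoothExt_eventuallyEq_of_differentiable hv.ne hg').self_of_nhds]
      simp only [hv.eq, sub_self, zero_mul]
    rw [hmul, opD_single hv.ne, scalarD_sub_mul hv hg, h0, zero_smul, add_zero] at h1
    refine (hR u _).unique (h1.congr ?_)
    filter_upwards [hgen] with t ht
    obtain ⟨h2, ρ', h3, h4⟩ := ht
    rw [h4, Module.End.mul_apply, Module.End.mul_apply, toGeneric_regTab, map_add (ρ' u),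
      (hact h2 h3).1, (hact h2 h3).2]
  · have h1 := hasLim_der hv.ne hv.eq (Finsupp.single z fun v => γ (addShift v z)) (hsingle hg)
    rw [opD_single hv.ne,
      (smoothExt_eventuallyEq_of_differentiable hv.ne hg).self_of_nhds, add_comm] at h1
    refine (hR u _).unique (h1.congr ?_)
    filter_upwards [hgen] with t ht
    obtain ⟨h2, ρ', h3, h4⟩ := ht
    rw [h4, Module.End.mul_apply, Module.End.mul_apply, toGeneric_derTab, map_smul (ρ' u),
      map_sub (ρ' u), (hact h2 h3).1, (hact h2 h3).2]

/-- The value at `x` of `c ↦ ∏_q (c - x_q)`, `q` in the `m`-th row. -/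
def rowEval (m : ℕ) (c : ℂ) (x : Vec n) : ℂ := ∏ q ∈ rowSet n m, (c - x q)

theorem differentiable_rowEval (m : ℕ) (c : ℂ) :
    Differentiable ℂ (rowEval m c : Vec n → ℂ) := by
  unfold rowEval
  fun_prop

theorem rowEval_swapVec {a b : LPos n} (hrow : a.1.row = b.1.row) (m : ℕ) (c : ℂ) (x : Vec n) :
    rowEval m c (swapVec a b x) = rowEval m c x :=
  prod_rowSet_swapVec hrow m x fun d => c - d

theorem IsGenericLimit.exists_jordan_rowEval {a b : LPos n} {vbar : Vec n}
    (hv : IsOneSingular a b vbar) {ρ : U n →ₐ[ℂ] Module.End ℂ (V n)}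
    (hρ : IsGenericLimit a b vbar ρ) {m : ℕ} (hm : m ≤ n) (c : ℂ) :
    ∃ u, ∀ z, ρ u (regTab a b z) = rowEval m c (addShift vbar z) • regTab a b z ∧
      ρ u (derTab a b z) = rowEval m c (addShift vbar z) • derTab a b z +
        scalarD a b vbar (fun v => rowEval m c (addShift v z)) • regTab a b z :=
  hρ.exists_jordan hv (eval_rowPoly_mem m hm c) (rowEval_swapVec hv.row_eq m c)
    (differentiable_rowEval m c)

/-- For `z_a ≠ z_b` the zero `(v̄ + z)_a` of the row polynomial is simple, so its value there has
nonzero derivative. -/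
theorem scalarD_rowEval_ne_zero {a b : LPos n} {vbar : Vec n} (hv : IsOneSingular a b vbar)
    {z : Shift n} (hz : z a ≠ z b) :
    scalarD a b vbar (fun v => rowEval a.1.row (addShift vbar z a.1) (addShift v z)) ≠ 0 := by
  set c := addShift vbar z a.1 with hc
  let P : Vec n → ℂ := fun v => ∏ q ∈ (rowSet n a.1.row).erase a.1, (c - addShift v z q)
  have hadd := differentiable_addShift_apply z (n := n)
  have hP : Differentiable ℂ P := by
    simp only [P]
    fun_prop
  have hg : Differentiable ℂ (fun v : Vec n => rowEval a.1.row c (addShift v z)) := by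
    unfold rowEval
    fun_prop
  have h1 := hasDerivAt_comp_curve hv.ne vbar hg
  have h2 : HasDerivAt (fun t : ℂ => (-t) * P (curve a b vbar t))
      ((-1) * P (curve a b vbar 0) + (-0) * (2 * scalarD a b vbar P)) 0 :=
    (hasDerivAt_neg (0 : ℂ)).mul (hasDerivAt_comp_curve hv.ne vbar hP)
  have h3 : (fun t : ℂ => (-t) * P (curve a b vbar t)) =
      fun t => rowEval a.1.row c (addShift (curve a b vbar t) z) := by
    funext t
    rw [rowEval, ← Finset.mul_prod_erase _ _ (mem_rowSet.mpr (rfl : a.1.row = a.1.row))]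
    congr 1
    rw [hc, addShift, addShift, curve_left hv.ne]
    ring
  rw [h3] at h2
  have h4 := h1.unique h2
  rw [curve_zero] at h4
  have hP0 : P vbar ≠ 0 := by
    rw [Finset.prod_ne_zero_iff]
    intro q hq
    rw [Finset.mem_erase, mem_rowSet] at hq
    exact addShift_sub_ne_zero hv z hq.2.symm a.2 hq.1.symm (Or.inl hz)
  intro h0
  rw [h0] at h4
  apply hP0
  linear_combination h4

theorem IsOneSingular.eq_of_addShift_eq {a b : LPos n} {vbar : Vec n}
    (hv : IsOneSingular a b vbar) {y w : Shift n} {p q : LPos n} (hrow : p.1.row = q.1.row)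
    (h : addShift vbar y p.1 = addShift vbar w q.1) :
    y p = w q ∧ (p = q ∨ (p = a ∧ q = b) ∨ (p = b ∧ q = a)) := by
  simp only [addShift, dif_pos p.2, dif_pos q.2] at h
  have hpq : p = q ∨ (p = a ∧ q = b) ∨ (p = b ∧ q = a) := by
    by_contra hne
    push Not at hne
    refine hv.sub_ne_int hrow p.2 (fun e => hne.1 (Subtype.ext e))
      (fun e => hne.2.1 (Subtype.ext e.1) (Subtype.ext e.2))
      (fun e => hne.2.2 (Subtype.ext e.1) (Subtype.ext e.2)) (w q - y p) ?_
    push_cast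
    linear_combination h
  have hval : vbar p.1 = vbar q.1 := by
    rcases hpq with rfl | ⟨rfl, rfl⟩ | ⟨rfl, rfl⟩
    · rfl
    · exact hv.eq
    · exact hv.eq.symm
  refine ⟨?_, hpq⟩
  rw [hval] at h
  exact_mod_cast add_left_cancel h

/-- The row polynomials of `v̄ + w` determine `w` up to `τ`. -/
theorem exists_rowEval_ne {a b : LPos n} {vbar : Vec n} (hv : IsOneSingular a b vbar)
    {y w : Shift n} (h1 : y ≠ w) (h2 : y ≠ tau a b w) :
    ∃ m ≤ n, ∃ c, rowEval m c (addShift vbar w) ≠ rowEval m c (addShift vbar y) := by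
  by_contra! H
  have key : ∀ {y w : Shift n}, (∀ m ≤ n, ∀ c,
      rowEval m c (addShift vbar w) = rowEval m c (addShift vbar y)) → ∀ p : LPos n,
      ∃ q : LPos n, y p = w q ∧ (p = q ∨ (p = a ∧ q = b) ∨ (p = b ∧ q = a)) := by
    intro y w H p
    have h0 := H p.1.row p.2.le (addShift vbar y p.1)
    have h0' : rowEval p.1.row (addShift vbar y p.1) (addShift vbar y) = 0 :=
      Finset.prod_eq_zero (mem_rowSet.mpr rfl) (sub_self _)
    rw [h0', rowEval, Finset.prod_eq_zero_iff] at h0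
    obtain ⟨q, hq, h0⟩ := h0
    rw [mem_rowSet] at hq
    exact ⟨⟨q, hq ▸ p.2⟩, hv.eq_of_addShift_eq hq.symm (sub_eq_zero.mp h0)⟩
  have hpair : ∀ {y w : Shift n}, (∀ m ≤ n, ∀ c,
      rowEval m c (addShift vbar w) = rowEval m c (addShift vbar y)) →
      (y a = w a ∨ y a = w b) ∧ (y b = w a ∨ y b = w b) := by
    intro y w H
    obtain ⟨q, hq, hq'⟩ := key H a
    obtain ⟨r, hr, hr'⟩ := key H b
    constructor
    · rcases hq' with rfl | ⟨-, rfl⟩ | ⟨-, rfl⟩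
      · exact Or.inl hq
      · exact Or.inr hq
      · exact Or.inl hq
    · rcases hr' with rfl | ⟨-, rfl⟩ | ⟨-, rfl⟩
      · exact Or.inr hr
      · exact Or.inr hr
      · exact Or.inl hr
  have hother : ∀ p, p ≠ a → p ≠ b → y p = w p := by
    intro p ha hb
    obtain ⟨q, hq, rfl | ⟨h, -⟩ | ⟨h, -⟩⟩ := key H p
    · exact hq
    · exact absurd h ha
    · exact absurd h hb
  have e1 := hpair H
  have e2 := hpair fun m hm c => (H m hm c).symm
  have e3 : (y a = w a ∧ y b = w b) ∨ (y a = w b ∧ y b = w a) := by omega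
  rcases e3 with ⟨ha, hb⟩ | ⟨ha, hb⟩
  · apply h1
    funext p
    by_cases hpa : p = a
    · rw [hpa, ha]
    by_cases hpb : p = b
    · rw [hpb, hb]
    exact hother p hpa hpb
  · apply h2
    funext p
    by_cases hpa : p = a
    · rw [hpa, ha, tau_left]
    by_cases hpb : p = b
    · rw [hpb, hb, tau_right]
    rw [hother p hpa hpb, tau, Equiv.swap_apply_of_ne_of_ne hpa hpb]

end SingularGT

end

/-! ### Submodules are spanned by tableaux -/

noncomputable section

namespace SingularGT

variable {n : ℕ}

/-- The span of `T(v̄ + z)` and `𝒟T(v̄ + z)`, that is, of `Tab(z)` and `Tab(τ(z))`. -/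
def block (a b : LPos n) (z : Shift n) : Submodule ℂ (V n) :=
  Submodule.span ℂ {regTab a b z, derTab a b z}

theorem regTab_mem_block (a b : LPos n) (z : Shift n) : regTab a b z ∈ block a b z :=
  Submodule.subset_span (Set.mem_insert _ _)

theorem derTab_mem_block (a b : LPos n) (z : Shift n) : derTab a b z ∈ block a b z :=
  Submodule.subset_span (Set.mem_insert_of_mem _ rfl)

theorem block_tau (a b : LPos n) (z : Shift n) : block a b (tau a b z) = block a b z := by
  have h : ∀ z, block a b (tau a b z) ≤ block a b z := by
    intro z
    rw [block, Submodule.span_le, Set.insert_subset_iff, Set.singleton_subset_iff, regTab_tau,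
      derTab_tau]
    exact ⟨regTab_mem_block a b z, neg_mem (derTab_mem_block a b z)⟩
  refine le_antisymm (h z) ?_
  have := h (tau a b z)
  rwa [tau_tau] at this

theorem Tab_mem_block (a b : LPos n) (z : Shift n) : Tab z ∈ block a b z := by
  rw [tab_eq a b z]
  split_ifs
  · exact regTab_mem_block a b z
  · exact derTab_mem_block a b z

/-- The polynomial `(X - μ)² (c₀ + c₁ (X - λ))` at an operator, on a vector `x` with
`u x = s x + r`, `u r = s r`. -/
theorem apply_jordan (ρ : U n →ₐ[ℂ] Module.End ℂ (V n)) {u : U n} {s : ℂ} {x r : V n}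
    (hx : ρ u x = s • x + r) (hr : ρ u r = s • r) (l m c₀ c₁ : ℂ) :
    ρ ((u - m • 1) * ((u - m • 1) * (c₀ • 1 + c₁ • (u - l • 1)))) x =
      ((s - m) ^ 2 * (c₀ + c₁ * (s - l))) • x +
        (2 * (s - m) * (c₀ + c₁ * (s - l)) + (s - m) ^ 2 * c₁) • r := by
  simp only [map_mul, map_add, map_sub, map_smul, map_one, Module.End.mul_apply,
    LinearMap.add_apply, LinearMap.sub_apply, LinearMap.smul_apply, Module.End.one_apply, hx, hr]
  module

/-- Two different blocks are separated by `U(gl(n))`: as the minimal polynomials of a suitable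
element on the two blocks are powers of different linear factors, a polynomial in it is the
identity on one block and zero on the other. -/
theorem IsGenericLimit.exists_separating {a b : LPos n} {vbar : Vec n}
    (hv : IsOneSingular a b vbar) {ρ : U n →ₐ[ℂ] Module.End ℂ (V n)}
    (hρ : IsGenericLimit a b vbar ρ) {y w : Shift n} (h1 : y ≠ w) (h2 : y ≠ tau a b w) :
    ∃ u, (∀ x ∈ block a b w, ρ u x = x) ∧ (∀ x ∈ block a b y, ρ u x = 0) ∧
      ∀ z, ∀ x ∈ block a b z, ρ u x ∈ block a b z := by
  obtain ⟨k, hk, c, hne⟩ := exists_rowEval_ne hv h1 h2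
  obtain ⟨u, hu⟩ := hρ.exists_jordan_rowEval hv hk c
  set f : Shift n → ℂ := fun z => rowEval k c (addShift vbar z) with hf
  have hd : f w - f y ≠ 0 := sub_ne_zero.mpr hne
  have hblock : ∀ z, ∀ x ∈ block a b z, ∃ r ∈ block a b z,
      ρ u x = f z • x + r ∧ ρ u r = f z • r := by
    intro z x hx
    obtain ⟨α, β, rfl⟩ := Submodule.mem_span_pair.mp hx
    refine ⟨β • scalarD a b vbar (fun v => rowEval k c (addShift v z)) • regTab a b z,
      Submodule.smul_mem _ _ (Submodule.smul_mem _ _ (regTab_mem_block a b z)), ?_, ?_⟩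
    · rw [map_add, map_smul, map_smul, (hu z).1, (hu z).2]
      module
    · rw [map_smul, map_smul, (hu z).1]
      module
  -- The coefficients make the polynomial congruent to `1` modulo `(X - f w)²`.
  refine ⟨(u - f y • 1) * ((u - f y • 1) * ((1 / (f w - f y) ^ 2) • 1 +
    (-2 / (f w - f y) ^ 3) • (u - f w • 1))), fun x hx => ?_, fun x hx => ?_, fun z x hx => ?_⟩
  · obtain ⟨r, -, h3, h4⟩ := hblock w x hx
    rw [apply_jordan ρ h3 h4]
    have e1 : (f w - f y) ^ 2 * (1 / (f w - f y) ^ 2 + -2 / (f w - f y) ^ 3 * (f w - f w)) = 1 := by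
      rw [sub_self, mul_zero, add_zero, mul_one_div_cancel (pow_ne_zero 2 hd)]
    have e2 : 2 * (f w - f y) * (1 / (f w - f y) ^ 2 + -2 / (f w - f y) ^ 3 * (f w - f w)) +
        (f w - f y) ^ 2 * (-2 / (f w - f y) ^ 3) = 0 := by
      rw [sub_self]
      field_simp
      ring
    rw [e1, e2, one_smul, zero_smul, add_zero]
  · obtain ⟨r, -, h3, h4⟩ := hblock y x hx
    rw [apply_jordan ρ h3 h4, sub_self]
    module
  · obtain ⟨r, hr, h3, h4⟩ := hblock z x hx
    rw [apply_jordan ρ h3 h4]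
    exact add_mem (Submodule.smul_mem _ _ hx) (Submodule.smul_mem _ _ hr)

/-- A submodule contains the components of its elements in the blocks. -/
theorem IsGenericLimit.component_mem {a b : LPos n} {vbar : Vec n}
    (hv : IsOneSingular a b vbar) {ρ : U n →ₐ[ℂ] Module.End ℂ (V n)}
    (hρ : IsGenericLimit a b vbar ρ) {W : Submodule ℂ (V n)} (hW : ∀ u, ∀ x ∈ W, ρ u x ∈ W)
    {w : Shift n} {x₀ : V n} (hx₀ : x₀ ∈ block a b w) (S : Finset (Shift n))
    (hS : ∀ y ∈ S, y ≠ w ∧ y ≠ tau a b w) (x : Shift n → V n)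
    (hx : ∀ y ∈ S, x y ∈ block a b y) (hmem : x₀ + ∑ y ∈ S, x y ∈ W) : x₀ ∈ W := by
  classical
  induction S using Finset.induction_on generalizing x with
  | empty => simpa using hmem
  | insert y S hy ih =>
    obtain ⟨u, hu1, hu2, hu3⟩ := hρ.exists_separating hv (hS y (Finset.mem_insert_self y S)).1
      (hS y (Finset.mem_insert_self y S)).2
    refine ih (fun z hz => hS z (Finset.mem_insert_of_mem hz)) (fun z => ρ u (x z))
      (fun z hz => hu3 z _ (hx z (Finset.mem_insert_of_mem hz))) ?_
    have := hW u _ hmem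
    rwa [map_add, hu1 _ hx₀, map_sum, Finset.sum_insert hy,
      hu2 _ (hx y (Finset.mem_insert_self y S)), zero_add] at this

/-- If `w_a ≠ w_b`, a submodule that contains `α T(v̄ + w) + β 𝒟T(v̄ + w)` contains `T(v̄ + w)`, unless
`α = β = 0`, and `𝒟T(v̄ + w)` if `β ≠ 0`: some element of `U(gl(n))` is a nontrivial Jordan block on
the span of the two. -/
theorem IsGenericLimit.regTab_mem_and_derTab_mem {a b : LPos n} {vbar : Vec n}
    (hv : IsOneSingular a b vbar) {ρ : U n →ₐ[ℂ] Module.End ℂ (V n)}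
    (hρ : IsGenericLimit a b vbar ρ) {W : Submodule ℂ (V n)} (hW : ∀ u, ∀ x ∈ W, ρ u x ∈ W)
    {w : Shift n} (hw : w a ≠ w b) {α β : ℂ}
    (hmem : α • regTab a b w + β • derTab a b w ∈ W) :
    (α ≠ 0 ∨ β ≠ 0 → regTab a b w ∈ W) ∧ (β ≠ 0 → derTab a b w ∈ W) := by
  have hreg : β ≠ 0 → regTab a b w ∈ W := by
    intro hβ
    obtain ⟨u, hu⟩ := hρ.exists_jordan_rowEval hv a.2.le (addShift vbar w a.1)
    have hκ := scalarD_rowEval_ne_zero hv hw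
    have h1 := sub_mem (hW u _ hmem)
      (W.smul_mem (rowEval a.1.row (addShift vbar w a.1) (addShift vbar w)) hmem)
    rw [map_add, map_smul, map_smul, (hu w).1, (hu w).2] at h1
    rw [← Submodule.smul_mem_iff W (mul_ne_zero hβ hκ)]
    convert h1 using 1
    module
  refine ⟨?_, fun hβ => ?_⟩
  · intro h
    by_cases hβ : β = 0
    · have hα := h.resolve_right (not_not.mpr hβ)
      rwa [hβ, zero_smul, add_zero, Submodule.smul_mem_iff W hα] at hmem
    · exact hreg hβ
  · have h1 := sub_mem hmem (W.smul_mem α (hreg hβ))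
    rwa [add_sub_cancel_left, Submodule.smul_mem_iff W hβ] at h1

/-- A submodule contains the basis vectors that occur in its elements. -/
theorem IsGenericLimit.Tab_mem {a b : LPos n} {vbar : Vec n} (hv : IsOneSingular a b vbar)
    {ρ : U n →ₐ[ℂ] Module.End ℂ (V n)} (hρ : IsGenericLimit a b vbar ρ)
    {W : Submodule ℂ (V n)} (hW : ∀ u, ∀ x ∈ W, ρ u x ∈ W) {x : V n} (hx : x ∈ W)
    {w : Shift n} (hxw : x w ≠ 0) : Tab w ∈ W := by
  classical
  have hsub : ({w, tau a b w} : Finset (Shift n)) ⊆ x.support ∪ {w, tau a b w} :=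
    Finset.subset_union_right
  have hcomp : ∑ y ∈ ({w, tau a b w} : Finset (Shift n)), x y • Tab y ∈ W := by
    refine hρ.component_mem hv hW (w := w) (sum_mem fun y hy => Submodule.smul_mem _ _ ?_)
      ((x.support ∪ {w, tau a b w}) \ {w, tau a b w}) (fun y hy => ?_) (fun y => x y • Tab y)
      (fun y _ => Submodule.smul_mem _ _ (Tab_mem_block a b y)) ?_
    · rw [Finset.mem_insert, Finset.mem_singleton] at hy
      rcases hy with rfl | rfl
      · exact Tab_mem_block a b y
      · rw [← block_tau]
        exact Tab_mem_block a b _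
    · simpa using (Finset.mem_sdiff.mp hy).2
    · rw [add_comm, Finset.sum_sdiff hsub, ← eq_sum_Tab x Finset.subset_union_left]
      exact hx
  rcases lt_trichotomy (w a) (w b) with h | h | h
  · have hne : w ≠ tau a b w := fun e => by
      have := congrFun e a
      rw [tau_left] at this
      omega
    have h1 : Tab w = regTab a b w := by rw [regTab, if_pos h.le]
    have h2 : Tab (tau a b w) = -derTab a b w := by
      rw [derTab, if_neg h.not_gt, if_neg h.ne, neg_neg]
    rw [Finset.sum_pair hne, h2, smul_neg, ← neg_smul, h1] at hcomp
    rw [h1]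
    exact (hρ.regTab_mem_and_derTab_mem hv hW h.ne hcomp).1 (Or.inl hxw)
  · rwa [tau_eq_self a b w h, Finset.pair_eq_singleton, Finset.sum_singleton,
      Submodule.smul_mem_iff W hxw] at hcomp
  · have hne : w ≠ tau a b w := fun e => by
      have := congrFun e a
      rw [tau_left] at this
      omega
    have h1 : Tab w = derTab a b w := by rw [derTab, if_pos h]
    have h2 : Tab (tau a b w) = regTab a b w := by rw [regTab, if_neg h.not_ge]
    rw [Finset.sum_pair hne, h2, h1, add_comm] at hcomp
    rw [h1]
    exact (hρ.regTab_mem_and_derTab_mem hv hW h.ne' hcomp).2 hxw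

/-- The elements `u x` form a submodule, to which `Tab_mem` applies. -/
theorem IsGenericLimit.exists_apply_eq_Tab {a b : LPos n} {vbar : Vec n}
    (hv : IsOneSingular a b vbar) {ρ : U n →ₐ[ℂ] Module.End ℂ (V n)}
    (hρ : IsGenericLimit a b vbar ρ) {x : V n} {u : U n} {w : Shift n} (h : ρ u x w ≠ 0) :
    ∃ u', ρ u' x = Tab w := by
  have hW : ∀ u, ∀ y ∈ LinearMap.range ((LinearMap.applyₗ x).comp ρ.toLinearMap),
      ρ u y ∈ LinearMap.range ((LinearMap.applyₗ x).comp ρ.toLinearMap) := by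
    rintro u _ ⟨u', rfl⟩
    exact ⟨u * u', by simp⟩
  exact hρ.Tab_mem hv hW ⟨u, rfl⟩ h

end SingularGT

end

theorem mainTheorem3 (n : ℕ) (a b : SingularGT.LPos n) (vbar : SingularGT.Vec n)
    (hv : SingularGT.IsOneSingular a b vbar) :
    (∃! ρ : SingularGT.U n →ₐ[ℂ] Module.End ℂ (SingularGT.V n),
      SingularGT.IsSingularGTAction a b vbar ρ) ∧
    ∀ ρ : SingularGT.U n →ₐ[ℂ] Module.End ℂ (SingularGT.V n),
      SingularGT.IsSingularGTAction a b vbar ρ →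
        (∀ z w : SingularGT.Shift n, SingularGT.Prec ρ z w →
          ∃ u : SingularGT.U n, ρ u (SingularGT.Tab z) = SingularGT.Tab w) ∧
        (∀ z : SingularGT.Shift n, SingularGT.Prec ρ z z) ∧
        (∀ x y z : SingularGT.Shift n,
          SingularGT.Prec ρ x y → SingularGT.Prec ρ y z → SingularGT.Prec ρ x z) := by
  obtain ⟨ρ₀, hρ₀, hlim⟩ := SingularGT.exists_singular_action hv
  refine ⟨⟨ρ₀, hρ₀, fun ρ hρ => hρ.unique hρ₀⟩, fun ρ hρ => ?_⟩
  obtain rfl := hρ.unique hρ₀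
  have h1 : ∀ z w : SingularGT.Shift n, SingularGT.Prec ρ z w →
      ∃ u : SingularGT.U n, ρ u (SingularGT.Tab z) = SingularGT.Tab w := by
    rintro z w ⟨u, hu⟩
    exact hlim.exists_apply_eq_Tab hv hu
  refine ⟨h1, fun z => ⟨1, ?_⟩, fun x y z hxy hyz => ?_⟩
  · simp [SingularGT.Tab]
  · obtain ⟨u, hu⟩ := h1 x y hxy
    obtain ⟨u', hu'⟩ := hyz
    exact ⟨u' * u, by rwa [map_mul, Module.End.mul_apply, hu]⟩
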